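/- A \emph{fence} is a nonempty compact metrizable space each of whose connected components is either a single point or an arc (a space homeomorphic to $[0,1]$). The components that are arcs are called \emph{arc components}. A fence $Y$ is \emph{smooth} if there is a partial order on $Y$, closed as a subset of $Y\times Y$, whose restriction to each connected component of $Y$ is total. Consider the language with two binary relation symbols $R$ and $\le$. A \emph{topological structure} is a zero-dimensional compact metrizable space with closed interpretations of $R$ and $\le$; finite structures carry the discrete topology. An \emph{epimorphism} $\varphi:A\to B$ is a continuous surjection with $(\varphi\times\varphi)[R^A]=R^B$ and $(\varphi\times\varphi)[\le^A]=\le^B$; an automorphism of $A$ is a bijective epimorphism $A\to A$. Let $\mathcal F$ be the family of all nonempty finite structures $P$ such that $\le^P$ is a partial order, $a\mathrel{R^P}b$ holds if and only if $a=b$ or one of $a,b$ is an immediate $\le^P$-successor of the other, and the Hasse diagram, that is, the undirected graph on $P$ joining distinct $R^P$-related points, has no cycles. A \emph{projective Fraïssé limit} of $\mathcal F$ is a topological structure $\mathbb F$ such that 1. every $A\in\mathcal F$ admits an epimorphism $\mathbb F\to A$; 2. for every covering $\mathcal U$ of $\mathbb F$ by clopen sets there are $A\in\mathcal F$ and an epimorphism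 $\varphi:\mathbb F\to A$ such that each $\varphi^{-1}(a)$, $a\in A$, is contained in some element of $\mathcal U$; 3. for all $A\in\mathcal F$ and epimorphisms $\varphi_1,\varphi_2:\mathbb F\to A$ there is an automorphism $\psi$ of $\mathbb F$ with $\varphi_2=\varphi_1\psi$. A \emph{Fraïssé fence} is a space homeomorphic to the quotient $\mathbb F/R^{\mathbb F}$, where $\mathbb F$ is a projective Fraïssé limit of $\mathcal F$ (unique up to isomorphism) and $R^{\mathbb F}$ is an equivalence relation on $\mathbb F$. **Theorem.** Let $Y$ be a (nonempty) smooth fence. Then $Y$ is a Fraïssé fence if and only if for any two open sets $O,O'\subseteq Y$ which meet a common connected component of $Y$ there is an arc component of $Y$ with one endpoint in $O$ and the other endpoint in $O'$. -/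

import Mathlib

namespace FraisseFence

universe u v

/-- Structures for the relational language with two binary relation symbols `R` and `≤`. -/
class LRStructure (X : Type u) where
  /-- interpretation of `R` -/
  R : X → X → Prop
  /-- interpretation of `≤` -/
  le : X → X → Prop

/-- A topological structure: a zero-dimensional (the clopen sets form a basis) compact metrizable
space on which the interpretations of the relation symbols are closed. -/
structure IsTopStructure (X : Type u) [TopologicalSpace X] [LRStructure X] : Prop where
  compact : CompactSpace X
  metrizable : TopologicalSpace.MetrizableSpace X
  zeroDim : TopologicalSpace.IsTopologicalBasis {s : Set X | IsClopen s}
  isClosed_R : IsClosed {p : X × X | LRStructure.R p.1 p.2}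
  isClosed_le : IsClosed {p : X × X | LRStructure.le p.1 p.2}

/-- An epimorphism: a continuous surjection such that the relations of the codomain are exactly the
images of the relations of the domain. -/
structure IsEpi {X : Type u} {Y : Type v} [TopologicalSpace X] [LRStructure X]
    [TopologicalSpace Y] [LRStructure Y] (φ : X → Y) : Prop where
  continuous : Continuous φ
  surjective : Function.Surjective φ
  R_iff : ∀ y y' : Y, LRStructure.R y y' ↔ ∃ x x' : X, φ x = y ∧ φ x' = y' ∧ LRStructure.R x x'
  le_iff : ∀ y y' : Y, LRStructure.le y y' ↔ ∃ x x' : X, φ x = y ∧ φ x' = y' ∧ LRStructure.le x x'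

/-- An automorphism: a bijective epimorphism of a topological structure onto itself. -/
def IsAut {X : Type u} [TopologicalSpace X] [LRStructure X] (ψ : X → X) : Prop :=
  IsEpi ψ ∧ Function.Bijective ψ

/-- `b` is an immediate `≤`-successor of `a` (the case `a = b` is allowed). -/
def ImmSucc {A : Type u} [LRStructure A] (a b : A) : Prop :=
  LRStructure.le a b ∧ ∀ c : A, LRStructure.le a c → LRStructure.le c b → c = a ∨ c = b

/-- A Hasse partial order: `≤` is a partial order and `R` is its Hasse diagram
(with loops at all points). -/
structure IsHPO (A : Type u) [LRStructure A] : Prop where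
  le_refl : ∀ a : A, LRStructure.le a a
  le_antisymm : ∀ a b : A, LRStructure.le a b → LRStructure.le b a → a = b
  le_trans : ∀ a b c : A, LRStructure.le a b → LRStructure.le b c → LRStructure.le a c
  R_iff : ∀ a b : A, LRStructure.R a b ↔ a = b ∨ ImmSucc a b ∨ ImmSucc b a

/-- A finite (nonempty) Hasse forest: a finite Hasse partial order whose Hasse diagram, as a simple
graph, has no cycles. -/
structure IsFiniteHForest (A : Type u) [LRStructure A] : Prop where
  finite : Finite A
  nonempty : Nonempty A
  isHPO : IsHPO A
  acyclic : (SimpleGraph.fromRel (LRStructure.R : A → A → Prop)).IsAcyclic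

/-- `L` is a projective Fraïssé limit of the family of all finite Hasse forests
(finite structures carry the discrete topology). -/
structure IsProjFraisseLimit (L : Type u) [TopologicalSpace L] [LRStructure L] : Prop where
  isTopStructure : IsTopStructure L
  /-- projective universality -/
  universal : ∀ (A : Type) [TopologicalSpace A] [DiscreteTopology A] [LRStructure A],
    IsFiniteHForest A → ∃ φ : L → A, IsEpi φ
  /-- every clopen covering is refined by an epimorphism onto a member of the family -/
  refines : ∀ 𝒰 : Set (Set L), (∀ U ∈ 𝒰, IsClopen U) → ⋃₀ 𝒰 = Set.univ →
    ∃ (A : Type) (_ : TopologicalSpace A) (_ : DiscreteTopology A) (_ : LRStructure A) (φ : L → A),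
      IsFiniteHForest A ∧ IsEpi φ ∧ ∀ a : A, ∃ U ∈ 𝒰, φ ⁻¹' {a} ⊆ U
  /-- projective ultrahomogeneity -/
  homogeneous : ∀ (A : Type) [TopologicalSpace A] [DiscreteTopology A] [LRStructure A],
    IsFiniteHForest A → ∀ φ₁ φ₂ : L → A, IsEpi φ₁ → IsEpi φ₂ →
      ∃ ψ : L → L, IsAut ψ ∧ φ₂ = φ₁ ∘ ψ

/-- A Fraïssé fence: a space homeomorphic to the quotient `𝔽 / R`, where `𝔽` is the projective
Fraïssé limit of the family of all finite Hasse forests and `R`, as interpreted in `𝔽`, is an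
equivalence relation. -/
def IsFraisseFence (Y : Type u) [TopologicalSpace Y] : Prop :=
  ∃ (𝔽 : Type) (_ : TopologicalSpace 𝔽) (_ : LRStructure 𝔽), IsProjFraisseLimit 𝔽 ∧
    ∃ h : Equivalence (LRStructure.R : 𝔽 → 𝔽 → Prop),
      Nonempty (Y ≃ₜ Quotient (Setoid.mk (LRStructure.R : 𝔽 → 𝔽 → Prop) h))

/-- `J` is an arc with endpoints `a` and `b`. -/
def IsArcWithEndpoints {Y : Type u} [TopologicalSpace Y] (J : Set Y) (a b : Y) : Prop :=
  ∃ e : unitInterval ≃ₜ J, (e 0 : Y) = a ∧ (e 1 : Y) = b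

/-- A fence: a compact metrizable space whose connected components are points or arcs. -/
structure IsFence (Y : Type u) [TopologicalSpace Y] : Prop where
  compact : CompactSpace Y
  metrizable : TopologicalSpace.MetrizableSpace Y
  component : ∀ x : Y, connectedComponent x = {x} ∨
    ∃ a b : Y, IsArcWithEndpoints (connectedComponent x) a b

/-- A smooth fence: a fence with a closed partial order whose restriction to each connected
component is total. -/
structure IsSmoothFence (Y : Type u) [TopologicalSpace Y] : Prop extends IsFence Y where
  smooth : ∃ r : Y → Y → Prop,
    (∀ x, r x x) ∧ (∀ x y, r x y → r y x → x = y) ∧ (∀ x y z, r x y → r y z → r x z) ∧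
    IsClosed {p : Y × Y | r p.1 p.2} ∧
    ∀ x, ∀ y ∈ connectedComponent x, ∀ z ∈ connectedComponent x, r y z ∨ r z y

end FraisseFence

/-! Necessity. Every finite Hasse forest is an epimorphic image of a disjoint union of finite chains
(`IsFiniteHForest.exists_chainSum`), and ultrahomogeneity lifts epimorphisms from the limit along
it. Hence the limit is approximated by unions of chains, and over a single component of the quotient
`≤` is total. If two open sets meet a common component, some approximation contains values `p ≤ p'`
on one chain whose preimages lie over the two sets. Lifting once more, to a union of chains one of
which runs from `p` to `p'` and stalls at both ends, gives a nondegenerate component whose least and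
greatest points lie over `p` and `p'`; they project to the endpoints of an arc
(`IsProjFraisseLimit.exists_arc_of_le`).

Sufficiency. A monotone Urysohn argument turns the closed order into a continuous height that is
injective on each component. Fix a countable dense set of real levels and double each point whose
height is a level, one copy for either side. The result, `Split`, is zero-dimensional; its `R`
identifies copies, so the quotient is `Y` again, and its `≤` is the height order on each component.
It remains to see that `Split` is a projective Fraïssé limit.

Cutting one fibre at finitely many levels maps it onto a chain; compactness extends this to nearby
fibres, and a locally constant choice of fibres patches the maps together (`Split.refining`). In the
same way an epimorphism to `A` lifts along `B → A`: on each fibre its values form a chain, and a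
walk in `B` over that chain is followed by cutting at suitable levels. The lift must also attain
every relation of `B`. The arc condition provides infinitely many arcs running between any two
prescribed comparable values, so each comparable pair of `B` gets an arc of its own
(`Split.infinite_joins`, `Split.exists_lift`). This needs levels in general position, found by Baire
category (`exists_isGeneric`). Refinement and lifting give homogeneity by back-and-forth, and
universality by lifting from a one-point structure. -/

open Set Filter Topology

namespace FraisseFence

universe u v w

/-- A continuous map preserving both relations. -/
structure IsHom {X : Type u} {Y : Type v} [TopologicalSpace X] [LRStructure X]
    [TopologicalSpace Y] [LRStructure Y] (φ : X → Y) : Prop where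
  continuous : Continuous φ
  map_R : ∀ x x' : X, LRStructure.R x x' → LRStructure.R (φ x) (φ x')
  map_le : ∀ x x' : X, LRStructure.le x x' → LRStructure.le (φ x) (φ x')

/-! ### Homomorphisms and epimorphisms -/

section Epi

variable {X : Type u} {Y : Type v} {Z : Type w} [TopologicalSpace X] [LRStructure X]
  [TopologicalSpace Y] [LRStructure Y] [TopologicalSpace Z] [LRStructure Z]

theorem IsEpi.isHom {φ : X → Y} (h : IsEpi φ) : IsHom φ :=
  ⟨h.continuous, fun x x' hx => (h.R_iff _ _).2 ⟨x, x', rfl, rfl, hx⟩,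
    fun x x' hx => (h.le_iff _ _).2 ⟨x, x', rfl, rfl, hx⟩⟩

theorem IsEpi.of_isHom {φ : X → Y} (h : IsHom φ) (hs : Function.Surjective φ)
    (hR : ∀ y y', LRStructure.R y y' → ∃ x x' : X, φ x = y ∧ φ x' = y' ∧ LRStructure.R x x')
    (hle : ∀ y y', LRStructure.le y y' → ∃ x x' : X, φ x = y ∧ φ x' = y' ∧ LRStructure.le x x') :
    IsEpi φ :=
  ⟨h.continuous, hs, fun y y' => ⟨hR y y', by rintro ⟨x, x', rfl, rfl, h'⟩; exact h.map_R _ _ h'⟩,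
    fun y y' => ⟨hle y y', by rintro ⟨x, x', rfl, rfl, h'⟩; exact h.map_le _ _ h'⟩⟩

theorem IsHom.comp {φ : X → Y} {g : Y → Z} (hg : IsHom g) (h : IsHom φ) : IsHom (g ∘ φ) :=
  ⟨hg.continuous.comp h.continuous, fun _ _ hx => hg.map_R _ _ (h.map_R _ _ hx),
    fun _ _ hx => hg.map_le _ _ (h.map_le _ _ hx)⟩

theorem IsEpi.comp {φ : X → Y} {g : Y → Z} (hg : IsEpi g) (h : IsEpi φ) : IsEpi (g ∘ φ) := by
  refine .of_isHom (hg.isHom.comp h.isHom) (hg.surjective.comp h.surjective) ?_ ?_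
  · intro z z' hz
    obtain ⟨y, y', rfl, rfl, hy⟩ := (hg.R_iff _ _).1 hz
    obtain ⟨x, x', rfl, rfl, hx⟩ := (h.R_iff _ _).1 hy
    exact ⟨x, x', rfl, rfl, hx⟩
  · intro z z' hz
    obtain ⟨y, y', rfl, rfl, hy⟩ := (hg.le_iff _ _).1 hz
    obtain ⟨x, x', rfl, rfl, hx⟩ := (h.le_iff _ _).1 hy
    exact ⟨x, x', rfl, rfl, hx⟩

/-- The second factor of an epimorphism through an epimorphism onto a discrete structure is an
epimorphism. -/
theorem IsEpi.of_comp [DiscreteTopology Y] {φ : X → Y} {g : Y → Z} (h : IsEpi φ)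
    (hg : IsEpi (g ∘ φ)) : IsEpi g := by
  refine .of_isHom ⟨continuous_of_discreteTopology, ?_, ?_⟩ hg.surjective.of_comp ?_ ?_
  · intro y y' hy
    obtain ⟨x, x', rfl, rfl, hx⟩ := (h.R_iff _ _).1 hy
    exact hg.isHom.map_R _ _ hx
  · intro y y' hy
    obtain ⟨x, x', rfl, rfl, hx⟩ := (h.le_iff _ _).1 hy
    exact hg.isHom.map_le _ _ hx
  · intro z z' hz
    obtain ⟨x, x', rfl, rfl, hx⟩ := (hg.R_iff _ _).1 hz
    exact ⟨φ x, φ x', rfl, rfl, h.isHom.map_R _ _ hx⟩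
  · intro z z' hz
    obtain ⟨x, x', rfl, rfl, hx⟩ := (hg.le_iff _ _).1 hz
    exact ⟨φ x, φ x', rfl, rfl, h.isHom.map_le _ _ hx⟩

end Epi

/-! ### Finite Hasse orders, walks, and intervals in forests -/

section Order

variable {A : Type u} [LRStructure A]

theorem IsHPO.R_symm (hA : IsHPO A) {a b : A} (h : LRStructure.R a b) : LRStructure.R b a := by
  rw [hA.R_iff] at h ⊢
  tauto

theorem IsHPO.R_refl (hA : IsHPO A) (a : A) : LRStructure.R a a := (hA.R_iff _ _).2 (.inl rfl)

theorem IsHPO.immSucc_refl (hA : IsHPO A) (a : A) : ImmSucc a a :=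
  ⟨hA.le_refl a, fun _ h h' => .inl (hA.le_antisymm _ _ h' h)⟩

theorem IsHPO.R_of_immSucc (hA : IsHPO A) {a b : A} (h : ImmSucc a b) : LRStructure.R a b :=
  (hA.R_iff _ _).2 (.inr (.inl h))

theorem IsHPO.immSucc_of_R (hA : IsHPO A) {a b : A} (h : LRStructure.R a b)
    (hab : LRStructure.le a b) : ImmSucc a b := by
  rcases (hA.R_iff _ _).1 h with rfl | h | h
  · exact hA.immSucc_refl a
  · exact h
  · obtain rfl := hA.le_antisymm _ _ hab h.1
    exact hA.immSucc_refl a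

/-- A sequence of length `n` with immediate successor (or equality) steps. -/
def IsWalk (n : ℕ) (f : ℕ → A) : Prop := ∀ i < n, ImmSucc (f i) (f (i + 1))

theorem IsHPO.walk_le (hA : IsHPO A) {n : ℕ} {f : ℕ → A} (hf : IsWalk n f) {i j : ℕ}
    (hij : i ≤ j) (hj : j ≤ n) : LRStructure.le (f i) (f j) := by
  induction j, hij using Nat.le_induction with
  | base => exact hA.le_refl _
  | succ j hij ih => exact hA.le_trans _ _ _ (ih (by omega)) (hf j (by omega)).1

theorem IsWalk.map {B : Type v} [LRStructure B] [TopologicalSpace A] [TopologicalSpace B]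
    (hB : IsHPO B) (hA : IsHPO A) {g : A → B} (hg : IsHom g) {n : ℕ} {f : ℕ → A}
    (hf : IsWalk n f) : IsWalk n (g ∘ f) := fun i hi =>
  hB.immSucc_of_R (hg.map_R _ _ (hA.R_of_immSucc (hf i hi))) (hg.map_le _ _ (hf i hi).1)

theorem IsHPO.exists_immSucc [Finite A] (hA : IsHPO A) {a b : A} (hab : LRStructure.le a b)
    (hne : a ≠ b) : ∃ c, ImmSucc a c ∧ a ≠ c ∧ LRStructure.le c b := by
  let S : Set A := {c | LRStructure.le a c ∧ a ≠ c ∧ LRStructure.le c b}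
  have hwf : WellFounded (fun x y : A => LRStructure.le x y ∧ x ≠ y) := by
    have : IsStrictOrder A (fun x y : A => LRStructure.le x y ∧ x ≠ y) :=
      { irrefl := fun x hx => hx.2 rfl
        trans := fun x y z hxy hyz => ⟨hA.le_trans _ _ _ hxy.1 hyz.1, by
          rintro rfl
          exact hxy.2 (hA.le_antisymm _ _ hxy.1 hyz.1)⟩ }
    exact Finite.wellFounded_of_trans_of_irrefl _
  obtain ⟨c, hc, hmin⟩ := hwf.has_min S ⟨b, hab, hne, hA.le_refl b⟩
  refine ⟨c, ⟨hc.1, fun d had hdc => ?_⟩, hc.2.1, hc.2.2⟩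
  by_contra! hd
  exact hmin d ⟨had, hd.1.symm, hA.le_trans _ _ _ hdc hc.2.2⟩ ⟨hdc, hd.2⟩

theorem IsHPO.wellFounded_gt [Finite A] (hA : IsHPO A) :
    WellFounded (fun x y : A => LRStructure.le y x ∧ y ≠ x) := by
  have : IsStrictOrder A (fun x y : A => LRStructure.le y x ∧ y ≠ x) :=
      { irrefl := fun x hx => hx.2 rfl
        trans := fun x y z hxy hyz => ⟨hA.le_trans _ _ _ hyz.1 hxy.1, by
          rintro rfl
          exact hxy.2 (hA.le_antisymm _ _ hxy.1 hyz.1)⟩ }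
  exact Finite.wellFounded_of_trans_of_irrefl _

theorem IsHPO.exists_walk [Finite A] (hA : IsHPO A) {a b : A} (hab : LRStructure.le a b) :
    ∃ (n : ℕ) (f : ℕ → A), f 0 = a ∧ f n = b ∧ IsWalk n f ∧ ∀ i < n, f i ≠ f (i + 1) := by
  induction a using hA.wellFounded_gt.induction with
  | _ a ih =>
    by_cases hne : a = b
    · exact ⟨0, fun _ => a, rfl, hne, fun i hi => by omega, fun i hi => by omega⟩
    · obtain ⟨c, hac, hne', hcb⟩ := hA.exists_immSucc hab hne
      obtain ⟨n, f, h0, hn, hw, hs⟩ := ih c ⟨hac.1, hne'⟩ hcb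
      refine ⟨n + 1, fun i => Nat.casesOn i a f, rfl, hn, fun i hi => ?_, fun i hi => ?_⟩
      · rcases i with _ | i
        · simpa [h0] using hac
        · exact hw i (by omega)
      · rcases i with _ | i
        · simpa [h0] using hne'
        · exact hs i (by omega)

/-- A strict walk between a point and a distinct immediate successor has a single step. -/
theorem IsHPO.walk_one (hA : IsHPO A) {n : ℕ} {f : ℕ → A} (hf : IsWalk n f)
    (hs : ∀ i < n, f i ≠ f (i + 1)) (h : ImmSucc (f 0) (f n)) (hne : f 0 ≠ f n) :
    0 < n ∧ f 1 = f n := by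
  have hn : 0 < n := by
    rcases Nat.eq_zero_or_pos n with rfl | h
    · exact absurd rfl hne
    · exact h
  refine ⟨hn, ?_⟩
  rcases h.2 (f 1) (hf 0 hn).1 (hA.walk_le hf (by omega) le_rfl) with h1 | h1
  · exact absurd h1.symm (hs 0 hn)
  · exact h1

-- An ascending sequence of immediate successors is a path of the Hasse graph, so a path whose
-- support is a chain above `x` can be prolonged downwards to `a`. Any `x` in an interval thus lies
-- on a monotone path between its ends.
open SimpleGraph in
theorem IsHPO.exists_path [Finite A] (hA : IsHPO A) {x b : A}
    (p : (fromRel (LRStructure.R : A → A → Prop)).Walk x b) (hp : p.IsPath)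
    (hx : ∀ v ∈ p.support, LRStructure.le x v)
    (hc : ∀ v ∈ p.support, ∀ w ∈ p.support, LRStructure.le v w ∨ LRStructure.le w v)
    {a : A} (hax : LRStructure.le a x) :
    ∃ p' : (fromRel (LRStructure.R : A → A → Prop)).Walk a b, p'.IsPath ∧
      (∀ v ∈ p'.support, LRStructure.le a v) ∧
      (∀ v ∈ p'.support, ∀ w ∈ p'.support, LRStructure.le v w ∨ LRStructure.le w v) ∧
      p.support ⊆ p'.support := by
  induction a using hA.wellFounded_gt.induction with
  | _ a ih =>
    by_cases hne : a = x
    · subst hne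
      exact ⟨p, hp, hx, hc, fun _ h => h⟩
    · obtain ⟨c, hac, hne', hcx⟩ := hA.exists_immSucc hax hne
      obtain ⟨p', hp', hx', hc', hsub⟩ := ih c ⟨hac.1, hne'⟩ hcx
      have hadj : (fromRel (LRStructure.R : A → A → Prop)).Adj a c :=
        (fromRel_adj _ _ _).2 ⟨hne', .inl (hA.R_of_immSucc hac)⟩
      have hle : ∀ v ∈ (Walk.cons hadj p').support, LRStructure.le a v := by
        intro v hv
        rw [Walk.support_cons, List.mem_cons] at hv
        rcases hv with rfl | hv
        · exact hA.le_refl _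
        · exact hA.le_trans _ _ _ hac.1 (hx' v hv)
      refine ⟨Walk.cons hadj p', ?_, hle, ?_, ?_⟩
      · rw [Walk.cons_isPath_iff]
        exact ⟨hp', fun h => hne' (hA.le_antisymm _ _ hac.1 (hx' a h))⟩
      · intro v hv w hw
        rw [Walk.support_cons, List.mem_cons] at hv hw
        rcases hv with rfl | hv
        · exact .inl (hle w (by simpa using hw))
        · rcases hw with rfl | hw
          · exact .inr (hle v (by simp [hv]))
          · exact hc' v hv w hw
      · intro v hv
        simp [hsub hv]

/-- Intervals in a Hasse forest are chains. -/
theorem IsFiniteHForest.interval_total (hA : IsFiniteHForest A) {a b x y : A}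
    (hax : LRStructure.le a x) (hxb : LRStructure.le x b) (hay : LRStructure.le a y)
    (hyb : LRStructure.le y b) : LRStructure.le x y ∨ LRStructure.le y x := by
  have := hA.finite
  have key : ∀ x, LRStructure.le a x → LRStructure.le x b →
      ∃ p : (SimpleGraph.fromRel (LRStructure.R : A → A → Prop)).Walk a b, p.IsPath ∧
      (∀ v ∈ p.support, ∀ w ∈ p.support, LRStructure.le v w ∨ LRStructure.le w v) ∧
      x ∈ p.support := by
    intro x hax hxb
    obtain ⟨p, hp, hx, hc, -⟩ := hA.isHPO.exists_path (SimpleGraph.Walk.nil' b) (by simp)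
      (by simpa using hA.isHPO.le_refl b) (by simpa using hA.isHPO.le_refl b) hxb
    obtain ⟨p', hp', -, hc', hsub⟩ := hA.isHPO.exists_path p hp hx hc hax
    exact ⟨p', hp', hc', hsub p.start_mem_support⟩
  obtain ⟨p, hp, hc, hx⟩ := key x hax hxb
  obtain ⟨p', hp', -, hy⟩ := key y hay hyb
  -- Acyclicity: paths with the same ends coincide, so `x` and `y` lie on one chain.
  have : p = p' := congrArg Subtype.val
    ((hA.acyclic.subsingleton_path a b).elim ⟨p, hp⟩ ⟨p', hp'⟩)
  subst this
  exact hc x hx y hy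

end Order

/-! ### Disjoint unions of finite chains -/

section ChainSum

/-- A disjoint union of finite chains; the chain with index `i` has `n i + 1` elements. -/
def ChainSum {ι : Type u} (n : ι → ℕ) : Type u := Σ i, Fin (n i + 1)

variable {ι : Type u} {n : ι → ℕ}

instance : LRStructure (ChainSum n) where
  R p q := p.1 = q.1 ∧ (p.2 : ℕ) ≤ q.2 + 1 ∧ (q.2 : ℕ) ≤ p.2 + 1
  le p q := p.1 = q.1 ∧ (p.2 : ℕ) ≤ q.2

theorem ChainSum.ext {p q : ChainSum n} (h : p.1 = q.1) (h' : (p.2 : ℕ) = q.2) : p = q := by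
  obtain ⟨i, k⟩ := p
  obtain ⟨j, l⟩ := q
  obtain rfl : i = j := h
  obtain rfl : k = l := Fin.ext h'
  rfl

instance : TopologicalSpace (ChainSum n) := ⊥
instance : DiscreteTopology (ChainSum n) := ⟨rfl⟩

theorem ChainSum.isHPO (n : ι → ℕ) : IsHPO (ChainSum n) where
  le_refl _ := ⟨rfl, le_rfl⟩
  le_antisymm _ _ h h' := ext h.1 (le_antisymm h.2 h'.2)
  le_trans _ _ _ h h' := ⟨h.1.trans h'.1, h.2.trans h'.2⟩
  R_iff := by
    have key : ∀ a b : ChainSum n, a.1 = b.1 → (b.2 : ℕ) = a.2 + 1 → ImmSucc a b := by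
      intro a b h h'
      refine ⟨⟨h, by omega⟩, fun c hac hcb => ?_⟩
      have h1 := hac.2
      have h2 := hcb.2
      rcases Nat.lt_or_ge (a.2 : ℕ) c.2 with h3 | h3
      · exact .inr (ext hcb.1 (by omega))
      · exact .inl (ext hac.1.symm (by omega))
    have key' : ∀ a b : ChainSum n, ImmSucc a b → (b.2 : ℕ) ≤ a.2 + 1 := by
      rintro ⟨i, a⟩ ⟨j, b⟩ ⟨⟨hij, hab⟩, h⟩
      obtain rfl : i = j := hij
      by_contra! hlt
      simp only at hlt hab
      rcases h ⟨i, ⟨a + 1, by omega⟩⟩ ⟨rfl, by simp⟩ ⟨rfl, by simp; omega⟩ with h1 | h1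
      · have := congrArg (fun p : ChainSum n => (p.2 : ℕ)) h1
        simp at this
      · have := congrArg (fun p : ChainSum n => (p.2 : ℕ)) h1
        simp at this
        omega
    intro a b
    constructor
    · rintro ⟨h, h1, h2⟩
      rcases lt_trichotomy (a.2 : ℕ) b.2 with h3 | h3 | h3
      · exact .inr (.inl (key a b h (by omega)))
      · exact .inl (ext h h3)
      · exact .inr (.inr (key b a h.symm (by omega)))
    · rintro (rfl | h | h)
      · exact ⟨rfl, by omega, by omega⟩
      · exact ⟨h.1.1, h.1.2.trans (by omega), key' _ _ h⟩
      · exact ⟨h.1.1.symm, key' _ _ h, h.1.2.trans (by omega)⟩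

theorem ChainSum.isFiniteHForest [Finite ι] [Nonempty ι] (n : ι → ℕ) :
    IsFiniteHForest (ChainSum n) where
  finite := inferInstanceAs (Finite (Σ i, Fin (n i + 1)))
  nonempty := ‹Nonempty ι›.elim fun i => ⟨⟨i, 0⟩⟩
  isHPO := isHPO n
  acyclic := by
    rw [SimpleGraph.isAcyclic_iff_forall_adj_isBridge]
    have key : ∀ a b : ChainSum n, a.1 = b.1 → (b.2 : ℕ) = a.2 + 1 →
        ¬ ((SimpleGraph.fromRel (LRStructure.R : ChainSum n → ChainSum n → Prop)).deleteEdges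
          {s(a, b)}).Reachable a b := by
      intro a b h h' hr
      -- Without the edge from `a` to its successor `b`, nothing above `a` can be reached from `a`:
      -- every edge is a bridge.
      have inv : ∀ c, ((SimpleGraph.fromRel
          (LRStructure.R : ChainSum n → ChainSum n → Prop)).deleteEdges {s(a, b)}).Reachable a c →
          (c.2 : ℕ) ≤ a.2 ∧ c.1 = a.1 := by
        intro c hc
        rw [SimpleGraph.reachable_iff_reflTransGen] at hc
        induction hc with
        | refl => exact ⟨le_rfl, rfl⟩
        | @tail c e _ hce ih =>
          rw [SimpleGraph.deleteEdges_adj, SimpleGraph.fromRel_adj] at hce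
          obtain ⟨⟨hne, hR⟩, hd⟩ := hce
          have hR' : c.1 = e.1 ∧ (e.2 : ℕ) ≤ c.2 + 1 := by
            rcases hR with h | h
            · exact ⟨h.1, h.2.2⟩
            · exact ⟨h.1.symm, h.2.1⟩
          refine ⟨?_, hR'.1.symm.trans ih.2⟩
          by_contra! hlt
          have h1 : c = a := ext ih.2 (by omega)
          have h2 : e = b := ext (by rw [← hR'.1, ih.2, h]) (by omega)
          exact hd (by rw [h1, h2]; rfl)
      have := inv b hr
      omega
    intro a b hab
    have hab' := hab
    rw [SimpleGraph.fromRel_adj] at hab'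
    obtain ⟨hne, hR⟩ := hab'
    have hR' : a.1 = b.1 ∧ (a.2 : ℕ) ≤ b.2 + 1 ∧ (b.2 : ℕ) ≤ a.2 + 1 := by
      rcases hR with h | h
      · exact h
      · exact ⟨h.1.symm, h.2.2, h.2.1⟩
    rw [SimpleGraph.isBridge_iff]
    rcases lt_trichotomy (a.2 : ℕ) b.2 with h3 | h3 | h3
    · exact key a b hR'.1 (by omega)
    · exact absurd (ext hR'.1 h3) hne
    · rw [Sym2.eq_swap]
      exact fun h => key b a hR'.1.symm (by omega) h.symm

/-- A family of walks in a Hasse partial order which connects all comparable pairs is an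
epimorphism from a disjoint union of chains. -/
theorem ChainSum.isEpi_of_walks {A : Type v} [TopologicalSpace A] [LRStructure A] (hA : IsHPO A)
    (f : ι → ℕ → A) (hf : ∀ i, IsWalk (n i) (f i))
    (hs : ∀ a b, LRStructure.le a b → ∃ i, f i 0 = a ∧ f i (n i) = b ∧
      ∀ j < n i, f i j ≠ f i (j + 1)) :
    IsEpi (fun p : ChainSum n => f p.1 p.2) := by
  have hle : ∀ p q : ChainSum n, LRStructure.le p q → LRStructure.le (f p.1 p.2) (f q.1 q.2) := by
    rintro ⟨i, a⟩ ⟨j, b⟩ ⟨hij, hab⟩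
    obtain rfl : i = j := hij
    exact hA.walk_le (hf i) hab (Nat.lt_succ_iff.1 b.2)
  have hR1 : ∀ a b, ImmSucc a b → a ≠ b →
      ∃ x x' : ChainSum n, f x.1 x.2 = a ∧ f x'.1 x'.2 = b ∧ LRStructure.R x x' := by
    intro a b h hne
    obtain ⟨i, rfl, rfl, hst⟩ := hs a b h.1
    obtain ⟨hn, h1⟩ := hA.walk_one (hf i) hst h hne
    exact ⟨⟨i, 0⟩, ⟨i, ⟨1, by omega⟩⟩, rfl, h1, rfl, by simp, by simp⟩
  have hsurj : Function.Surjective (fun p : ChainSum n => f p.1 p.2) := by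
    intro a
    obtain ⟨i, h, -⟩ := hs a a (hA.le_refl a)
    exact ⟨⟨i, 0⟩, h⟩
  refine .of_isHom ⟨continuous_of_discreteTopology, ?_, hle⟩ hsurj ?_ ?_
  · intro p q hpq
    rcases (isHPO n).R_iff p q |>.1 hpq with rfl | h | h
    · exact hA.R_refl _
    · obtain ⟨i, a⟩ := p
      obtain ⟨j, b⟩ := q
      obtain rfl : i = j := hpq.1
      have h1 := hpq.2.2
      have h2 := h.1.2
      rcases Nat.lt_or_ge (a : ℕ) b with h3 | h3
      · have : (b : ℕ) = a + 1 := by simp only at h1; omega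
        simp only [this]
        exact hA.R_of_immSucc (hf i a (by omega))
      · have : (b : ℕ) = a := by simp only at h2; omega
        simp only [this]
        exact hA.R_refl _
    · obtain ⟨i, a⟩ := p
      obtain ⟨j, b⟩ := q
      obtain rfl : i = j := hpq.1
      have h1 := hpq.2.1
      have h2 := h.1.2
      rcases Nat.lt_or_ge (b : ℕ) a with h3 | h3
      · have : (a : ℕ) = b + 1 := by simp only at h1; omega
        simp only [this]
        exact hA.R_symm (hA.R_of_immSucc (hf i b (by omega)))
      · have : (a : ℕ) = b := by simp only at h2; omega
        simp only [this]
        exact hA.R_refl _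
  · intro a b hab
    by_cases hne : a = b
    · subst hne
      obtain ⟨p, hp⟩ := hsurj a
      exact ⟨p, p, hp, hp, (isHPO n).R_refl p⟩
    · rcases (hA.R_iff a b).1 hab with h | h | h
      · exact absurd h hne
      · exact hR1 a b h hne
      · obtain ⟨x, x', h1, h2, h3⟩ := hR1 b a h (Ne.symm hne)
        exact ⟨x', x, h2, h1, (isHPO n).R_symm h3⟩
  · intro a b hab
    obtain ⟨i, h0, h1, -⟩ := hs a b hab
    exact ⟨⟨i, 0⟩, ⟨i, Fin.last _⟩, h0, h1, rfl, by simp⟩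

/-- Every finite Hasse forest is an epimorphic image of a disjoint union of chains, one of which
may be prescribed to follow a given walk. -/
theorem IsFiniteHForest.exists_chainSum {A : Type u} [TopologicalSpace A] [LRStructure A]
    (hA : IsFiniteHForest A) (m : ℕ) (w : ℕ → A) (hw : IsWalk m w) :
    ∃ (ι : Type u) (_ : Finite ι) (n : ι → ℕ) (g : ChainSum n → A) (i : ι), IsEpi g ∧ n i = m ∧
      ∀ p : ChainSum n, p.1 = i → g p = w p.2 := by
  have := hA.finite
  choose N f h0 h1 hf hs using fun (p : {p : A × A // LRStructure.le p.1 p.2}) =>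
    hA.isHPO.exists_walk p.2
  -- The index `none` carries the prescribed walk; the other indices carry a strict walk for each
  -- comparable pair.
  refine ⟨Option {p : A × A // LRStructure.le p.1 p.2}, inferInstance,
    fun i => i.elim m N, fun p => p.1.elim w f p.2, none,
    ChainSum.isEpi_of_walks hA.isHPO 
      (n := fun i : Option _ => i.elim m N) (fun i => i.elim w f) ?_ ?_,
    rfl, ?_⟩
  · rintro (_ | i)
    · exact hw
    · exact hf i
  · intro a b hab
    exact ⟨some ⟨(a, b), hab⟩, h0 _, h1 _, hs _⟩
  · rintro ⟨i, k⟩ (rfl : i = none)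
    rfl

end ChainSum

theorem isLocallyConstant_mem {X : Type u} [TopologicalSpace X] {U : Set X} (hU : IsClopen U) :
    IsLocallyConstant (fun x => x ∈ U) := by
  rw [IsLocallyConstant.iff_eventually_eq]
  intro x
  by_cases hx : x ∈ U
  · filter_upwards [hU.isOpen.mem_nhds hx] with y hy
    simp [hx, hy]
  · filter_upwards [hU.compl.isOpen.mem_nhds hx] with y hy
    simpa [hx] using hy

/-! ### Relations detected by finite quotients -/

section Refining

variable {L : Type u} [TopologicalSpace L] [LRStructure L]

/-- Every clopen covering is refined by an epimorphism onto a finite Hasse forest. -/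
def Refining (L : Type u) [TopologicalSpace L] [LRStructure L] : Prop :=
  ∀ 𝒰 : Set (Set L), (∀ U ∈ 𝒰, IsClopen U) → ⋃₀ 𝒰 = Set.univ →
    ∃ (A : Type) (_ : TopologicalSpace A) (_ : DiscreteTopology A) (_ : LRStructure A) (φ : L → A),
      IsFiniteHForest A ∧ IsEpi φ ∧ ∀ a : A, ∃ U ∈ 𝒰, φ ⁻¹' {a} ⊆ U

theorem Refining.exists_factor (hL : Refining L) {K : Type v} {κ : L → K}
    (hκ : IsLocallyConstant κ) :
    ∃ (A : Type) (_ : TopologicalSpace A) (_ : DiscreteTopology A) (_ : LRStructure A) (φ : L → A),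
      IsFiniteHForest A ∧ IsEpi φ ∧ ∀ x y, φ x = φ y → κ x = κ y := by
  obtain ⟨A, i1, i2, i3, φ, hA, hφ, h⟩ := hL (range fun k => κ ⁻¹' {k})
    (by rintro _ ⟨k, rfl⟩; exact hκ.isClopen_fiber k)
    (by
      rw [sUnion_range, eq_univ_iff_forall]
      exact fun x => mem_iUnion.2 ⟨κ x, rfl⟩)
  refine ⟨A, i1, i2, i3, φ, hA, hφ, fun x y hxy => ?_⟩
  obtain ⟨_, ⟨k, rfl⟩, hk⟩ := h (φ x)
  have h1 : κ x = k := hk (show φ x = φ x from rfl)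
  have h2 : κ y = k := hk (show φ y = φ x from hxy.symm)
  rw [h1, h2]

theorem Refining.exists_separating (hL : Refining L) {U V : Set L} (hU : IsClopen U)
    (hV : IsClopen V) :
    ∃ (A : Type) (_ : TopologicalSpace A) (_ : DiscreteTopology A) (_ : LRStructure A) (φ : L → A),
      IsFiniteHForest A ∧ IsEpi φ ∧
        ∀ x y, φ x = φ y → (x ∈ U ↔ y ∈ U) ∧ (x ∈ V ↔ y ∈ V) := by
  obtain ⟨A, i1, i2, i3, φ, hA, hφ, h⟩ :=
    hL.exists_factor ((isLocallyConstant_mem hU).prodMk (isLocallyConstant_mem hV))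
  refine ⟨A, i1, i2, i3, φ, hA, hφ, fun x y hxy => ?_⟩
  have := h x y hxy
  rw [Prod.mk.injEq] at this
  exact ⟨iff_of_eq this.1, iff_of_eq this.2⟩

theorem IsTopStructure.exists_clopen_rectangle (hL : IsTopStructure L) {r : L → L → Prop}
    (hr : IsClosed {p : L × L | r p.1 p.2}) {x y : L} (h : ¬ r x y) :
    ∃ U V : Set L, IsClopen U ∧ IsClopen V ∧ x ∈ U ∧ y ∈ V ∧ ∀ u ∈ U, ∀ v ∈ V, ¬ r u v := by
  obtain ⟨U, V, hU, hV, hx, hy, hUV⟩ := isOpen_prod_iff.1 hr.isOpen_compl x y h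
  obtain ⟨U', hU', hx', hs⟩ := hL.zeroDim.mem_nhds_iff.1 (hU.mem_nhds hx)
  obtain ⟨V', hV', hy', hs'⟩ := hL.zeroDim.mem_nhds_iff.1 (hV.mem_nhds hy)
  exact ⟨U', V', hU', hV', hx', hy', fun u hu v hv => hUV (mk_mem_prod (hs hu) (hs' hv))⟩

/-- A pair outside a closed relation has a clopen rectangle missing the relation, and some finite
quotient separates both sides of the rectangle. -/
theorem Refining.rel_of_forall (hL : Refining L) (hT : IsTopStructure L) {r : L → L → Prop}
    (hr : IsClosed {p : L × L | r p.1 p.2}) {x y : L}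
    (h : ∀ (A : Type) [TopologicalSpace A] [DiscreteTopology A] [LRStructure A] (φ : L → A),
      IsFiniteHForest A → IsEpi φ → ∃ u v, φ u = φ x ∧ φ v = φ y ∧ r u v) : r x y := by
  by_contra hxy
  obtain ⟨U, V, hU, hV, hx, hy, hUV⟩ := hT.exists_clopen_rectangle hr hxy
  obtain ⟨A, i1, i2, i3, φ, hA, hφ, hsep⟩ := hL.exists_separating hU hV
  obtain ⟨u, v, hu, hv, huv⟩ := h A φ hA hφ
  exact hUV u ((hsep u x hu).1.2 hx) v ((hsep v y hv).2.2 hy) huv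

theorem Refining.le_of_forall (hL : Refining L) (hT : IsTopStructure L) {x y : L}
    (h : ∀ (A : Type) [TopologicalSpace A] [DiscreteTopology A] [LRStructure A] (φ : L → A),
      IsFiniteHForest A → IsEpi φ → LRStructure.le (φ x) (φ y)) : LRStructure.le x y :=
  hL.rel_of_forall hT hT.isClosed_le fun A _ _ _ φ hA hφ => (hφ.le_iff _ _).1 (h A φ hA hφ)

theorem Refining.le_refl (hL : Refining L) (hT : IsTopStructure L) (x : L) : LRStructure.le x x :=
  hL.le_of_forall hT fun _ _ _ _ _ hA _ => hA.isHPO.le_refl _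

theorem Refining.le_trans (hL : Refining L) (hT : IsTopStructure L) {x y z : L}
    (hxy : LRStructure.le x y) (hyz : LRStructure.le y z) : LRStructure.le x z :=
  hL.le_of_forall hT fun _ _ _ _ _ hA hφ =>
    hA.isHPO.le_trans _ _ _ (hφ.isHom.map_le _ _ hxy) (hφ.isHom.map_le _ _ hyz)

/-- `R`-related points are consecutive. -/
theorem Refining.eq_or_eq_of_R (hL : Refining L) (hT : IsTopStructure L) {x y z : L}
    (hxz : LRStructure.R x z) (hxy : LRStructure.le x y) (hyz : LRStructure.le y z) :
    y = x ∨ y = z := by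
  by_contra! hne
  have := hT.metrizable
  obtain ⟨U, U', hU, -, hyU, hxU, hd⟩ := hT.exists_clopen_rectangle (r := (· = ·))
    (isClosed_eq continuous_fst continuous_snd) hne.1
  obtain ⟨V, V', hV, -, hyV, hzV, hd'⟩ := hT.exists_clopen_rectangle (r := (· = ·))
    (isClosed_eq continuous_fst continuous_snd) hne.2
  obtain ⟨A, i1, i2, i3, φ, hA, hφ, hsep⟩ := hL.exists_separating hU hV
  have hle := hφ.isHom.map_le
  have him := hA.isHPO.immSucc_of_R (hφ.isHom.map_R _ _ hxz)
    (hA.isHPO.le_trans _ _ _ (hle _ _ hxy) (hle _ _ hyz))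
  rcases him.2 _ (hle _ _ hxy) (hle _ _ hyz) with h | h
  · exact hd x ((hsep _ _ h).1.1 hyU) x hxU rfl
  · exact hd' z ((hsep _ _ h).2.1 hyV) z hzV rfl

end Refining

/-! ### Components of the quotient of the limit -/

section Limit

variable {L : Type u} [TopologicalSpace L] [LRStructure L]

/-- Epimorphisms from the limit lift along epimorphisms of finite forests. -/
theorem IsProjFraisseLimit.exists_lift (hL : IsProjFraisseLimit L) {A B : Type}
    [TopologicalSpace A] [DiscreteTopology A] [LRStructure A]
    [TopologicalSpace B] [DiscreteTopology B] [LRStructure B]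
    (hA : IsFiniteHForest A) (hB : IsFiniteHForest B) {φ : L → A} (hφ : IsEpi φ) {g : B → A}
    (hg : IsEpi g) : ∃ φ' : L → B, IsEpi φ' ∧ g ∘ φ' = φ := by
  obtain ⟨θ, hθ⟩ := hL.universal B hB
  obtain ⟨ψ, hψ, h⟩ := hL.homogeneous A hA (g ∘ θ) φ (hg.comp hθ) hφ
  exact ⟨θ ∘ ψ, hθ.comp hψ.1, by rw [h]; rfl⟩

/-- Unions of chains suffice as targets. In them, elements joined by a sequence of `R`-steps are
comparable, which fails in a general forest. -/
theorem IsProjFraisseLimit.exists_separating_chainSum (hL : IsProjFraisseLimit L) {U V : Set L}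
    (hU : IsClopen U) (hV : IsClopen V) :
    ∃ (ι : Type) (_ : Finite ι) (_ : Nonempty ι) (n : ι → ℕ) (φ : L → ChainSum n),
      IsEpi φ ∧ ∀ x y, φ x = φ y → (x ∈ U ↔ y ∈ U) ∧ (x ∈ V ↔ y ∈ V) := by
  obtain ⟨A, _, _, _, φ, hA, hφ, hsep⟩ := Refining.exists_separating hL.refines hU hV
  obtain ⟨a⟩ := hA.nonempty
  obtain ⟨ι, h1, n, g, i, hg, -⟩ := hA.exists_chainSum 0 (fun _ => a) (fun i hi => by omega)
  have : Nonempty ι := ⟨i⟩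
  obtain ⟨φ', hφ', hgφ⟩ := hL.exists_lift hA (ChainSum.isFiniteHForest n) hφ hg
  refine ⟨ι, h1, ⟨i⟩, n, φ', hφ', fun x y hxy => hsep x y ?_⟩
  rw [← hgφ, Function.comp_apply, Function.comp_apply, hxy]

/-- The projection onto the quotient by `R`, in a form that does not mention the quotient. -/
structure IsRProjection {Y : Type v} [TopologicalSpace Y] (q : L → Y) : Prop where
  continuous : Continuous q
  surjective : Function.Surjective q
  eq_iff : ∀ x y, q x = q y ↔ LRStructure.R x y

variable {Y : Type v} [TopologicalSpace Y] {q : L → Y}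

theorem IsRProjection.isClopen_image [CompactSpace L] [T2Space Y] (hq : IsRProjection q)
    {Z : Set L} (hZ : IsClopen Z) (hs : ∀ x y, LRStructure.R x y → x ∈ Z → y ∈ Z) :
    IsClopen (q '' Z) := by
  have hcl : IsClosedMap q := hq.continuous.isClosedMap
  refine ⟨hcl _ hZ.isClosed, ?_⟩
  have : q '' Z = (q '' Zᶜ)ᶜ := by
    ext y
    constructor
    · rintro ⟨x, hx, rfl⟩ ⟨x', hx', h⟩
      exact hx' (hs _ _ ((hq.eq_iff _ _).1 h.symm) hx)
    · intro hy
      obtain ⟨x, rfl⟩ := hq.surjective y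
      by_contra h
      exact hy ⟨x, fun hx => h ⟨x, hx, rfl⟩, rfl⟩
  rw [this]
  exact (hcl _ hZ.compl.isClosed).isOpen_compl

/-- The component is the intersection of the clopen sets containing it. A walk in a finite quotient
cannot leave such a set: each step is realised by `R`-related points, which `q` identifies. -/
theorem IsProjFraisseLimit.mem_component_of_le (hL : IsProjFraisseLimit L) [CompactSpace Y]
    [T2Space Y] (hq : IsRProjection q) {x y : L} (hxy : LRStructure.le x y) :
    q y ∈ connectedComponent (q x) := by
  rw [connectedComponent_eq_iInter_isClopen]
  refine mem_iInter.2 fun ⟨V, hV, hxV⟩ => ?_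
  have hW : IsClopen (q ⁻¹' V) := hV.preimage hq.continuous
  obtain ⟨A, _, _, _, φ, hA, hφ, hsep⟩ := Refining.exists_separating hL.refines hW hW
  have := hA.finite
  obtain ⟨n, f, h0, hn, hf, -⟩ := hA.isHPO.exists_walk (hφ.isHom.map_le _ _ hxy)
  have key : ∀ i ≤ n, ∀ z, φ z = f i → q z ∈ V := by
    intro i
    induction i with
    | zero =>
      intro _ z hz
      exact (hsep x z (by rw [hz, h0])).1.1 hxV
    | succ i ih =>
      intro hi z hz
      obtain ⟨u, u', hu, hu', hR⟩ :=
        (hφ.R_iff _ _).1 (hA.isHPO.R_of_immSucc (hf i (by omega)))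
      have h1 : q u ∈ V := ih (by omega) u hu
      rw [(hq.eq_iff _ _).2 hR] at h1
      exact (hsep u' z (by rw [hz, hu'])).1.1 h1
  exact key n le_rfl y hn.symm

/-- The preimage of a whole chain is clopen and `R`-saturated, so its image in `Y` is clopen and
contains entire components. -/
theorem ChainSum.mem_fiber_of_component {ι : Type w} {n : ι → ℕ} [CompactSpace L]
    [T2Space Y] (hq : IsRProjection q) {φ : L → ChainSum n} (hφ : IsHom φ) {x y : L}
    (hxy : q y ∈ connectedComponent (q x)) : (φ x).1 = (φ y).1 := by
  have hZ : IsClopen (φ ⁻¹' {p | p.1 = (φ x).1}) :=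
    (isClopen_discrete _).preimage hφ.continuous
  have hcl := hq.isClopen_image hZ fun u v huv hu => ((hφ.map_R _ _ huv).1.symm.trans hu)
  obtain ⟨z, hz, hzy⟩ := hcl.connectedComponent_subset ⟨x, rfl, rfl⟩ hxy
  exact (((hφ.map_R _ _ ((hq.eq_iff _ _).1 hzy)).1).symm.trans hz).symm

/-- Points over one component have values in one chain, hence comparable values. If neither point
were below the other, a fine enough quotient would contradict this. -/
theorem IsProjFraisseLimit.le_total_of_component (hL : IsProjFraisseLimit L)
    [T2Space Y] (hq : IsRProjection q) {x y : L} (hxy : q y ∈ connectedComponent (q x)) :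
    LRStructure.le x y ∨ LRStructure.le y x := by
  have := hL.isTopStructure.compact
  by_contra! hne
  have hT := hL.isTopStructure
  obtain ⟨U, V, hU, hV, hx, hy, hUV⟩ := hT.exists_clopen_rectangle hT.isClosed_le hne.1
  obtain ⟨V', U', hV', hU', hy', hx', hUV'⟩ := hT.exists_clopen_rectangle hT.isClosed_le hne.2
  obtain ⟨ι, _, _, n, φ, hφ, hsep⟩ :=
    hL.exists_separating_chainSum (hU.inter hU') (hV.inter hV')
  have h1 := ChainSum.mem_fiber_of_component hq hφ.isHom hxy
  rcases le_total ((φ x).2 : ℕ) (φ y).2 with h | h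
  · obtain ⟨u, v, hu, hv, huv⟩ := (hφ.le_iff (φ x) (φ y)).1 ⟨h1, h⟩
    exact hUV u ((hsep u x hu).1.2 ⟨hx, hx'⟩).1 v ((hsep v y hv).2.2 ⟨hy, hy'⟩).1 huv
  · obtain ⟨v, u, hv, hu, huv⟩ := (hφ.le_iff (φ y) (φ x)).1 ⟨h1.symm, h⟩
    exact hUV' v ((hsep v y hv).2.2 ⟨hy, hy'⟩).2 u ((hsep u x hu).1.2 ⟨hx, hx'⟩).2 huv

end Limit

theorem exists_least_of_isCompact {X : Type u} [TopologicalSpace X] [CompactSpace X]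
    {r : X → X → Prop} (hr : IsClosed {p : X × X | r p.1 p.2}) {M : Set X} (hM : IsClosed M)
    (hne : M.Nonempty) (hrefl : ∀ x, r x x) (htrans : ∀ x y z, r x y → r y z → r x z)
    (htot : ∀ x ∈ M, ∀ y ∈ M, r x y ∨ r y x) : ∃ m ∈ M, ∀ x ∈ M, r m x := by
  have : Nonempty M := hne.to_subtype
  have hcl : ∀ m : M, IsClosed (M ∩ {z | r z m}) := fun m =>
    hM.inter (hr.preimage (Continuous.prodMk_left (m : X)))
  obtain ⟨m, hm⟩ := IsCompact.nonempty_iInter_of_directed_nonempty_isCompact_isClosed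
    (fun m : M => M ∩ {z | r z m}) (by
      intro a b
      rcases htot a a.2 b b.2 with h | h
      · exact ⟨a, subset_rfl, fun z hz => ⟨hz.1, htrans _ _ _ hz.2 h⟩⟩
      · exact ⟨b, fun z hz => ⟨hz.1, htrans _ _ _ hz.2 h⟩, subset_rfl⟩)
    (fun m => ⟨m, m.2, hrefl _⟩) (fun m => (hcl m).isCompact) hcl
  rw [mem_iInter] at hm
  exact ⟨m, (hm (Classical.arbitrary M)).1, fun x hx => (hm ⟨x, hx⟩).2⟩

/-! ### Arcs and their endpoints -/

section Arc

variable {Y : Type u} [TopologicalSpace Y] {J : Set Y} {a b : Y}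

theorem IsArcWithEndpoints.symm (h : IsArcWithEndpoints J a b) : IsArcWithEndpoints J b a := by
  obtain ⟨e, h0, h1⟩ := h
  exact ⟨unitInterval.symmHomeomorph.trans e, by simpa using h1, by simpa using h0⟩

theorem IsArcWithEndpoints.ne (h : IsArcWithEndpoints J a b) : a ≠ b := by
  obtain ⟨e, rfl, rfl⟩ := h
  intro h
  exact zero_ne_one (e.injective (Subtype.ext h))

theorem IsArcWithEndpoints.mem_left (h : IsArcWithEndpoints J a b) : a ∈ J := by
  obtain ⟨e, rfl, rfl⟩ := h
  exact (e 0).2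

theorem IsArcWithEndpoints.isPreconnected_diff (h : IsArcWithEndpoints J a b) :
    IsPreconnected (J \ {a}) := by
  obtain ⟨e, rfl, rfl⟩ := h
  have hpre : IsPreconnected (Ioi (0 : unitInterval)) := by
    have : Ioi (0 : unitInterval) = projIcc (0 : ℝ) 1 zero_le_one '' Ioc 0 1 := by
      ext x
      constructor
      · intro hx
        exact ⟨x, ⟨hx, x.2.2⟩, projIcc_val _ x⟩
      · rintro ⟨y, hy, rfl⟩
        rw [projIcc_of_mem _ ⟨hy.1.le, hy.2⟩]
        exact hy.1
    rw [this]
    exact isPreconnected_Ioc.image _ continuous_projIcc.continuousOn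
  have himg : J \ {(e 0 : Y)} = (fun t => (e t : Y)) '' Ioi 0 := by
    ext y
    constructor
    · rintro ⟨hy, hne⟩
      refine ⟨e.symm ⟨y, hy⟩, ?_, by simp⟩
      refine lt_of_le_of_ne (unitInterval.nonneg') fun h => hne ?_
      rw [h]
      simp
    · rintro ⟨t, ht, rfl⟩
      refine ⟨(e t).2, fun h => ?_⟩
      exact (ne_of_gt ht) (e.injective (Subtype.ext h))
  rw [himg]
  exact hpre.image _ (by fun_prop)

end Arc

/-! ### Necessity: arc components with prescribed endpoints -/

section ArcComponent

variable {L : Type u} [TopologicalSpace L] [LRStructure L] {Y : Type v} [TopologicalSpace Y]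
  {q : L → Y}

/-- The endpoints of an arc component are the images of the least and the greatest point over the
component. -/
theorem IsProjFraisseLimit.endpoint_eq (hL : IsProjFraisseLimit L) [T2Space Y]
    (hq : IsRProjection q) {c a b : Y} (harc : IsArcWithEndpoints (connectedComponent c) a b)
    {m m' : L} (hm : q m ∈ connectedComponent c) (hm' : q m' ∈ connectedComponent c)
    (hmin : ∀ x, q x ∈ connectedComponent c → LRStructure.le m x)
    (hmax : ∀ x, q x ∈ connectedComponent c → LRStructure.le x m') : a = q m ∨ a = q m' := by
  have := hL.isTopStructure.compact
  have hT := hL.isTopStructure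
  have hRef : Refining L := hL.refines
  by_contra! hne
  obtain ⟨x, rfl⟩ := hq.surjective a
  have hx := harc.mem_left
  have hC : IsClosed {z : L | q z ∈ connectedComponent c} :=
    isClosed_connectedComponent.preimage hq.continuous
  have htot : ∀ y z, q y ∈ connectedComponent c → q z ∈ connectedComponent c →
      LRStructure.le y z ∨ LRStructure.le z y := fun y z hy hz =>
    hL.le_total_of_component hq (by rwa [← connectedComponent_eq hy])
  -- `A₁` and `A₂` consist of the points below, respectively above, some copy of the endpoint `q x`.
  -- If `q x` were neither extreme image, both would have images meeting the arc minus `q x`; that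
  -- set is connected, so the images share a point `y` of it.
  let A₁ : Set L := Prod.fst '' {p : L × L | q p.1 ∈ connectedComponent c ∧ q p.2 = q x ∧
    LRStructure.le p.1 p.2}
  let A₂ : Set L := Prod.snd '' {p : L × L | q p.2 ∈ connectedComponent c ∧ q p.1 = q x ∧
    LRStructure.le p.1 p.2}
  have hA₁ : IsClosed A₁ := by
    refine isClosedMap_fst_of_compactSpace _ ?_
    exact (hC.preimage continuous_fst).inter ((isClosed_eq (hq.continuous.comp continuous_snd)
      continuous_const).inter hT.isClosed_le)
  have hA₂ : IsClosed A₂ := by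
    refine isClosedMap_snd_of_compactSpace _ ?_
    exact (hC.preimage continuous_snd).inter ((isClosed_eq (hq.continuous.comp continuous_fst)
      continuous_const).inter hT.isClosed_le)
  have hcl : IsClosedMap q := hq.continuous.isClosedMap
  have hcov : connectedComponent c \ {q x} ⊆ q '' A₁ ∪ q '' A₂ := by
    rintro y ⟨hy, -⟩
    obtain ⟨z, rfl⟩ := hq.surjective y
    rcases htot z x hy hx with h | h
    · exact .inl ⟨z, ⟨(z, x), ⟨hy, rfl, h⟩, rfl⟩, rfl⟩
    · exact .inr ⟨z, ⟨(x, z), ⟨hy, rfl, h⟩, rfl⟩, rfl⟩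
  obtain ⟨y, ⟨-, hyx⟩, ⟨_, ⟨⟨z₁, u⟩, ⟨hz₁, hu, hzu⟩, rfl⟩, hy₁⟩,
      ⟨_, ⟨⟨v, z₂⟩, ⟨hz₂, hv, hvz⟩, rfl⟩, hy₂⟩⟩ :=
    isPreconnected_closed_iff.1 harc.isPreconnected_diff _ _ (hcl _ hA₁) (hcl _ hA₂) hcov
      ⟨q m, ⟨hm, hne.1.symm⟩, m, ⟨(m, x), ⟨hm, rfl, hmin _ hx⟩, rfl⟩, rfl⟩
      ⟨q m', ⟨hm', hne.2.symm⟩, m', ⟨(x, m'), ⟨hm', rfl, hmax _ hx⟩, rfl⟩, rfl⟩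
  simp only at hz₁ hu hzu hy₁ hz₂ hv hvz hy₂
  have hR : LRStructure.R z₁ z₂ := (hq.eq_iff _ _).1 (hy₁.trans hy₂.symm)
  have hRvu : LRStructure.R v u := (hq.eq_iff _ _).1 (hv.trans hu.symm)
  -- No copy of `y ≠ q x` fits between the two `R`-related copies `v` and `u`, because `R`-related
  -- points are consecutive.
  have hbetween : ∀ z, q z = y → LRStructure.le v z → LRStructure.le z u → False := by
    intro z hz h1 h2
    rcases hRef.eq_or_eq_of_R hT hRvu h1 h2 with rfl | rfl
    · exact hyx (hz.symm.trans hv)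
    · exact hyx (hz.symm.trans hu)
  have hv' : q v ∈ connectedComponent c := by rw [hv]; exact hx
  rcases htot z₂ z₁ hz₂ hz₁ with h | h
  · exact hbetween z₁ hy₁ (hRef.le_trans hT hvz h) hzu
  · rcases htot v z₁ hv' hz₁ with h' | h'
    · exact hbetween z₁ hy₁ h' hzu
    · rcases hRef.eq_or_eq_of_R hT hR h' hvz with rfl | rfl
      · exact hyx (hy₁.symm.trans hv)
      · exact hyx (hy₂.symm.trans hv)

/-- The extra steps make the walk at least two steps long, so the ends of a chain that follows it
are not `R`-related and have different images in the quotient. -/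
theorem IsHPO.padded_walk {A : Type u} [LRStructure A] (hA : IsHPO A) {n : ℕ} {f : ℕ → A}
    (hf : IsWalk n f) : IsWalk (n + 2) (fun k => f (min (k - 1) n)) := by
  intro k hk
  by_cases h : k = 0 ∨ n < k
  · have : min (k - 1) n = min (k + 1 - 1) n := by omega
    simp only [this]
    exact hA.immSucc_refl _
  · have h1 : min (k + 1 - 1) n = min (k - 1) n + 1 := by omega
    simp only [h1]
    exact hf _ (by omega)

/-- After lifting `φ` to a union of chains containing a padded chain from `p` to `p'`, points over
the two ends of that chain lie in one nondegenerate component. The extreme points over this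
component still map to the ends of the chain, and they project to the endpoints of the arc. -/
theorem IsProjFraisseLimit.exists_arc_of_le (hL : IsProjFraisseLimit L) (hY : IsFence Y)
    (hq : IsRProjection q) {ι : Type} [Finite ι] [Nonempty ι] {n : ι → ℕ} {φ : L → ChainSum n}
    (hφ : IsEpi φ) {p p' : ChainSum n} (hpp : LRStructure.le p p') :
    ∃ z a b, IsArcWithEndpoints (connectedComponent z) a b ∧
      (∃ x, φ x = p ∧ q x = a) ∧ ∃ x, φ x = p' ∧ q x = b := by
  have := hY.compact
  have := hY.metrizable
  have := hL.isTopStructure.compact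
  have hT := hL.isTopStructure
  have hRef : Refining L := hL.refines
  have hA := ChainSum.isFiniteHForest n
  have := hA.finite
  obtain ⟨N, f, h0, hN, hf, -⟩ := hA.isHPO.exists_walk hpp
  obtain ⟨κ, _, n', g, i, hg, hi, hgi⟩ := hA.exists_chainSum _ _ (hA.isHPO.padded_walk hf)
  have : Nonempty κ := ⟨i⟩
  obtain ⟨φ', hφ', hlift⟩ := hL.exists_lift hA (ChainSum.isFiniteHForest n') hφ hg
  have hlift' : ∀ x, g (φ' x) = φ x := congrFun hlift
  obtain ⟨x, x', hx, hx', hxx⟩ := (hφ'.le_iff (⟨i, 0⟩ : ChainSum n') ⟨i, Fin.last _⟩).1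
    ⟨rfl, by simp⟩
  have hqx' := hL.mem_component_of_le hq hxx
  have hne : q x ≠ q x' := by
    intro h
    have := (hφ'.isHom.map_R _ _ ((hq.eq_iff _ _).1 h)).2.2
    rw [hx, hx'] at this
    simp at this
    omega
  obtain hs | ⟨a, b, harc⟩ := hY.component (q x)
  · rw [hs] at hqx'
    exact absurd hqx'.symm hne
  have hM : IsClosed {z : L | q z ∈ connectedComponent (q x)} :=
    isClosed_connectedComponent.preimage hq.continuous
  have htot : ∀ y z, q y ∈ connectedComponent (q x) → q z ∈ connectedComponent (q x) →
      LRStructure.le y z ∨ LRStructure.le z y := fun y z hy hz =>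
    hL.le_total_of_component hq (by rwa [← connectedComponent_eq hy])
  obtain ⟨m, hm, hmin⟩ := exists_least_of_isCompact hT.isClosed_le hM ⟨x, mem_connectedComponent⟩
    (hRef.le_refl hT) (fun _ _ _ => hRef.le_trans hT) fun y hy z hz => htot y z hy hz
  obtain ⟨m', hm', hmax⟩ := exists_least_of_isCompact (r := fun y z : L => LRStructure.le z y)
    (hT.isClosed_le.preimage continuous_swap) hM
    ⟨x, mem_connectedComponent⟩ (hRef.le_refl hT) (fun _ _ _ h h' => hRef.le_trans hT h' h)
    fun y hy z hz => htot z y hz hy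
  -- `m` maps into chain `i`, below the value of `x`, which is already the bottom.
  have hφm : φ m = p := by
    have h1 := ChainSum.mem_fiber_of_component hq hφ'.isHom hm
    have h2 := (hφ'.isHom.map_le _ _ (hmin x mem_connectedComponent)).2
    rw [hx] at h1 h2
    rw [← hlift', hgi _ h1.symm, ← h0]
    congr 1
    simp at h2
    simp [h2]
  have hφm' : φ m' = p' := by
    have h1 := ChainSum.mem_fiber_of_component hq hφ'.isHom hm'
    have h2 := (hφ'.isHom.map_le _ _ (hmax x' hqx')).2
    rw [hx] at h1
    rw [hx'] at h2
    rw [← hlift', hgi _ h1.symm, ← hN]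
    congr 1
    simp at h2
    omega
  have ha := hL.endpoint_eq hq harc hm hm' hmin hmax
  have hb := hL.endpoint_eq hq harc.symm hm hm' hmin hmax
  rcases ha with rfl | rfl <;> rcases hb with rfl | rfl
  · exact absurd rfl harc.ne
  · exact ⟨_, _, _, harc, ⟨m, hφm, rfl⟩, m', hφm', rfl⟩
  · exact ⟨_, _, _, harc.symm, ⟨m, hφm, rfl⟩, m', hφm', rfl⟩
  · exact absurd rfl harc.ne

theorem IsProjFraisseLimit.exists_arc (hL : IsProjFraisseLimit L) (hY : IsFence Y)
    (hq : IsRProjection q) {O O' : Set Y} (hO : IsOpen O) (hO' : IsOpen O') {y y' : Y}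
    (hy : y ∈ O) (hy' : y' ∈ O') (hyy : y' ∈ connectedComponent y) :
    ∃ z a b, IsArcWithEndpoints (connectedComponent z) a b ∧ a ∈ O ∧ b ∈ O' := by
  have := hY.compact
  have := hY.metrizable
  have := hL.isTopStructure.compact
  obtain ⟨x, rfl⟩ := hq.surjective y
  obtain ⟨x', rfl⟩ := hq.surjective y'
  obtain ⟨U, hU, hxU, hUO⟩ := hL.isTopStructure.zeroDim.mem_nhds_iff.1
    ((hO.preimage hq.continuous).mem_nhds hy)
  obtain ⟨V, hV, hxV, hVO⟩ := hL.isTopStructure.zeroDim.mem_nhds_iff.1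
    ((hO'.preimage hq.continuous).mem_nhds hy')
  obtain ⟨ι, _, _, n, φ, hφ, hsep⟩ := hL.exists_separating_chainSum hU hV
  have h1 := ChainSum.mem_fiber_of_component hq hφ.isHom hyy
  rcases le_total ((φ x).2 : ℕ) (φ x').2 with h | h
  · obtain ⟨z, a, b, harc, ⟨u, hu, rfl⟩, v, hv, rfl⟩ :=
      hL.exists_arc_of_le hY hq hφ (p := φ x) (p' := φ x') ⟨h1, h⟩
    exact ⟨z, _, _, harc, hUO ((hsep u x hu).1.2 hxU), hVO ((hsep v x' hv).2.2 hxV)⟩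
  · obtain ⟨z, a, b, harc, ⟨v, hv, rfl⟩, u, hu, rfl⟩ :=
      hL.exists_arc_of_le hY hq hφ (p := φ x') (p' := φ x) ⟨h1.symm, h⟩
    exact ⟨z, _, _, harc.symm, hUO ((hsep u x hu).1.2 hxU), hVO ((hsep v x' hv).2.2 hxV)⟩

end ArcComponent

theorem IsFraisseFence.exists_arc {Y : Type u} [TopologicalSpace Y] (hY : IsFence Y)
    (hF : IsFraisseFence Y) {O O' : Set Y} (hO : IsOpen O) (hO' : IsOpen O') {x : Y}
    (hx : (O ∩ connectedComponent x).Nonempty) (hx' : (O' ∩ connectedComponent x).Nonempty) :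
    ∃ z a b, IsArcWithEndpoints (connectedComponent z) a b ∧ a ∈ O ∧ b ∈ O' := by
  obtain ⟨L, _, _, hL, hR, ⟨e⟩⟩ := hF
  let q : L → Y := fun x => e.symm (Quotient.mk (Setoid.mk LRStructure.R hR) x)
  have hq : IsRProjection q :=
    { continuous := e.symm.continuous.comp continuous_quotient_mk'
      surjective := e.symm.surjective.comp Quotient.mk_surjective
      eq_iff := fun x y => by
        refine e.symm.injective.eq_iff.trans ?_
        exact Quotient.eq (r := Setoid.mk LRStructure.R hR) }
  obtain ⟨y, hy, hyx⟩ := hx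
  obtain ⟨y', hy', hyx'⟩ := hx'
  exact hL.exists_arc hY hq hO hO' hy hy' (by rwa [← connectedComponent_eq hyx])

/-! ### Strictly monotone functions for closed orders -/

section MonotoneUrysohn

variable {Y : Type u} [TopologicalSpace Y] [CompactSpace Y] {r : Y → Y → Prop}

theorem isClosed_lower (hcl : IsClosed {p : Y × Y | r p.1 p.2}) {c : Set Y} (hc : IsClosed c) :
    IsClosed {y | ∃ x ∈ c, r y x} := by
  have : {y | ∃ x ∈ c, r y x} = Prod.fst '' {p : Y × Y | p.2 ∈ c ∧ r p.1 p.2} := by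
    ext y
    simp
  rw [this]
  exact isClosedMap_fst_of_compactSpace _ ((hc.preimage continuous_snd).inter hcl)

theorem isClosed_upper (hcl : IsClosed {p : Y × Y | r p.1 p.2}) {c : Set Y} (hc : IsClosed c) :
    IsClosed {y | ∃ x ∈ c, r x y} :=
  isClosed_lower (r := fun x y => r y x) (hcl.preimage continuous_swap) hc

variable [T2Space Y]

/-- In a compact Hausdorff space with a closed partial order, incomparable points are separated by
a continuous monotone function. -/
theorem exists_monotone_separating (hrefl : ∀ x, r x x) (htrans : ∀ x y z, r x y → r y z → r x z)
    (hcl : IsClosed {p : Y × Y | r p.1 p.2}) {a b : Y} (hab : ¬ r b a) :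
    ∃ f : C(Y, ℝ), (∀ x y, r x y → f x ≤ f y) ∧ (∀ x, f x ∈ Icc (0 : ℝ) 1) ∧ f a < f b := by
  -- Urysohn's construction is run with open lower sets only, which makes every approximation
  -- monotone.
  let P : Set Y → Set Y → Prop := fun c u =>
    (∀ x ∈ u, ∀ y, r y x → y ∈ u) ∧ ∀ x ∈ c, ∀ y, r y x → y ∈ u
  have hP : ∀ {c u : Set Y}, IsClosed c → P c u → IsOpen u → c ⊆ u →
      ∃ v : Set Y, IsOpen v ∧ c ⊆ v ∧ closure v ⊆ u ∧ P c v ∧ P (closure v) u := by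
    intro c u hc hcu hu _
    have hd : Disjoint {y | ∃ x ∈ c, r y x} uᶜ := by
      rw [Set.disjoint_left]
      rintro y ⟨x, hx, hyx⟩ hy
      exact hy (hcu.2 x hx y hyx)
    obtain ⟨W, W', hW, hW', hcW, huW, hWW⟩ :=
      normal_separation (isClosed_lower hcl hc) hu.isClosed_compl hd
    have hvW : {y | ∃ x ∈ Wᶜ, r x y}ᶜ ⊆ W := by
      intro y hy
      by_contra h
      exact hy ⟨y, h, hrefl y⟩
    have hcv : ∀ x ∈ c, ∀ y, r y x → y ∈ {y | ∃ x ∈ Wᶜ, r x y}ᶜ := by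
      rintro x hx y hyx ⟨w, hw, hwy⟩
      exact hw (hcW ⟨x, hx, htrans _ _ _ hwy hyx⟩)
    have hclW : closure {y | ∃ x ∈ Wᶜ, r x y}ᶜ ⊆ W'ᶜ :=
      closure_minimal (hvW.trans (Set.disjoint_left.1 hWW)) hW'.isClosed_compl
    -- The largest lower set inside `W`; it is open because upper closures of closed sets are
    -- closed.
    refine ⟨{y | ∃ x ∈ Wᶜ, r x y}ᶜ, (isClosed_upper hcl hW.isClosed_compl).isOpen_compl,
      fun x hx => hcv x hx x (hrefl x), fun x hx => ?_, ⟨?_, hcv⟩, hcu.1, ?_⟩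
    · by_contra h
      exact hclW hx (huW h)
    · rintro x hx y hyx ⟨w, hw, hwy⟩
      exact hx ⟨w, hw, htrans _ _ _ hwy hyx⟩
    · intro x hx y hyx
      by_contra h
      exact hclW hx (huW fun h' => h (hcu.1 x h' y hyx))
  let c : Urysohns.CU P :=
    { C := {y | ∃ x ∈ ({a} : Set Y), r y x}
      U := {y | ∃ x ∈ ({b} : Set Y), r x y}ᶜ
      P_C_U := by
        refine ⟨?_, ?_⟩
        · rintro x hx y hyx ⟨w, hw, hwy⟩
          exact hx ⟨w, hw, htrans _ _ _ hwy hyx⟩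
        · rintro x ⟨_, rfl, hx⟩ y hyx ⟨_, rfl, hy⟩
          exact hab (htrans _ _ _ hy (htrans _ _ _ hyx hx))
      closed_C := isClosed_lower hcl isClosed_singleton
      open_U := (isClosed_upper hcl isClosed_singleton).isOpen_compl
      subset := by
        rintro x ⟨_, rfl, hx⟩ ⟨_, rfl, hy⟩
        exact hab (htrans _ _ _ hy hx)
      hP := hP }
  have hmono : ∀ n (c : Urysohns.CU P) x y, r x y → c.approx n x ≤ c.approx n y := by
    intro n
    induction n with
    | zero =>
      intro c x y hxy
      simp only [Urysohns.CU.approx]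
      by_cases hx : x ∈ c.U
      · rw [indicator_of_notMem (by simpa using hx)]
        exact indicator_nonneg (fun _ _ => zero_le_one) _
      · have hy : y ∉ c.U := fun hy => hx (c.P_C_U.1 y hy x hxy)
        rw [indicator_of_mem (by simpa using hx), indicator_of_mem (by simpa using hy)]
        exact le_rfl
    | succ n ih =>
      intro c x y hxy
      exact midpoint_le_midpoint (ih _ _ _ hxy) (ih _ _ _ hxy)
  refine ⟨⟨c.lim, c.continuous_lim⟩, fun x y hxy => ?_, c.lim_mem_Icc, ?_⟩
  · exact ciSup_mono (c.bddAbove_range_approx y) fun n => hmono n c x y hxy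
  · have h1 : c.lim a = 0 := c.lim_of_mem_C a ⟨a, rfl, hrefl a⟩
    have h2 : c.lim b = 1 := c.lim_of_notMem_U b fun h => h ⟨b, rfl, hrefl b⟩
    simp [h1, h2]

/-- A closed partial order on a compact metrizable space has a strictly monotone continuous
real function. -/
theorem exists_strictMono_of_closed_order [SecondCountableTopology Y] (hrefl : ∀ x, r x x)
    (hanti : ∀ x y, r x y → r y x → x = y) (htrans : ∀ x y z, r x y → r y z → r x z)
    (hcl : IsClosed {p : Y × Y | r p.1 p.2}) :
    ∃ h : Y → ℝ, Continuous h ∧ ∀ x y, r x y → x ≠ y → h x < h y := by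
  let Q : C(Y, ℝ) → Prop := fun f =>
    (∀ x y, r x y → f x ≤ f y) ∧ ∀ x, f x ∈ Icc (0 : ℝ) 1
  -- Second countability of `Y × Y`: countably many monotone functions separate all the pairs that
  -- can be separated. Their weighted sum is strictly monotone.
  obtain ⟨T, hT, hTU⟩ := TopologicalSpace.isOpen_iUnion_countable
    (fun f : Subtype Q => {p : Y × Y | f.1 p.1 < f.1 p.2})
    (fun f => isOpen_lt (f.1.continuous.comp continuous_fst) (f.1.continuous.comp continuous_snd))
  -- The zero function is added so that the countable family is nonempty and can be enumerated.
  let z : Subtype Q := ⟨0, fun _ _ _ => le_rfl, fun _ => ⟨le_rfl, zero_le_one⟩⟩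
  obtain ⟨F, hF⟩ := (hT.insert z).exists_eq_range (insert_nonempty _ _)
  have hbound : ∀ n x, ‖(1 / 2 : ℝ) ^ n * (F n).1 x‖ ≤ (1 / 2 : ℝ) ^ n := by
    intro n x
    rw [norm_mul, Real.norm_of_nonneg (by positivity), Real.norm_of_nonneg ((F n).2.2 x).1]
    exact mul_le_of_le_one_right (by positivity) ((F n).2.2 x).2
  have hsum : ∀ x, Summable fun n => (1 / 2 : ℝ) ^ n * (F n).1 x := fun x =>
    Summable.of_norm_bounded summable_geometric_two fun n => hbound n x
  refine ⟨fun x => ∑' n, (1 / 2 : ℝ) ^ n * (F n).1 x,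
    continuous_tsum (fun n => by fun_prop) summable_geometric_two hbound, fun x y hxy hne => ?_⟩
  obtain ⟨f, hf, hf1, hf2⟩ := exists_monotone_separating hrefl htrans hcl
    (fun h => hne (hanti x y hxy h))
  have : (x, y) ∈ ⋃ f ∈ T, {p : Y × Y | (f : Subtype Q).1 p.1 < f.1 p.2} := by
    rw [hTU]
    exact mem_iUnion.2 ⟨⟨f, hf, hf1⟩, hf2⟩
  obtain ⟨f, hfT, hfxy⟩ := mem_iUnion₂.1 this
  obtain ⟨n, rfl⟩ : f ∈ range F := hF ▸ mem_insert_of_mem _ hfT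
  refine Summable.tsum_lt_tsum (i := n) (fun m => ?_) ?_ (hsum x) (hsum y)
  · exact mul_le_mul_of_nonneg_left ((F m).2.1 x y hxy) (by positivity)
  · exact mul_lt_mul_of_pos_left hfxy (by positivity)

end MonotoneUrysohn

/-- The order is total on each component, so a strictly monotone function is injective there. -/
theorem IsSmoothFence.exists_height {Y : Type u} [TopologicalSpace Y] (hY : IsSmoothFence Y) :
    ∃ h : Y → ℝ, Continuous h ∧
      ∀ x y : Y, (x : ConnectedComponents Y) = y → h x = h y → x = y := by
  have := hY.compact
  have := hY.metrizable
  let _ := TopologicalSpace.metrizableSpaceMetric Y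
  obtain ⟨r, hrefl, hanti, htrans, hcl, htot⟩ := hY.smooth
  obtain ⟨h, hc, hs⟩ := exists_strictMono_of_closed_order hrefl hanti htrans hcl
  refine ⟨h, hc, fun x y hxy he => ?_⟩
  by_contra hne
  rcases htot x x mem_connectedComponent y
    (ConnectedComponents.coe_eq_coe'.1 hxy.symm) with h' | h'
  · exact (hs _ _ h' hne).ne he
  · exact (hs _ _ h' (Ne.symm hne)).ne' he

/-- The endpoints of an arc have extreme values under an injective continuous function. -/
theorem IsArcWithEndpoints.extreme {Y : Type u} [TopologicalSpace Y] {J : Set Y} {a b : Y}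
    (hJ : IsArcWithEndpoints J a b) {h : Y → ℝ} (hc : Continuous h) (hinj : InjOn h J) :
    (∀ w ∈ J, h a ≤ h w ∧ h w ≤ h b) ∨ ∀ w ∈ J, h b ≤ h w ∧ h w ≤ h a := by
  obtain ⟨e, rfl, rfl⟩ := hJ
  have hcont : Continuous fun t : unitInterval => h (e t) := by fun_prop
  have hinj' : Function.Injective fun t : unitInterval => h (e t) := fun s t hst =>
    e.injective (Subtype.ext (hinj (e s).2 (e t).2 hst))
  have hw : ∀ w ∈ J, ∃ t, (e t : Y) = w := fun w hw => ⟨e.symm ⟨w, hw⟩, by simp⟩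
  rcases hcont.strictMono_of_inj hinj' with hm | hm
  · left
    intro w hwJ
    obtain ⟨t, rfl⟩ := hw w hwJ
    exact ⟨hm.monotone unitInterval.nonneg', hm.monotone unitInterval.le_one'⟩
  · right
    intro w hwJ
    obtain ⟨t, rfl⟩ := hw w hwJ
    exact ⟨hm.antitone unitInterval.le_one', hm.antitone unitInterval.nonneg'⟩

/-! ### Heights, dense arcs, and levels in general position -/

/-- A continuous real function `h`, injective on each fibre of a continuous surjection `k` with
connected fibres. -/
structure IsHeight {Y : Type u} {K : Type v} [TopologicalSpace Y] [TopologicalSpace K] (k : Y → K)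
    (h : Y → ℝ) : Prop where
  continuous_k : Continuous k
  continuous_h : Continuous h
  surjective : Function.Surjective k
  preconnected : ∀ c, IsPreconnected (k ⁻¹' {c})
  inj : ∀ x y, k x = k y → h x = h y → x = y

/-- Any two open sets meeting a common fibre contain the two extreme points of a
nondegenerate fibre. -/
def HasDenseArcs {Y : Type u} {K : Type v} [TopologicalSpace Y] (k : Y → K) (h : Y → ℝ) : Prop :=
  ∀ O O' : Set Y, IsOpen O → IsOpen O' → ∀ x ∈ O, ∀ y ∈ O', k x = k y →
    ∃ a b, a ≠ b ∧ k a = k b ∧ (∀ w, k w = k a → h a ≤ h w ∧ h w ≤ h b) ∧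
      (a ∈ O ∧ b ∈ O' ∨ a ∈ O' ∧ b ∈ O)

/-- The fibre over `c` passes through the level `t` inside `N`. -/
def Crosses {Y : Type u} {K : Type v} (k : Y → K) (h : Y → ℝ) (c : K) (N : Set Y) (t : ℝ) : Prop :=
  (∃ z ∈ N, k z = c ∧ h z < t) ∧ ∃ z ∈ N, k z = c ∧ t < h z

/-- A sequence of levels in general position with respect to a height function. -/
structure IsGeneric {Y : Type u} {K : Type v} [TopologicalSpace Y] (k : Y → K) (h : Y → ℝ)
    (d : ℕ → ℝ) : Prop where
  injective : Function.Injective d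
  denseRange : DenseRange d
  crosses : ∀ m n, ∀ N N' : Set Y, IsOpen N → IsOpen N' → ∀ y ∈ N, ∀ y' ∈ N', k y = k y' →
    h y = d m → h y' = d n → ∃ c, Crosses k h c N (d m) ∧ Crosses k h c N' (d n)

section Generic

variable {Y : Type u} {K : Type v} [TopologicalSpace Y] [TopologicalSpace K]
  {k : Y → K} {h : Y → ℝ}

theorem IsHeight.exists_of_between (hh : IsHeight k h) {x y : Y} (hxy : k x = k y) {t : ℝ}
    (h1 : h x ≤ t) (h2 : t ≤ h y) : ∃ z, k z = k x ∧ h z = t := by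
  have := (hh.preconnected (k x)).image h hh.continuous_h.continuousOn
  obtain ⟨z, hz, rfl⟩ := this.Icc_subset ⟨x, rfl, rfl⟩ ⟨y, hxy.symm, rfl⟩ ⟨h1, h2⟩
  exact ⟨z, hz, rfl⟩

variable [CompactSpace Y] [T1Space K]

/-- The fibre outside `O` is compact and its heights miss `h x`, hence miss a neighbourhood of `h
x`. Since the fibre is connected and nondegenerate, its heights fill an interval on at least one
side of `h x`. -/
theorem IsHeight.exists_interval (hh : IsHeight k h) {x x' : Y} (hk : k x = k x') (hne : x ≠ x')
    {O : Set Y} (hO : IsOpen O) (hx : x ∈ O) :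
    ∃ α β, α < β ∧ ∀ t ∈ Ioo α β, ∃ z ∈ O, k z = k x ∧ h z = t := by
  have hF : IsClosed (h '' (k ⁻¹' {k x} \ O)) := by
    refine IsCompact.isClosed (IsCompact.image (IsClosed.isCompact ?_) hh.continuous_h)
    exact (isClosed_singleton.preimage hh.continuous_k).sdiff hO
  have hxF : h x ∈ (h '' (k ⁻¹' {k x} \ O))ᶜ := by
    rintro ⟨z, ⟨hz, hzO⟩, hzx⟩
    rw [hh.inj z x hz hzx] at hzO
    exact hzO hx
  obtain ⟨ε, hε, hball⟩ := Metric.isOpen_iff.1 hF.isOpen_compl _ hxF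
  have key : ∀ t, |t - h x| < ε → (∃ z, k z = k x ∧ h z = t) → ∃ z ∈ O, k z = k x ∧ h z = t := by
    rintro t ht ⟨z, hz, rfl⟩
    refine ⟨z, ?_, hz, rfl⟩
    by_contra hzO
    exact hball (by rwa [Metric.mem_ball, Real.dist_eq]) ⟨z, ⟨hz, hzO⟩, rfl⟩
  rcases lt_trichotomy (h x) (h x') with hlt | heq | hlt
  · refine ⟨h x, min (h x + ε) (h x'), by simp [hε, hlt], fun t ht => key t ?_ ?_⟩
    · rw [abs_lt]
      constructor <;> linarith [ht.1, ht.2.trans_le (min_le_left _ _)]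
    · exact hh.exists_of_between hk ht.1.le (ht.2.le.trans (min_le_right _ _))
  · exact absurd (hh.inj _ _ hk heq) hne
  · refine ⟨max (h x - ε) (h x'), h x, by simp [hε, hlt], fun t ht => key t ?_ ?_⟩
    · rw [abs_lt]
      constructor <;> linarith [ht.2, (le_max_left _ _).trans_lt ht.1]
    · obtain ⟨z, hz, hzt⟩ :=
        hh.exists_of_between hk.symm ((le_max_right _ _).trans ht.1.le) ht.2.le
      exact ⟨z, hz.trans hk.symm, hzt⟩

theorem IsHeight.exists_crosses (hh : IsHeight k h) {x x' : Y} (hk : k x = k x') (hne : x ≠ x')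
    {O : Set Y} (hO : IsOpen O) (hx : x ∈ O) :
    ∃ s, (∃ z ∈ O, h z = s) ∧ Crosses k h (k x) O s := by
  obtain ⟨α, β, hαβ, H⟩ := hh.exists_interval hk hne hO hx
  obtain ⟨s, hs1, hs2⟩ := exists_between hαβ
  obtain ⟨s', hs1', hs2'⟩ := exists_between hs1
  obtain ⟨s'', hs1'', hs2''⟩ := exists_between hs2
  obtain ⟨z, hz, -, hzs⟩ := H s ⟨hs1, hs2⟩
  obtain ⟨z', hz', hkz', hzs'⟩ := H s' ⟨hs1', hs2'.trans hs2⟩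
  obtain ⟨z'', hz'', hkz'', hzs''⟩ := H s'' ⟨hs1.trans hs1'', hs2''⟩
  exact ⟨s, ⟨z, hz, hzs⟩, ⟨z', hz', hkz', by rwa [hzs']⟩, ⟨z'', hz'', hkz'', by rwa [hzs'']⟩⟩

theorem HasDenseArcs.exists_crosses (ha : HasDenseArcs k h) (hh : IsHeight k h) {O O' : Set Y}
    (hO : IsOpen O) (hO' : IsOpen O') {x y : Y} (hx : x ∈ O) (hy : y ∈ O') (hxy : k x = k y) :
    ∃ c s t, (∃ z ∈ O, h z = s) ∧ (∃ z ∈ O', h z = t) ∧ Crosses k h c O s ∧ Crosses k h c O' t := by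
  obtain ⟨a, b, hab, hk, -, ⟨h1, h2⟩ | ⟨h1, h2⟩⟩ := ha O O' hO hO' x hx y hy hxy
  · obtain ⟨s, hs, hs'⟩ := hh.exists_crosses hk hab hO h1
    obtain ⟨t, ht, ht'⟩ := hh.exists_crosses hk.symm hab.symm hO' h2
    exact ⟨k a, s, t, hs, ht, hs', hk ▸ ht'⟩
  · obtain ⟨s, hs, hs'⟩ := hh.exists_crosses hk hab hO' h1
    obtain ⟨t, ht, ht'⟩ := hh.exists_crosses hk.symm hab.symm hO h2
    exact ⟨k a, t, s, ht, hs, hk ▸ ht', hs'⟩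

omit [CompactSpace Y] [T1Space K] [TopologicalSpace Y] [TopologicalSpace K] in
theorem Crosses.mono {c : K} {N N' : Set Y} {t : ℝ} (hc : Crosses k h c N t) (hN : N ⊆ N') :
    Crosses k h c N' t := by
  obtain ⟨⟨z, hz, h1⟩, z', hz', h2⟩ := hc
  exact ⟨⟨z, hN hz, h1⟩, z', hN hz', h2⟩

theorem exists_ball_of_continuous {X : Type*} [TopologicalSpace X] {f : ℝ × ℝ → X}
    (hf : Continuous f) {U : Set X} (hU : IsOpen U) {s t : ℝ} (hst : f (s, t) ∈ U) :
    ∃ ε > 0, ∀ s' t', |s' - s| < ε → |t' - t| < ε → f (s', t') ∈ U := by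
  obtain ⟨ε, hε, H⟩ := Metric.isOpen_iff.1 (hU.preimage hf) _ hst
  refine ⟨ε, hε, fun s' t' hs ht => H ?_⟩
  rw [Metric.mem_ball, Prod.dist_eq, max_lt_iff]
  exact ⟨hs, ht⟩

/-- `W` is open because crossings survive small changes of the level. Where the configuration `P`
occurs, the arc condition supplies a nondegenerate fibre with its ends near `y` and `y'`; moving the
levels slightly to heights crossed by that fibre lands in `W`. So `W ∪ (closure P)ᶜ` is open and
dense. -/
theorem residual_crosses (hh : IsHeight k h) (ha : HasDenseArcs k h) (m n : ℕ) {N N' : Set Y}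
    (hN : IsOpen N) (hN' : IsOpen N') :
    ∀ᶠ d in residual (ℕ → ℝ), ∀ y ∈ N, ∀ y' ∈ N', k y = k y' → h y = d m → h y' = d n →
      ∃ c, Crosses k h c N (d m) ∧ Crosses k h c N' (d n) := by
  let W : Set (ℕ → ℝ) := {d | ∃ c, Crosses k h c N (d m) ∧ Crosses k h c N' (d n)}
  let P : Set (ℕ → ℝ) := {d | ∃ y ∈ N, ∃ y' ∈ N', k y = k y' ∧ h y = d m ∧ h y' = d n}
  have hW : IsOpen W := by
    rw [isOpen_iff_mem_nhds]
    rintro d ⟨c, ⟨⟨z₁, h1, h1', h1''⟩, z₂, h2, h2', h2''⟩, ⟨z₃, h3, h3', h3''⟩, z₄, h4, h4', h4''⟩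
    have cm : Tendsto (fun e : ℕ → ℝ => e m) (𝓝 d) (𝓝 (d m)) := (continuous_apply m).tendsto d
    have cn : Tendsto (fun e : ℕ → ℝ => e n) (𝓝 d) (𝓝 (d n)) := (continuous_apply n).tendsto d
    filter_upwards [cm.eventually (lt_mem_nhds h1''), cm.eventually (gt_mem_nhds h2''),
      cn.eventually (lt_mem_nhds h3''), cn.eventually (gt_mem_nhds h4'')] with e e1 e2 e3 e4
    exact ⟨c, ⟨⟨z₁, h1, h1', e1⟩, z₂, h2, h2', e2⟩, ⟨z₃, h3, h3', e3⟩, z₄, h4, h4', e4⟩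
  have hdense : Dense (W ∪ (closure P)ᶜ) := by
    rw [dense_iff_inter_open]
    intro U hU hUne
    by_cases hsub : U ⊆ closure P
    swap
    · obtain ⟨d, hd, hdP⟩ := not_subset.1 hsub
      exact ⟨d, hd, .inr hdP⟩
    obtain ⟨d₀, hd₀⟩ := hUne
    obtain ⟨d, hdU, y, hy, y', hy', hk, h1, h2⟩ := mem_closure_iff.1 (hsub hd₀) U hU hd₀
    have hopen : ∀ (t ε : ℝ), IsOpen {z | |h z - t| < ε} := fun t ε =>
      isOpen_lt (hh.continuous_h.sub continuous_const).abs continuous_const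
    by_cases hmn : m = n
    · subst hmn
      -- With `m = n` the two points coincide and only one level may be moved; a single crossing
      -- inside `N ∩ N'` serves both sets.
      obtain rfl : y = y' := hh.inj _ _ hk (h1.trans h2.symm)
      obtain ⟨ε, hε, H⟩ := exists_ball_of_continuous
        (f := fun p : ℝ × ℝ => Function.update d m p.1) (by fun_prop) hU
        (s := d m) (t := 0) (by simpa using hdU)
      obtain ⟨c, s, -, ⟨z, hz, rfl⟩, -, hs, -⟩ := ha.exists_crosses hh
        ((hN.inter hN').inter (hopen (d m) ε)) isOpen_univ (x := y)
        ⟨⟨hy, hy'⟩, by simpa [h1] using hε⟩ (mem_univ y) rfl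
      refine ⟨_, H (h z) 0 hz.2 (by simpa using hε), .inl ⟨c, ?_⟩⟩
      simp only [Function.update_self]
      exact ⟨hs.mono fun z hz => hz.1.1, hs.mono fun z hz => hz.1.2⟩
    · obtain ⟨ε, hε, H⟩ := exists_ball_of_continuous
        (f := fun p : ℝ × ℝ => Function.update (Function.update d m p.1) n p.2) (by fun_prop) hU
        (s := d m) (t := d n) (by simpa using hdU)
      obtain ⟨c, s, t, ⟨z, hz, rfl⟩, ⟨z', hz', rfl⟩, hs, ht⟩ := ha.exists_crosses hh
        (hN.inter (hopen (d m) ε)) (hN'.inter (hopen (d n) ε)) (x := y) (y := y')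
        ⟨hy, by simpa [h1] using hε⟩ ⟨hy', by simpa [h2] using hε⟩ hk
      refine ⟨_, H (h z) (h z') hz.2 hz'.2, .inl ⟨c, ?_⟩⟩
      simp only [Function.update_self, Function.update_of_ne hmn]
      exact ⟨hs.mono fun z hz => hz.1, ht.mono fun z hz => hz.1⟩
  filter_upwards [residual_of_dense_open (hW.union isClosed_closure.isOpen_compl) hdense]
    with d hd y hy y' hy' hk h1 h2
  rcases hd with hd | hd
  · exact hd
  · have : d ∈ P := ⟨y, hy, y', hy', hk, h1, h2⟩
    exact absurd (subset_closure this) hd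

theorem residual_injective : ∀ᶠ d in residual (ℕ → ℝ), Function.Injective d := by
  have key : ∀ m n : ℕ, ∀ᶠ d in residual (ℕ → ℝ), d m = d n → m = n := by
    intro m n
    by_cases hmn : m = n
    · exact .of_forall fun _ _ => hmn
    have ho : IsOpen {d : ℕ → ℝ | d m ≠ d n} :=
      isOpen_ne_fun (continuous_apply m) (continuous_apply n)
    refine mem_of_superset (residual_of_dense_open ho ?_) fun d hd h => absurd h hd
    rw [dense_iff_inter_open]
    rintro U hU ⟨d, hd⟩
    obtain ⟨ε, hε, H⟩ := exists_ball_of_continuous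
      (f := fun p : ℝ × ℝ => Function.update d m p.1) (by fun_prop) hU
      (s := d m) (t := 0) (by simpa using hd)
    by_cases heq : d m = d n
    · refine ⟨_, H (d m + ε / 2) 0 (by rw [add_sub_cancel_left, abs_of_pos (half_pos hε)]; linarith)
        (by simpa using hε), ?_⟩
      simp only [mem_ofPred_eq, Function.update_self, Function.update_of_ne (Ne.symm hmn)]
      linarith
    · exact ⟨d, hd, heq⟩
  filter_upwards [eventually_countable_forall.2 fun m => eventually_countable_forall.2 (key m)]
    with d hd m n using hd m n

theorem residual_denseRange : ∀ᶠ d in residual (ℕ → ℝ), DenseRange d := by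
  have key : ∀ U ∈ TopologicalSpace.countableBasis ℝ,
      ∀ᶠ d in residual (ℕ → ℝ), ∃ n, (d : ℕ → ℝ) n ∈ U := by
    intro U hU
    have hUo := TopologicalSpace.isOpen_of_mem_countableBasis hU
    obtain ⟨t, ht⟩ := TopologicalSpace.nonempty_of_mem_countableBasis hU
    have ho : IsOpen {d : ℕ → ℝ | ∃ n, d n ∈ U} := by
      simp only [ofPred_exists]
      exact isOpen_iUnion fun n => hUo.preimage (continuous_apply n)
    refine residual_of_dense_open ho ?_
    rw [dense_iff_inter_open]
    rintro V hV ⟨d, hd⟩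
    have hlim : Tendsto (fun n => Function.update d n t) atTop (𝓝 d) := by
      rw [tendsto_pi_nhds]
      intro i
      refine tendsto_const_nhds.congr' ?_
      filter_upwards [eventually_gt_atTop i] with n hn
      rw [Function.update_of_ne hn.ne]
    obtain ⟨n, hn⟩ := (hlim.eventually (hV.mem_nhds hd)).exists
    exact ⟨_, hn, n, by simpa using ht⟩
  filter_upwards [(eventually_countable_ball (TopologicalSpace.countable_countableBasis ℝ)).2 key]
    with d hd
  refine (TopologicalSpace.isBasis_countableBasis ℝ).dense_iff.2 fun U hU _ => ?_
  obtain ⟨n, hn⟩ := hd U hU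
  exact ⟨_, hn, n, rfl⟩

/-- Baire category in `ℕ → ℝ`; it is enough to treat `N` and `N'` from a countable basis. -/
theorem exists_isGeneric [SecondCountableTopology Y] (hh : IsHeight k h) (ha : HasDenseArcs k h) :
    ∃ d, IsGeneric k h d := by
  let b := TopologicalSpace.countableBasis Y
  have hb : b.Countable := TopologicalSpace.countable_countableBasis Y
  have key : ∀ᶠ d in residual (ℕ → ℝ), ∀ m n : ℕ, ∀ N ∈ b, ∀ N' ∈ b,
      ∀ y ∈ N, ∀ y' ∈ N', k y = k y' → h y = d m → h y' = d n →
      ∃ c, Crosses k h c N (d m) ∧ Crosses k h c N' (d n) := by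
    simp only [eventually_countable_forall, eventually_countable_ball hb]
    intro m n N hN N' hN'
    exact residual_crosses hh ha m n (TopologicalSpace.isOpen_of_mem_countableBasis hN)
      (TopologicalSpace.isOpen_of_mem_countableBasis hN')
  obtain ⟨d, h1, h2, h3⟩ :=
    (dense_of_mem_residual (residual_injective.and (residual_denseRange.and key))).nonempty
  refine ⟨d, h1, h2, fun m n N N' hN hN' y hy y' hy' hk e1 e2 => ?_⟩
  have hB := TopologicalSpace.isBasis_countableBasis Y
  obtain ⟨V, hV, hyV, hVN⟩ := hB.mem_nhds_iff.1 (hN.mem_nhds hy)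
  obtain ⟨V', hV', hyV', hVN'⟩ := hB.mem_nhds_iff.1 (hN'.mem_nhds hy')
  obtain ⟨c, hc, hc'⟩ := h3 m n V hV V' hV' y hyV y' hyV' hk e1 e2
  exact ⟨c, hc.mono hVN, hc'.mono hVN'⟩

end Generic

/-! ### The split space -/

/-- The space obtained from `Y` by doubling all points whose height is one of the levels `d n`. -/
def Split {Y : Type u} {K : Type v} (_k : Y → K) (h : Y → ℝ) (d : ℕ → ℝ) : Type u :=
  {p : Y × (ℕ → Bool) // ∀ n, (p.2 n = true → d n ≤ h p.1) ∧ (p.2 n = false → h p.1 ≤ d n)}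

namespace Split

variable {Y : Type u} {K : Type v} {k : Y → K} {h : Y → ℝ} {d : ℕ → ℝ}

/-- The underlying point. -/
def pt (x : Split k h d) : Y := x.1.1

/-- The side of the levels on which a point lies. -/
def bit (x : Split k h d) (n : ℕ) : Bool := x.1.2 n

theorem le_of_bit (x : Split k h d) {n : ℕ} (hn : x.bit n = true) : d n ≤ h x.pt := (x.2 n).1 hn

theorem ge_of_bit (x : Split k h d) {n : ℕ} (hn : x.bit n = false) : h x.pt ≤ d n := (x.2 n).2 hn

theorem bit_of_lt (x : Split k h d) {n : ℕ} (hn : d n < h x.pt) : x.bit n = true := by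
  by_contra hb
  exact (x.ge_of_bit (by simpa using hb)).not_gt hn

theorem bit_of_gt (x : Split k h d) {n : ℕ} (hn : h x.pt < d n) : x.bit n = false := by
  by_contra hb
  exact (x.le_of_bit (by simpa using hb)).not_gt hn

theorem bit_anti (x : Split k h d) {m n : ℕ} (hmn : d m < d n) (hn : x.bit n = true) :
    x.bit m = true := x.bit_of_lt (hmn.trans_le (x.le_of_bit hn))

theorem ext {x y : Split k h d} (hp : x.pt = y.pt) (hb : ∀ n, x.bit n = y.bit n) : x = y :=
  Subtype.ext (Prod.ext hp (funext hb))

instance : LRStructure (Split k h d) where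
  R x y := x.pt = y.pt
  le x y := k x.pt = k y.pt ∧ ∀ n, x.bit n = true → y.bit n = true

open Classical in
/-- The lower copy of a point. -/
noncomputable def lo (k : Y → K) (h : Y → ℝ) (d : ℕ → ℝ) (y : Y) : Split k h d :=
  ⟨(y, fun n => decide (d n < h y)), fun n => by
    simp only [decide_eq_true_eq, decide_eq_false_iff_not, not_lt]
    exact ⟨le_of_lt, id⟩⟩

open Classical in
/-- The upper copy of a point. -/
noncomputable def up (k : Y → K) (h : Y → ℝ) (d : ℕ → ℝ) (y : Y) : Split k h d :=
  ⟨(y, fun n => decide (d n ≤ h y)), fun n => by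
    simp only [decide_eq_true_eq, decide_eq_false_iff_not, not_le]
    exact ⟨id, le_of_lt⟩⟩

theorem pt_lo (y : Y) : (lo k h d y).pt = y := rfl

theorem pt_up (y : Y) : (up k h d y).pt = y := rfl

theorem bit_lo {y : Y} {n : ℕ} : (lo k h d y).bit n = true ↔ d n < h y := by
  simp [lo, bit]

theorem bit_up {y : Y} {n : ℕ} : (up k h d y).bit n = true ↔ d n ≤ h y := by
  simp [up, bit]

theorem lo_le (x : Split k h d) : LRStructure.le (lo k h d x.pt) x :=
  ⟨rfl, fun _ hn => x.bit_of_lt (bit_lo.1 hn)⟩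

theorem le_up (x : Split k h d) : LRStructure.le x (up k h d x.pt) :=
  ⟨rfl, fun _ hn => bit_up.2 (x.le_of_bit hn)⟩

theorem le_of_height_lt {x y : Split k h d} (hk : k x.pt = k y.pt) (hlt : h x.pt < h y.pt) :
    LRStructure.le x y :=
  ⟨hk, fun _ hn => y.bit_of_lt ((x.le_of_bit hn).trans_lt hlt)⟩

theorem R_lo_up (y : Y) : LRStructure.R (lo k h d y) (up k h d y) := rfl

theorem exists_level_of_lo_ne_up {y : Y} (hne : lo k h d y ≠ up k h d y) : ∃ n, h y = d n := by
  by_contra! hy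
  refine hne (ext rfl fun n => ?_)
  rw [Bool.eq_iff_iff, bit_lo, bit_up]
  exact ⟨le_of_lt, fun h => h.lt_of_ne (hy n).symm⟩

theorem le_refl (x : Split k h d) : LRStructure.le x x := ⟨rfl, fun _ => id⟩

theorem surjective_pt : Function.Surjective (pt : Split k h d → Y) := fun y => ⟨lo k h d y, rfl⟩

/-- Points of a fibre with the same sides coincide. -/
theorem eq_of_bits [TopologicalSpace Y] [TopologicalSpace K] (hh : IsHeight k h)
    (hd : DenseRange d) {x y : Split k h d} (hk : k x.pt = k y.pt)
    (hb : ∀ n, x.bit n = y.bit n) : x = y := by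
  have key : ∀ x y : Split k h d, (∀ n, x.bit n = y.bit n) → ¬ h x.pt < h y.pt := by
    intro x y hb hlt
    obtain ⟨n, h1, h2⟩ := hd.exists_mem_open isOpen_Ioo (nonempty_Ioo.2 hlt)
    have h1' := x.bit_of_gt h1
    rw [hb, y.bit_of_lt h2] at h1'
    exact absurd h1' (by simp)
  refine ext (hh.inj _ _ hk ?_) hb
  exact le_antisymm (not_lt.1 (key y x fun n => (hb n).symm)) (not_lt.1 (key x y hb))

section Topology

variable [TopologicalSpace Y]

instance : TopologicalSpace (Split k h d) :=
  inferInstanceAs (TopologicalSpace {p : Y × (ℕ → Bool) //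
    ∀ n, (p.2 n = true → d n ≤ h p.1) ∧ (p.2 n = false → h p.1 ≤ d n)})

theorem continuous_pt : Continuous (pt : Split k h d → Y) :=
  continuous_fst.comp continuous_subtype_val

theorem continuous_bit (n : ℕ) : Continuous (fun x : Split k h d => x.bit n) :=
  (continuous_apply n).comp (continuous_snd.comp continuous_subtype_val)

theorem isClopen_bit (n : ℕ) : IsClopen {x : Split k h d | x.bit n = true} :=
  (isClopen_discrete {true}).preimage (continuous_bit n)

theorem compactSpace [CompactSpace Y] (hh : Continuous h) : CompactSpace (Split k h d) := by
  suffices H : IsClosed {p : Y × (ℕ → Bool) |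
      ∀ n, (p.2 n = true → d n ≤ h p.1) ∧ (p.2 n = false → h p.1 ≤ d n)} from
    isCompact_iff_compactSpace.1 H.isCompact
  simp only [ofPred_forall, ofPred_and]
  refine isClosed_iInter fun n => IsClosed.inter ?_ ?_
  · have : {p : Y × (ℕ → Bool) | p.2 n = true → d n ≤ h p.1} =
        {p | p.2 n = false} ∪ {p | d n ≤ h p.1} := by
      ext p
      cases hp : p.2 n <;> simp [hp]
    rw [this]
    exact (isClosed_eq (by fun_prop) continuous_const).union
      (isClosed_le continuous_const (by fun_prop))
  · have : {p : Y × (ℕ → Bool) | p.2 n = false → h p.1 ≤ d n} =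
        {p | p.2 n = true} ∪ {p | h p.1 ≤ d n} := by
      ext p
      cases hp : p.2 n <;> simp [hp]
    rw [this]
    exact (isClosed_eq (by fun_prop) continuous_const).union
      (isClosed_le (by fun_prop) continuous_const)

instance [T2Space Y] : T2Space (Split k h d) :=
  inferInstanceAs (T2Space {p : Y × (ℕ → Bool) //
    ∀ n, (p.2 n = true → d n ≤ h p.1) ∧ (p.2 n = false → h p.1 ≤ d n)})

variable [TopologicalSpace K] [CompactSpace K] [T2Space K] [TotallyDisconnectedSpace K]

/-- Different fibres are separated by clopen sets of `K`. Within a fibre, dense levels separate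
points, and being on a given side of a level is a clopen condition. -/
theorem totallySeparatedSpace (hh : IsHeight k h) (hd : DenseRange d) :
    TotallySeparatedSpace (Split k h d) := by
  rw [totallySeparatedSpace_iff_exists_isClopen]
  intro x y hxy
  by_cases hk : k x.pt = k y.pt
  · have : ∃ n, x.bit n ≠ y.bit n := by
      by_contra! hb
      exact hxy (eq_of_bits hh hd hk hb)
    obtain ⟨n, hn⟩ := this
    refine ⟨_, (isClopen_discrete {x.bit n}).preimage (continuous_bit n), rfl, ?_⟩
    exact fun h' => hn (Eq.symm h')
  · have : TotallySeparatedSpace K := inferInstance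
    obtain ⟨U, hU, hx, hy⟩ := totallySeparatedSpace_iff_exists_isClopen.1 this hk
    exact ⟨_, hU.preimage (hh.continuous_k.comp continuous_pt), hx, hy⟩

theorem isTopStructure [CompactSpace Y] [T2Space Y] [SecondCountableTopology Y] (hh : IsHeight k h)
    (hd : DenseRange d) : IsTopStructure (Split k h d) where
  compact := compactSpace hh.continuous_h
  metrizable := by
    have := compactSpace (k := k) (d := d) hh.continuous_h
    have : SecondCountableTopology (Split k h d) :=
      Topology.IsEmbedding.subtypeVal.secondCountableTopology
    exact TopologicalSpace.metrizableSpace_of_t3_secondCountable _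
  zeroDim := by
    have := compactSpace (k := k) (d := d) hh.continuous_h
    have := totallySeparatedSpace (k := k) hh hd
    exact isTopologicalBasis_isClopen
  isClosed_R := isClosed_eq (continuous_pt.comp continuous_fst) (continuous_pt.comp continuous_snd)
  isClosed_le := by
    have hk := hh.continuous_k.comp (continuous_pt (k := k) (h := h) (d := d))
    refine IsClosed.inter (isClosed_eq (hk.comp continuous_fst) (hk.comp continuous_snd)) ?_
    suffices H : IsClosed {p : Split k h d × Split k h d |
        ∀ n, p.1.bit n = true → p.2.bit n = true} from H
    rw [ofPred_forall]
    refine isClosed_iInter fun n => ?_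
    have : {p : Split k h d × Split k h d | p.1.bit n = true → p.2.bit n = true} =
        {p | p.1.bit n = true}ᶜ ∪ {p | p.2.bit n = true} := by
      ext p
      simp [imp_iff_not_or]
    rw [this]
    exact (((isClopen_bit n).preimage continuous_fst).compl.union
      ((isClopen_bit n).preimage continuous_snd)).isClosed

end Topology

end Split

/-! ### Maps to walks given by finitely many levels -/

section CutIndex

/-- The number of the interval between the levels with indices `s 0, …, s (n - 1)`. -/
def cutIndex (s : ℕ → ℕ) (n : ℕ) (σ : ℕ → Bool) : ℕ :=
  Nat.find (p := fun i => i = n ∨ σ (s i) = false) ⟨n, .inl rfl⟩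

variable {s : ℕ → ℕ} {n : ℕ} {σ : ℕ → Bool}

theorem cutIndex_le : cutIndex s n σ ≤ n := Nat.find_min' _ (.inl rfl)

theorem bit_of_lt_cutIndex {i : ℕ} (hi : i < cutIndex s n σ) : σ (s i) = true := by
  have := Nat.find_min _ hi
  push Not at this
  simpa using this.2

theorem bit_cutIndex (hi : cutIndex s n σ < n) : σ (s (cutIndex s n σ)) = false :=
  (Nat.find_spec (p := fun i => i = n ∨ σ (s i) = false) ⟨n, .inl rfl⟩).resolve_left hi.ne

theorem cutIndex_congr {τ : ℕ → Bool} (h : ∀ i < n, σ (s i) = τ (s i)) :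
    cutIndex s n σ = cutIndex s n τ := by
  have key : ∀ σ τ : ℕ → Bool, (∀ i < n, σ (s i) = τ (s i)) →
      cutIndex s n σ ≤ cutIndex s n τ := by
    intro σ τ h
    refine Nat.find_min' _ ?_
    rcases (cutIndex_le (s := s) (n := n) (σ := τ)).lt_or_eq with h' | h'
    · exact .inr ((h _ h').trans (bit_cutIndex h'))
    · exact .inl h'
  exact le_antisymm (key _ _ h) (key _ _ fun i hi => (h i hi).symm)

variable {Y : Type u} {K : Type v} {k : Y → K} {h : Y → ℝ} {d : ℕ → ℝ}

theorem lt_cutIndex (x : Split k h d) (hs : ∀ i j, i < j → j < n → d (s i) < d (s j)) {i : ℕ}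
    (hi : i < n) (hb : x.bit (s i) = true) : i < cutIndex s n x.bit := by
  by_contra! hle
  have h1 := bit_cutIndex (hle.trans_lt hi)
  rcases hle.lt_or_eq with h2 | h2
  · rw [x.bit_anti (hs _ _ h2 hi) hb] at h1
    exact absurd h1 (by simp)
  · rw [h2, hb] at h1
    exact absurd h1 (by simp)

theorem cutIndex_mono {x y : Split k h d} (hxy : LRStructure.le x y) :
    cutIndex s n x.bit ≤ cutIndex s n y.bit := by
  refine Nat.find_min' _ ?_
  rcases (cutIndex_le (s := s) (n := n) (σ := y.bit)).lt_or_eq with h' | h'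
  · refine .inr ?_
    by_contra hb
    have h2 := bit_cutIndex h'
    rw [hxy.2 _ (by simpa using hb)] at h2
    exact absurd h2 (by simp)
  · exact .inl h'

/-- Two copies of a point differ only at levels equal to its height, and the levels `s i` are
distinct. -/
theorem cutIndex_le_succ {x y : Split k h d} (hs : ∀ i j, i < j → j < n → d (s i) < d (s j))
    (hxy : x.pt = y.pt) : cutIndex s n y.bit ≤ cutIndex s n x.bit + 1 := by
  by_contra! hlt
  have hn := cutIndex_le (s := s) (n := n) (σ := y.bit)
  have h1 := x.ge_of_bit (bit_cutIndex (s := s) (n := n) (σ := x.bit) (by omega))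
  have h2 := y.le_of_bit (bit_of_lt_cutIndex hlt)
  rw [hxy] at h1
  exact (h2.trans h1).not_gt (hs _ _ (Nat.lt_succ_self _) (by omega))

theorem isLocallyConstant_cutIndex [TopologicalSpace Y] :
    IsLocallyConstant (fun x : Split k h d => cutIndex s n x.bit) := by
  rw [IsLocallyConstant.iff_eventually_eq]
  intro x
  have : ∀ᶠ y : Split k h d in 𝓝 x, ∀ i ∈ Finset.range n, y.bit (s i) = x.bit (s i) := by
    rw [eventually_all_finset]
    intro i _
    exact (Split.continuous_bit (s i)).continuousAt.eventually
      (IsOpen.mem_nhds (isOpen_discrete {x.bit (s i)}) rfl)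
  filter_upwards [this] with y hy
  exact cutIndex_congr fun i hi => hy i (Finset.mem_range.2 hi)

/-- Following a walk along the levels is a homomorphism. -/
theorem IsWalk.isHom_cutIndex [TopologicalSpace Y] {B : Type w} [TopologicalSpace B]
    [LRStructure B] (hB : IsHPO B) {f : ℕ → B} (hf : IsWalk n f)
    (hs : ∀ i j, i < j → j < n → d (s i) < d (s j)) :
    IsHom (fun x : Split k h d => f (cutIndex s n x.bit)) where
  continuous := (isLocallyConstant_cutIndex.comp f).continuous
  map_le _ _ hxy := hB.walk_le hf (cutIndex_mono hxy) cutIndex_le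
  map_R x y hxy := by
    have h1 := cutIndex_le_succ hs hxy
    have h2 := cutIndex_le_succ hs (Eq.symm hxy)
    have h3 := cutIndex_le (s := s) (n := n) (σ := x.bit)
    have h4 := cutIndex_le (s := s) (n := n) (σ := y.bit)
    rcases lt_trichotomy (cutIndex s n x.bit) (cutIndex s n y.bit) with hlt | heq | hlt
    · have : cutIndex s n y.bit = cutIndex s n x.bit + 1 := by omega
      rw [this]
      exact hB.R_of_immSucc (hf _ (by omega))
    · rw [heq]
      exact hB.R_refl _
    · have : cutIndex s n x.bit = cutIndex s n y.bit + 1 := by omega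
      rw [this]
      exact hB.R_symm (hB.R_of_immSucc (hf _ (by omega)))

end CutIndex

/-! ### Locally constant selections on profinite spaces -/

section Selection

variable {K : Type u} [TopologicalSpace K] [CompactSpace K] [T2Space K] [TotallyDisconnectedSpace K]

/-- Neighbourhoods in a profinite space admit a locally constant idempotent choice of centres. -/
theorem exists_selection (V : K → Set K) (hV : ∀ c, V c ∈ 𝓝 c) :
    ∃ j : K → K, IsLocallyConstant j ∧ (∀ c, c ∈ V (j c)) ∧ ∀ c, j (j c) = j c := by
  rcases isEmpty_or_nonempty K with hK | hK
  · exact ⟨id, fun s => by rw [Subsingleton.elim (id ⁻¹' s) ∅]; exact isOpen_empty,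
      fun c => (hK.false c).elim, fun c => rfl⟩
  have hbasis := isTopologicalBasis_isClopen (X := K)
  choose W hW hcW hWV using fun c => hbasis.mem_nhds_iff.1 (hV c)
  obtain ⟨t, ht⟩ := isCompact_univ.elim_nhds_subcover W
    (fun c _ => (hW c).isOpen.mem_nhds (hcW c))
  -- Disjoint neighbourhoods of the finitely many centres: near a centre, that centre itself is
  -- selected, which gives idempotence. Elsewhere any centre whose `W` contains the point will do.
  obtain ⟨U, hU, hdisj⟩ := t.finite_toSet.t2_separation
  choose N hN hcN hNU using fun c => hbasis.mem_nhds_iff.1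
    (((hU c).2.inter (hW c).isOpen).mem_nhds ⟨(hU c).1, hcW c⟩)
  let S : K → Set K × Set K := fun x => ({c | c ∈ t ∧ x ∈ N c}, {c | c ∈ t ∧ x ∈ W c})
  have hS : IsLocallyConstant S := by
    rw [IsLocallyConstant.iff_eventually_eq]
    intro x
    have h1 : ∀ᶠ y in 𝓝 x, ∀ c ∈ t, (y ∈ N c) = (x ∈ N c) := by
      rw [eventually_all_finset]
      exact fun c _ => (isLocallyConstant_mem (hN c)).eventually_eq x
    have h2 : ∀ᶠ y in 𝓝 x, ∀ c ∈ t, (y ∈ W c) = (x ∈ W c) := by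
      rw [eventually_all_finset]
      exact fun c _ => (isLocallyConstant_mem (hW c)).eventually_eq x
    filter_upwards [h1, h2] with y hy1 hy2
    refine Prod.ext (Set.ext fun c => ?_) (Set.ext fun c => ?_)
    · exact and_congr_right fun hc => iff_of_eq (hy1 c hc)
    · exact and_congr_right fun hc => iff_of_eq (hy2 c hc)
  let P : Set K × Set K → K → Prop := fun T c => c ∈ T.1 ∨ T.1 = ∅ ∧ c ∈ T.2
  let j : K → K := fun x => Classical.epsilon (P (S x))
  have hj : ∀ x, P (S x) (j x) := by
    intro x
    refine Classical.epsilon_spec (p := P (S x)) ?_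
    rcases (S x).1.eq_empty_or_nonempty with h | ⟨c, hc⟩
    · obtain ⟨c, hct, hc⟩ := mem_iUnion₂.1 (ht.2 (mem_univ x))
      exact ⟨c, .inr ⟨h, hct, hc⟩⟩
    · exact ⟨c, .inl hc⟩
  have hjt : ∀ x, j x ∈ t ∧ x ∈ W (j x) := by
    intro x
    rcases hj x with h | ⟨-, h⟩
    · exact ⟨h.1, (hNU _ h.2).2⟩
    · exact h
  refine ⟨j, hS.comp (fun T => Classical.epsilon (P T)), fun c => hWV _ (hjt c).2, fun c => ?_⟩
  have hmem : j c ∈ (S (j c)).1 := ⟨(hjt c).1, hcN _⟩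
  rcases hj (j c) with h | ⟨h, -⟩
  · by_contra hne
    exact Set.disjoint_left.1 (hdisj h.1 (hjt c).1 hne) (hNU _ h.2).1 (hU _).1
  · rw [h] at hmem
    exact hmem.elim

/-- Removing the other points of `E` from each `V c` leaves a point of `E` no centre but itself. -/
theorem exists_selection_fixing (V : K → Set K) (hV : ∀ c, V c ∈ 𝓝 c) {E : Set K}
    (hE : E.Finite) :
    ∃ j : K → K, IsLocallyConstant j ∧ (∀ c, c ∈ V (j c)) ∧ ∀ c ∈ E, j c = c := by
  obtain ⟨j, hj, hjV, -⟩ := exists_selection (fun c => V c ∩ (E \ {c})ᶜ) fun c =>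
    inter_mem (hV c) (hE.sdiff.isClosed.isOpen_compl.mem_nhds fun h => h.2 rfl)
  refine ⟨j, hj, fun c => (hjV c).1, fun c hc => ?_⟩
  by_contra hne
  exact (hjV c).2 ⟨hc, fun h => hne h.symm⟩

end Selection

theorem exists_injective_of_infinite {I : Type u} {K : Type v} [Finite I] {S : I → Set K}
    (hS : ∀ i, (S i).Infinite) : ∃ e : I → K, Function.Injective e ∧ ∀ i, e i ∈ S i := by
  classical
  have := Fintype.ofFinite I
  have key : ∀ s : Finset I, ∃ e : I → K, InjOn e s ∧ ∀ i, e i ∈ S i := by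
    intro s
    induction s using Finset.induction_on with
    | empty =>
      choose e he using fun i => (hS i).nonempty
      exact ⟨e, by simp, he⟩
    | insert i s hi ih =>
      obtain ⟨e, he, heS⟩ := ih
      obtain ⟨c, hc, hcs⟩ := (hS i).exists_notMem_finset (s.image e)
      refine ⟨Function.update e i c, ?_, fun l => ?_⟩
      · have hup : ∀ l ∈ s, Function.update e i c l = e l := fun l hl =>
          Function.update_of_ne (by rintro rfl; exact hi hl) _ _
        rw [Finset.coe_insert, injOn_insert (by simpa using hi)]
        refine ⟨fun l hl l' hl' h => he hl hl' (by rwa [hup l hl, hup l' hl'] at h), ?_⟩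
        rintro ⟨l, hl, h⟩
        rw [hup l hl, Function.update_self] at h
        exact hcs (h ▸ Finset.mem_image_of_mem e hl)
      · by_cases hl : l = i
        · subst hl
          simpa using hc
        · rw [Function.update_of_ne hl]
          exact heS l
  obtain ⟨e, he, heS⟩ := key Finset.univ
  exact ⟨e, by simpa using he, heS⟩

/-! ### Lifting along a walk on one fibre -/

section Cuts

open Split

variable {Y : Type u} {K : Type v} [TopologicalSpace Y] [CompactSpace Y]
  [T2Space Y] {k : Y → K} {h : Y → ℝ} {d : ℕ → ℝ}

theorem Split.isClosedMap_pt (hh : Continuous h) : IsClosedMap (pt : Split k h d → Y) :=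
  have := compactSpace (k := k) (d := d) hh
  continuous_pt.isClosedMap

variable [TopologicalSpace K] {A : Type w} [TopologicalSpace A] [LRStructure A]

/-- A homomorphism which leaves the lower cone of `c` along a fibre does so at a doubled point. -/
theorem Split.exists_jump [DiscreteTopology A] (hh : IsHeight k h) (hA : IsHPO A)
    {φ : Split k h d → A} (hφ : IsHom φ) {y₀ y₁ : Y} (hk : k y₀ = k y₁) {c : A}
    (h₀ : LRStructure.le (φ (lo k h d y₀)) c) (h₁ : ¬ LRStructure.le (φ (up k h d y₁)) c) :
    ∃ y, k y = k y₀ ∧ LRStructure.le (φ (lo k h d y)) c ∧ ¬ LRStructure.le (φ (up k h d y)) c := by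
  let F : Set (Split k h d) := {x | LRStructure.le (φ x) c}
  have hF : IsClopen F := (isClopen_discrete {a | LRStructure.le a c}).preimage hφ.continuous
  have hcl := isClosedMap_pt (k := k) (d := d) hh.continuous_h
  -- The images of `F` and of its complement are closed and cover the connected fibre, so some point
  -- has copies in both.
  obtain ⟨y, hy, ⟨x, hx, rfl⟩, x', hx', hxx⟩ := isPreconnected_closed_iff.1
    (hh.preconnected (k y₀)) _ _ (hcl _ hF.isClosed) (hcl _ hF.compl.isClosed)
    (fun y _ => by
      by_cases hy : lo k h d y ∈ F
      · exact .inl ⟨_, hy, rfl⟩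
      · exact .inr ⟨_, hy, rfl⟩)
    ⟨y₀, rfl, lo k h d y₀, h₀, rfl⟩ ⟨y₁, hk.symm, up k h d y₁, h₁, rfl⟩
  refine ⟨x.pt, hy, hA.le_trans _ _ _ (hφ.map_le _ _ (lo_le x)) hx, fun hle => hx' ?_⟩
  rw [← hxx] at hle
  exact hA.le_trans _ _ _ (hφ.map_le _ _ (le_up x')) hle

/-- Finds the level realising one step `c, c'` of a walk above the previous cut `r`. `hbit` and
`hjump` say that the fibre above `r` has already reached `c` and that the remaining jumps of `φ` lie
strictly between `r` and `q`; the conclusion restores both for `c'` and the new level. -/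
theorem Split.exists_cut [DiscreteTopology A] (hh : IsHeight k h) (hd : DenseRange d)
    (hinj : Function.Injective d) (hA : IsFiniteHForest A) {φ : Split k h d → A} (hφ : IsHom φ)
    {y₀ y₁ : Y} (hk : k y₀ = k y₁)
    (hmin : ∀ y, k y = k y₀ → h y₀ ≤ h y) (hmax : ∀ y, k y = k y₀ → h y ≤ h y₁) {r q : ℝ}
    (hrq : r < q) {c c' : A} (hcc : ImmSucc c c') (hc₀ : LRStructure.le (φ (lo k h d y₀)) c)
    (hc₁ : LRStructure.le c' (φ (up k h d y₁)))
    (hbit : ∀ x : Split k h d, k x.pt = k y₀ → ∀ m, r < d m → x.bit m = true →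
      LRStructure.le c (φ x))
    (hjump : ∀ y, k y = k y₀ → LRStructure.le c (φ (lo k h d y)) →
      φ (lo k h d y) ≠ φ (up k h d y) → r < h y ∧ h y < q) :
    ∃ s, r < d s ∧ d s < q ∧
      (∀ x : Split k h d, k x.pt = k y₀ → (x.bit s = true → LRStructure.le c' (φ x)) ∧
        (x.bit s = false → LRStructure.le (φ x) c)) ∧
      ∀ y, k y = k y₀ → LRStructure.le c' (φ (lo k h d y)) →
        φ (lo k h d y) ≠ φ (up k h d y) → d s < h y := by
  have hO := hA.isHPO
  have hle₀ : ∀ x : Split k h d, k x.pt = k y₀ → LRStructure.le (φ (lo k h d y₀)) (φ x) :=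
    fun x hx => hφ.map_le _ _ ⟨hx.symm, fun n hn =>
      x.bit_of_lt ((bit_lo.1 hn).trans_le (hmin _ hx))⟩
  have hle₁ : ∀ x : Split k h d, k x.pt = k y₀ → LRStructure.le (φ x) (φ (up k h d y₁)) :=
    fun x hx => hφ.map_le _ _
      ⟨hx.trans hk, fun n hn => bit_up.2 ((x.le_of_bit hn).trans (hmax _ hx))⟩
  have hup : ∀ y, k y = k y₀ → ∀ t, k t = k y₀ → h y < h t →
      LRStructure.le (φ (up k h d y)) (φ (lo k h d t)) := fun y hy t ht hlt =>
    hφ.map_le _ _ (le_of_height_lt (hy.trans ht.symm) hlt)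
  -- If `c` is already the top value of the fibre, then `c' = c` and any level in between works.
  by_cases hce : c = φ (up k h d y₁)
  · obtain rfl : c' = c := hO.le_antisymm _ _ (hce ▸ hc₁) hcc.1
    obtain ⟨s, hs⟩ := hd.exists_mem_open isOpen_Ioo (nonempty_Ioo.2 hrq)
    refine ⟨s, hs.1, hs.2, fun x hx => ⟨hbit x hx s hs.1, fun _ => hce ▸ hle₁ x hx⟩, ?_⟩
    intro y hy hle hne
    refine absurd (hO.le_antisymm _ _ (hφ.map_le _ _ ((lo_le (up k h d y)))) ?_) hne
    exact hO.le_trans _ _ _ (hle₁ _ hy) (hce ▸ hle)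
  · have hc₁' := hO.le_trans _ _ _ hcc.1 hc₁
    -- Otherwise the fibre leaves the lower cone of `c` at a jump. Intervals are chains and the two
    -- copies have consecutive values, so the lower copy has value exactly `c`.
    obtain ⟨y, hy, hyl, hyu⟩ := exists_jump hh hO hφ hk hc₀
      (fun hle => hce (hO.le_antisymm _ _ hc₁' hle))
    have hcy : LRStructure.le c (φ (up k h d y)) :=
      (hA.interval_total hc₀ hc₁' (hle₀ (up k h d y) hy)
        (hle₁ (up k h d y) hy)).resolve_right hyu
    have him : ImmSucc (φ (lo k h d y)) (φ (up k h d y)) :=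
      hO.immSucc_of_R (hφ.map_R _ _ (R_lo_up y)) (hφ.map_le _ _ (lo_le (up k h d y)))
    obtain rfl : c = φ (lo k h d y) := by
      rcases him.2 c hyl hcy with h' | h'
      · exact h'
      · exact absurd (h' ▸ hO.le_refl _) hyu
    have hne : φ (lo k h d y) ≠ φ (up k h d y) := fun he => hyu (he ▸ hO.le_refl _)
    obtain ⟨hry, hyq⟩ := hjump y hy (hO.le_refl _) hne
    -- If the walk stalls, the cut goes below the jump, which is left for a later step. If it moves,
    -- the cut is the level of the jump itself and `c'` is the value of the upper copy.
    by_cases hcc' : φ (lo k h d y) = c'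
    · subst hcc'
      obtain ⟨s, hs⟩ := hd.exists_mem_open isOpen_Ioo (nonempty_Ioo.2 hry)
      refine ⟨s, hs.1, hs.2.trans hyq, fun x hx => ⟨hbit x hx s hs.1, fun hb => ?_⟩, ?_⟩
      · exact hφ.map_le _ _ (le_of_height_lt (hx.trans hy.symm) ((x.ge_of_bit hb).trans_lt hs.2))
      · intro t ht hle hne'
        by_contra! hlt
        refine hne' (hO.le_antisymm _ _ (hφ.map_le _ _ (lo_le (up k h d t))) ?_)
        exact hO.le_trans _ _ _ (hup t ht y hy (hlt.trans_lt hs.2)) hle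
    · have hlou : lo k h d y ≠ up k h d y := fun he => hne (congrArg φ he)
      obtain ⟨s, hs⟩ := exists_level_of_lo_ne_up hlou
      have hc'u : c' = φ (up k h d y) := by
        rcases hA.interval_total (hO.le_trans _ _ _ (hle₀ (lo k h d y) hy) hcc.1) hc₁
          (hle₀ (up k h d y) hy)
          (hle₁ (up k h d y) hy) with h' | h'
        · rcases him.2 c' hcc.1 h' with h'' | h''
          · exact absurd h''.symm hcc'
          · exact h''
        · rcases hcc.2 _ him.1 h' with h'' | h''
          · exact absurd h''.symm hne
          · exact h''.symm
      rw [hs] at hry hyq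
      refine ⟨s, hry, hyq, fun x hx => ⟨fun hb => ?_, fun hb => ?_⟩, ?_⟩
      · rw [hc'u]
        refine hφ.map_le _ _ ⟨hy.trans hx.symm, fun n hn => ?_⟩
        rcases (bit_up.1 hn).lt_or_eq with hlt | heq
        · exact x.bit_anti (hs ▸ hlt) hb
        · rwa [hinj (heq.trans hs)]
      · refine hφ.map_le _ _ ⟨hx.trans hy.symm, fun n hn => bit_lo.2 ?_⟩
        rw [hs]
        refine ((x.le_of_bit hn).trans (x.ge_of_bit hb)).lt_of_ne fun heq => ?_
        rw [hinj heq, hb] at hn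
        exact absurd hn (by simp)
      · intro t ht hle hne'
        by_contra! hlt
        rw [← hs] at hlt
        refine hcc' (hO.le_antisymm _ _ hcc.1 (hO.le_trans _ _ _ hle ?_))
        exact hφ.map_le _ _ ⟨ht.trans hy.symm, fun n hn => bit_lo.2 ((bit_lo.1 hn).trans_le hlt)⟩

/-- Induction along the walk: each new cut becomes the lower bound `r` for the rest. -/
theorem Split.exists_cuts [DiscreteTopology A] (hh : IsHeight k h) (hd : DenseRange d)
    (hinj : Function.Injective d) (hA : IsFiniteHForest A) {φ : Split k h d → A} (hφ : IsHom φ)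
    {y₀ y₁ : Y} (hk : k y₀ = k y₁)
    (hmin : ∀ y, k y = k y₀ → h y₀ ≤ h y) (hmax : ∀ y, k y = k y₀ → h y ≤ h y₁) {q : ℝ}
    (n : ℕ) {r : ℝ} {a : ℕ → A} (hrq : r < q) (ha : IsWalk n a)
    (ha₀ : LRStructure.le (φ (lo k h d y₀)) (a 0)) (ha₁ : a n = φ (up k h d y₁))
    (hbit : ∀ x : Split k h d, k x.pt = k y₀ → ∀ m, r < d m → x.bit m = true →
      LRStructure.le (a 0) (φ x))
    (hjump : ∀ y, k y = k y₀ → LRStructure.le (a 0) (φ (lo k h d y)) →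
      φ (lo k h d y) ≠ φ (up k h d y) → r < h y ∧ h y < q) :
    ∃ s : ℕ → ℕ, (∀ i j, i < j → j < n → d (s i) < d (s j)) ∧
      (∀ i < n, r < d (s i) ∧ d (s i) < q) ∧
      ∀ x : Split k h d, k x.pt = k y₀ → ∀ i < n,
        (x.bit (s i) = true → LRStructure.le (a (i + 1)) (φ x)) ∧
        (x.bit (s i) = false → LRStructure.le (φ x) (a i)) := by
  induction n generalizing r a with
  | zero => exact ⟨id, fun i j _ hj => by omega, fun i hi => by omega, fun x _ i hi => by omega⟩
  | succ n ih =>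
    have hO := hA.isHPO
    obtain ⟨s₀, hrs, hsq, hs, hsj⟩ := exists_cut hh hd hinj hA hφ hk hmin hmax hrq
      (ha 0 (Nat.succ_pos n)) ha₀ (ha₁ ▸ hO.walk_le ha (by omega) le_rfl) hbit hjump
    obtain ⟨s, hs1, hs2, hs3⟩ := ih (r := d s₀) (a := fun i => a (i + 1)) hsq
      (fun i hi => ha (i + 1) (by omega)) (hO.le_trans _ _ _ ha₀ (ha 0 (Nat.succ_pos n)).1) ha₁
      (fun x hx m hm hb => (hs x hx).1 (x.bit_anti hm hb))
      (fun y hy hle hne => ⟨hsj y hy hle hne,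
        (hjump y hy (hO.le_trans _ _ _ (ha 0 (Nat.succ_pos n)).1 hle) hne).2⟩)
    refine ⟨fun i => Nat.casesOn i s₀ s, ?_, ?_, ?_⟩
    · rintro (_ | i) (_ | j) hij hj
      · omega
      · exact (hs2 j (by omega)).1
      · omega
      · exact hs1 i j (by omega) (by omega)
    · rintro (_ | i) hi
      · exact ⟨hrs, hsq⟩
      · exact ⟨hrs.trans (hs2 i (by omega)).1, (hs2 i (by omega)).2⟩
    · rintro x hx (_ | i) hi
      · exact hs x hx
      · exact hs3 x hx i (by omega)

/-- A homomorphism to `A` lifts along a walk over its values on a single fibre. -/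
theorem Split.exists_lift_on_fiber [DiscreteTopology A] {B : Type*} [TopologicalSpace B]
    [LRStructure B] (hh : IsHeight k h) (hd : DenseRange d)
    (hinj : Function.Injective d) (hA : IsFiniteHForest A) (hB : IsHPO B) {φ : Split k h d → A}
    (hφ : IsHom φ) {g : B → A} (hg : IsHom g) {y₀ y₁ : Y} (hk : k y₀ = k y₁)
    (hmin : ∀ y, k y = k y₀ → h y₀ ≤ h y) (hmax : ∀ y, k y = k y₀ → h y ≤ h y₁) {p q : ℝ}
    (hpq : p < q) (hjump : ∀ y, k y = k y₀ → φ (lo k h d y) ≠ φ (up k h d y) → p < h y ∧ h y < q)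
    {n : ℕ} {f : ℕ → B} (hf : IsWalk n f) (hf₀ : g (f 0) = φ (lo k h d y₀))
    (hf₁ : g (f n) = φ (up k h d y₁)) :
    ∃ s : ℕ → ℕ, (∀ i j, i < j → j < n → d (s i) < d (s j)) ∧
      (∀ i < n, p < d (s i) ∧ d (s i) < q) ∧
      ∀ x : Split k h d, k x.pt = k y₀ → g (f (cutIndex s n x.bit)) = φ x := by
  have hO := hA.isHPO
  have hle₀ : ∀ x : Split k h d, k x.pt = k y₀ → LRStructure.le (φ (lo k h d y₀)) (φ x) :=
    fun x hx => hφ.map_le _ _ ⟨hx.symm, fun n hn =>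
      x.bit_of_lt ((bit_lo.1 hn).trans_le (hmin _ hx))⟩
  have hle₁ : ∀ x : Split k h d, k x.pt = k y₀ → LRStructure.le (φ x) (φ (up k h d y₁)) :=
    fun x hx => hφ.map_le _ _
      ⟨hx.trans hk, fun n hn => bit_up.2 ((x.le_of_bit hn).trans (hmax _ hx))⟩
  obtain ⟨s, hs, hs', hs''⟩ := exists_cuts hh hd hinj hA hφ hk hmin hmax n (a := g ∘ f) hpq
    (hf.map hO hB hg) (hf₀ ▸ hO.le_refl _) hf₁
    (fun x hx _ _ _ => by
      rw [Function.comp_apply, hf₀]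
      exact hle₀ x hx)
    (fun y hy _ => hjump y hy)
  -- The cut just below `x` bounds `φ x` from below and the cut just above it bounds `φ x` from
  -- above, by the same element of the walk. At the ends the extreme values of the fibre replace the
  -- missing cuts.
  refine ⟨s, hs, hs', fun x hx => hO.le_antisymm _ _ ?_ ?_⟩
  · rcases Nat.eq_zero_or_pos (cutIndex s n x.bit) with h0 | hpos
    · rw [h0, hf₀]
      exact hle₀ x hx
    · obtain ⟨i, hi⟩ : ∃ i, cutIndex s n x.bit = i + 1 := ⟨_, (Nat.succ_pred_eq_of_pos hpos).symm⟩
      have hn := cutIndex_le (s := s) (n := n) (σ := x.bit)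
      rw [hi]
      exact (hs'' x hx i (by omega)).1 (bit_of_lt_cutIndex (n := n) (by omega))
  · rcases (cutIndex_le (s := s) (n := n) (σ := x.bit)).lt_or_eq with hlt | heq
    · exact (hs'' x hx _ hlt).2 (bit_cutIndex hlt)
    · rw [heq, hf₁]
      exact hle₁ x hx

end Cuts

namespace Split

/-! ### Cores of values and arcs joining them -/

section Special

variable {Y : Type u} {K : Type v} [TopologicalSpace Y] [CompactSpace Y]
  [T2Space Y] {k : Y → K} {h : Y → ℝ} {d : ℕ → ℝ}
  {A : Type w} [TopologicalSpace A]

/-- The points all of whose copies are mapped to `a`. -/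
def core (φ : Split k h d → A) (a : A) : Set Y := {y | ∀ x, x.pt = y → φ x = a}

variable [DiscreteTopology A] {φ : Split k h d → A}

theorem isOpen_core (hh : Continuous h) (hφ : Continuous φ) (a : A) : IsOpen (core φ a) := by
  have hF : IsClosed (φ ⁻¹' {a}ᶜ) := (isClosed_discrete _).preimage hφ
  have : core φ a = (pt '' (φ ⁻¹' {a}ᶜ))ᶜ := by
    ext y
    simp only [core, mem_ofPred_eq, mem_compl_iff, mem_image, not_exists, not_and, mem_preimage,
      mem_singleton_iff]
    exact forall_congr' fun x => ⟨fun h1 h2 h3 => h2 (h1 h3), fun h1 h2 => by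
      by_contra h3
      exact h1 h3 h2⟩
  rw [this]
  exact (isClosedMap_pt hh _ hF).isOpen_compl

/-- A point off the levels has a single copy. A point on a level `d m` has its copies told apart by
bit `m` alone, as `d` is injective; since `pt` is a closed map, nearby points strictly on the side
of `x` have all their copies sent to `φ x`. -/
theorem mem_core_or (hh : Continuous h) (hinj : Function.Injective d) (hφ : Continuous φ)
    (x : Split k h d) : x.pt ∈ core φ (φ x) ∨ ∃ m N, IsOpen N ∧ x.pt ∈ N ∧ h x.pt = d m ∧
      ((∀ z ∈ N, d m < h z → z ∈ core φ (φ x)) ∨ ∀ z ∈ N, h z < d m → z ∈ core φ (φ x)) := by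
  by_cases hlev : ∃ m, h x.pt = d m
  · obtain ⟨m, hm⟩ := hlev
    right
    have huniq : ∀ y : Split k h d, y.pt = x.pt → y.bit m = x.bit m → y = x := by
      intro y hy hb
      refine ext hy fun n => ?_
      by_cases hnm : n = m
      · rw [hnm, hb]
      · rcases lt_or_gt_of_ne (fun he => hnm (hinj he) : d n ≠ d m) with hlt | hlt
        · rw [y.bit_of_lt (by rwa [hy, hm]), x.bit_of_lt (by rwa [hm])]
        · rw [y.bit_of_gt (by rwa [hy, hm]), x.bit_of_gt (by rwa [hm])]
    have hF : IsClosed (φ ⁻¹' {φ x}ᶜ ∩ (fun y : Split k h d => y.bit m) ⁻¹' {x.bit m}) :=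
      ((isClosed_discrete _).preimage hφ).inter
        ((isClosed_discrete _).preimage (continuous_bit m))
    have hN := (isClosedMap_pt hh _ hF).isOpen_compl
    refine ⟨m, _, hN, ?_, hm, ?_⟩
    · rintro ⟨y, ⟨hy, hb⟩, hyx⟩
      exact hy (congrArg φ (huniq y hyx hb))
    · have key : ∀ z ∈ (pt '' (φ ⁻¹' {φ x}ᶜ ∩
          (fun y : Split k h d => y.bit m) ⁻¹' {x.bit m}))ᶜ,
          (∀ y : Split k h d, y.pt = z → y.bit m = x.bit m) → z ∈ core φ (φ x) := by
        intro z hz hb y hy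
        by_contra hne
        exact hz ⟨y, ⟨hne, hb y hy⟩, hy⟩
      rcases Bool.eq_false_or_eq_true (x.bit m) with hb | hb
      · left
        rintro z hz hlt
        exact key z hz fun y hy => by rw [hb]; exact y.bit_of_lt (by rwa [hy])
      · right
        rintro z hz hlt
        exact key z hz fun y hy => by rw [hb]; exact y.bit_of_gt (by rwa [hy])
  · left
    push Not at hlev
    intro y hy
    congr 1
    refine ext hy fun n => ?_
    rcases lt_or_gt_of_ne (hlev n) with hlt | hlt
    · rw [y.bit_of_gt (by rwa [hy]), x.bit_of_gt hlt]
    · rw [y.bit_of_lt (by rwa [hy]), x.bit_of_lt hlt]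

variable [TopologicalSpace K] [T1Space K]

/-- Brings both cases of `mem_core_or` to the form required by genericity: inside an open core, a
nondegenerate fibre meets some level. -/
theorem exists_level_near (hh : IsHeight k h) (hd : IsGeneric k h d) (hφ : Continuous φ)
    (x : Split k h d) {w : Y} (hw : k x.pt = k w) (hne : x.pt ≠ w) :
    ∃ y m N, k y = k x.pt ∧ IsOpen N ∧ y ∈ N ∧ h y = d m ∧
      ((∀ z ∈ N, d m < h z → z ∈ core φ (φ x)) ∨ ∀ z ∈ N, h z < d m → z ∈ core φ (φ x)) := by
  rcases mem_core_or hh.continuous_h hd.injective hφ x with hx | ⟨m, N, hN, hx, hm, H⟩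
  · have ho := isOpen_core hh.continuous_h hφ (φ x)
    obtain ⟨α, β, hαβ, H⟩ := hh.exists_interval hw hne ho hx
    obtain ⟨m, hm⟩ := hd.denseRange.exists_mem_open isOpen_Ioo (nonempty_Ioo.2 hαβ)
    obtain ⟨y, hy, hky, hhy⟩ := H _ hm
    exact ⟨y, m, _, hky, ho, hy, hhy, .inl fun z hz _ => hz⟩
  · exact ⟨x.pt, m, N, rfl, hN, hx, hm, H⟩

/-- A one-sided neighbourhood of `x` might miss the fibres near `x'`. Genericity rules this out: one
fibre crosses both levels, so it has points on whichever sides are wanted. -/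
theorem exists_core_pair (hh : IsHeight k h) (hd : IsGeneric k h d) (hφ : Continuous φ)
    {x x' : Split k h d} (hxx : k x.pt = k x'.pt) :
    ∃ z ∈ core φ (φ x), ∃ z' ∈ core φ (φ x'), k z = k z' := by
  have key : ∀ {c : K} {m : ℕ} {N : Set Y} {a : A}, Crosses k h c N (d m) →
      ((∀ z ∈ N, d m < h z → z ∈ core φ a) ∨ ∀ z ∈ N, h z < d m → z ∈ core φ a) →
      ∃ z ∈ core φ a, k z = c := by
    rintro c m N a ⟨⟨z, hz, hkz, h1⟩, z', hz', hkz', h2⟩ (H | H)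
    · exact ⟨z', H z' hz' h2, hkz'⟩
    · exact ⟨z, H z hz h1, hkz⟩
  have fin : ∀ {y y' : Y} {m m' : ℕ} {N N' : Set Y}, k y = k y' → IsOpen N → IsOpen N' → y ∈ N →
      y' ∈ N' → h y = d m → h y' = d m' →
      ((∀ z ∈ N, d m < h z → z ∈ core φ (φ x)) ∨ ∀ z ∈ N, h z < d m → z ∈ core φ (φ x)) →
      ((∀ z ∈ N', d m' < h z → z ∈ core φ (φ x')) ∨ ∀ z ∈ N', h z < d m' → z ∈ core φ (φ x')) →
      ∃ z ∈ core φ (φ x), ∃ z' ∈ core φ (φ x'), k z = k z' := by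
    intro y y' m m' N N' hk hN hN' hy hy' hm hm' H H'
    obtain ⟨c, hc, hc'⟩ := hd.crosses m m' N N' hN hN' y hy y' hy' hk hm hm'
    obtain ⟨z, hz, hzc⟩ := key hc H
    obtain ⟨z', hz', hzc'⟩ := key hc' H'
    exact ⟨z, hz, z', hz', hzc.trans hzc'.symm⟩
  by_cases hs : ∃ w, k x.pt = k w ∧ x.pt ≠ w
  · obtain ⟨w, hw, hne⟩ := hs
    obtain ⟨w', hw', hne'⟩ : ∃ w', k x'.pt = k w' ∧ x'.pt ≠ w' := by
      by_cases h' : x'.pt = w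
      · exact ⟨x.pt, hxx.symm, by rw [h']; exact hne.symm⟩
      · exact ⟨w, hxx.symm.trans hw, h'⟩
    obtain ⟨y, m, N, hk, hN, hy, hm, H⟩ := exists_level_near hh hd hφ x hw hne
    obtain ⟨y', m', N', hk', hN', hy', hm', H'⟩ := exists_level_near hh hd hφ x' hw' hne'
    exact fin (hk.trans (hxx.trans hk'.symm)) hN hN' hy hy' hm hm' H H'
  · push Not at hs
    have hpt : x.pt = x'.pt := hs _ hxx
    rcases mem_core_or hh.continuous_h hd.injective hφ x with hx | ⟨m, N, hN, hy, hm, H⟩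
    · have : φ x' = φ x := hx x' hpt.symm
      exact ⟨_, hx, _, by rw [this]; exact hx, rfl⟩
    · rcases mem_core_or hh.continuous_h hd.injective hφ x' with hx' | ⟨m', N', hN', hy', hm', H'⟩
      · have : φ x = φ x' := hx' x hpt
        exact ⟨_, by rw [this]; exact hx', _, hx', rfl⟩
      · exact fin hxx hN hN' hy hy' hm hm' H H'

/-- The fibre over `c` is nondegenerate, with least point in the core of `a` and greatest point in
the core of `a'`. -/
def Joins (φ : Split k h d → A) (a a' : A) (c : K) : Prop :=
  ∃ y₀ y₁, k y₀ = c ∧ k y₁ = c ∧ (∀ y, k y = c → h y₀ ≤ h y ∧ h y ≤ h y₁) ∧ y₀ ≠ y₁ ∧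
    y₀ ∈ core φ a ∧ y₁ ∈ core φ a'

variable [LRStructure A]

/-- If there were only finitely many such fibres, deleting their least points would leave the cores
open and still meeting a common fibre, because nondegenerate fibres have infinitely many points in
an open set they meet. The arc condition would then give a joining fibre with a new least point. -/
theorem infinite_joins (hh : IsHeight k h) (hd : IsGeneric k h d) (harc : HasDenseArcs k h)
    (hA : IsHPO A) (hφ : IsHom φ) {x x' : Split k h d} (hxx : LRStructure.le x x') :
    {c | Joins φ (φ x) (φ x') c}.Infinite := by
  intro hfin
  have hO := isOpen_core hh.continuous_h hφ.continuous (φ x)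
  have hO' := isOpen_core hh.continuous_h hφ.continuous (φ x')
  have hends : ∀ c, ∃ E : Set Y, E.Finite ∧ (Joins φ (φ x) (φ x') c → ∃ y₀ ∈ E, k y₀ = c ∧
      ∀ y, k y = c → h y₀ ≤ h y) := by
    intro c
    by_cases hc : Joins φ (φ x) (φ x') c
    · obtain ⟨y₀, y₁, h0, -, h1, -⟩ := hc
      exact ⟨{y₀}, finite_singleton _, fun _ => ⟨y₀, rfl, h0, fun y hy => (h1 y hy).1⟩⟩
    · exact ⟨∅, finite_empty, fun h' => absurd h' hc⟩
  choose E hE hE' using hends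
  have hEfin : (⋃ c ∈ {c | Joins φ (φ x) (φ x') c}, E c).Finite := hfin.biUnion fun c _ => hE c
  set F := ⋃ c ∈ {c | Joins φ (φ x) (φ x') c}, E c with hF
  obtain ⟨z, hz, z', hz', hzz⟩ := exists_core_pair hh hd hφ.continuous hxx.1
  have havoid : ∀ {U : Set Y} {y w : Y}, IsOpen U → y ∈ U → k y = k w → y ≠ w →
      ∃ t ∈ U \ F, k t = k y := by
    intro U y w hU hy hk hne
    obtain ⟨α, β, hαβ, H⟩ := hh.exists_interval hk hne hU hy
    obtain ⟨s, hs, hsF⟩ := (Ioo_infinite hαβ).exists_notMem_finset (hEfin.image h).toFinset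
    obtain ⟨t, ht, hkt, rfl⟩ := H s hs
    refine ⟨t, ⟨ht, fun htF => hsF ?_⟩, hkt⟩
    simpa using ⟨t, htF, rfl⟩
  have hpair : ∃ t ∈ core φ (φ x) \ F, ∃ t' ∈ core φ (φ x') \ F, k t = k t' := by
    obtain ⟨a, b, hab, hk, -, ⟨ha, hb⟩ | ⟨ha, hb⟩⟩ := harc _ _ hO hO' z hz z' hz' hzz
    · obtain ⟨t, ht, hkt⟩ := havoid hO ha hk hab
      obtain ⟨t', ht', hkt'⟩ := havoid hO' hb hk.symm hab.symm
      exact ⟨t, ht, t', ht', hkt.trans (hk.trans hkt'.symm)⟩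
    · obtain ⟨t, ht, hkt⟩ := havoid hO hb hk.symm hab.symm
      obtain ⟨t', ht', hkt'⟩ := havoid hO' ha hk hab
      exact ⟨t, ht, t', ht', hkt.trans (hk.symm.trans hkt'.symm)⟩
  obtain ⟨t, ht, t', ht', hkt⟩ := hpair
  have hUF : IsOpen (core φ (φ x) \ F) := hO.sdiff hEfin.isClosed
  have hUF' : IsOpen (core φ (φ x') \ F) := hO'.sdiff hEfin.isClosed
  obtain ⟨a, b, hab, hk, hext, H⟩ := harc _ _ hUF hUF' t ht t' ht' hkt
  have haF : a ∉ F := by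
    rcases H with H | H
    · exact H.1.2
    · exact H.1.2
  have hJ : Joins φ (φ x) (φ x') (k a) := by
    refine ⟨a, b, rfl, hk.symm, hext, hab, ?_⟩
    rcases H with H | H
    · exact ⟨H.1.1, H.2.1⟩
    -- The arc may run the wrong way; monotonicity of `φ` then forces `φ x = φ x'`.
    · have h1 : φ (lo k h d a) = φ x' := H.1.1 _ rfl
      have h2 : φ (up k h d b) = φ x := H.2.1 _ rfl
      have h3 : LRStructure.le (lo k h d a) (up k h d b) :=
        ⟨hk, fun n hn => bit_up.2 ((bit_lo.1 hn).le.trans (hext b hk.symm).1)⟩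
      have h4 := hφ.map_le _ _ h3
      rw [h1, h2] at h4
      have h5 := hA.le_antisymm _ _ (hφ.map_le _ _ hxx) h4
      rw [h5] at H ⊢
      exact ⟨H.1.1, H.2.1⟩
  obtain ⟨y₀, hy₀, hk₀, hmin⟩ := hE' _ hJ
  obtain rfl : y₀ = a := hh.inj _ _ hk₀ (le_antisymm (hmin a rfl) (hext y₀ hk₀).1)
  exact haF (mem_biUnion hJ hy₀)

end Special

/-! ### Nearby fibres and patching -/

section Fibers

variable {Y : Type u} {K : Type v} [TopologicalSpace Y] [TopologicalSpace K] {k : Y → K}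
  {h : Y → ℝ} {d : ℕ → ℝ}

theorem exists_fiber_extremes [CompactSpace Y] [T1Space K] (hh : IsHeight k h) (c : K) :
    ∃ y₀ y₁, k y₀ = c ∧ k y₁ = c ∧ ∀ y, k y = c → h y₀ ≤ h y ∧ h y ≤ h y₁ := by
  have hcomp : IsCompact (k ⁻¹' {c}) := (isClosed_singleton.preimage hh.continuous_k).isCompact
  have hne : (k ⁻¹' {c}).Nonempty := hh.surjective c
  obtain ⟨y₀, h0, hmin⟩ := hcomp.exists_isMinOn hne hh.continuous_h.continuousOn
  obtain ⟨y₁, h1, hmax⟩ := hcomp.exists_isMaxOn hne hh.continuous_h.continuousOn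
  exact ⟨y₀, y₁, h0, h1, fun y hy => ⟨hmin hy, hmax hy⟩⟩

/-- A closed set which misses a fibre misses all nearby fibres. -/
theorem nhds_fiber [CompactSpace Y] [T2Space K] (hh : IsHeight k h) {F : Set (Split k h d)}
    (hF : IsClosed F) {c : K}
    (hc : ∀ x : Split k h d, k x.pt = c → x ∉ F) :
    {c' | ∀ x : Split k h d, k x.pt = c' → x ∉ F} ∈ 𝓝 c := by
  have := compactSpace (k := k) (d := d) hh.continuous_h
  have hcl : IsClosedMap (fun x : Split k h d => k x.pt) :=
    (hh.continuous_k.comp continuous_pt).isClosedMap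
  filter_upwards [(hcl F hF).isOpen_compl.mem_nhds fun ⟨x, hx, hxc⟩ => hc x hxc hx]
    with c' hc' x hx hxF
  exact hc' ⟨x, hxF, hx⟩

variable {B : Type w} [TopologicalSpace B] [LRStructure B]

/-- Homomorphisms chosen locally over the space of fibres form a homomorphism. -/
theorem isHom_patch (hh : IsHeight k h) {ℓ : K → Split k h d → B} (hℓ : ∀ c, IsHom (ℓ c))
    {j : K → K} (hj : IsLocallyConstant j) : IsHom (fun x : Split k h d => ℓ (j (k x.pt)) x) where
  continuous := by
    rw [continuous_iff_continuousAt]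
    intro x
    refine ((hℓ (j (k x.pt))).continuous.continuousAt (x := x)).congr ?_
    filter_upwards [(hj.comp_continuous (hh.continuous_k.comp
      (continuous_pt (k := k) (h := h) (d := d)))).eventually_eq x] with y hy
    simp only [Function.comp_apply] at hy
    rw [hy]
  map_R x y hxy := by
    have : x.pt = y.pt := hxy
    rw [this]
    exact (hℓ _).map_R _ _ hxy
  map_le x y hxy := by
    rw [hxy.1]
    exact (hℓ _).map_le _ _ hxy

end Fibers

/-! ### The lifting property of the split space -/

section Lift

variable {Y : Type u} {K : Type v} [TopologicalSpace Y] [CompactSpace Y]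
  [T2Space Y] [TopologicalSpace K] {k : Y → K} {h : Y → ℝ} {d : ℕ → ℝ}
  {A B : Type w} [TopologicalSpace A] [LRStructure A] [DiscreteTopology A]
  [TopologicalSpace B] [LRStructure B] {φ : Split k h d → A} {g : B → A}

/-- At the ends of the fibre `φ` does not jump, so all cuts can be placed strictly inside. The least
and greatest points then get the ends `b` and `b'` of the walk. If `b'` immediately succeeds `b`,
the two copies of the point on the first cut realise the edge. -/
theorem exists_local_lift_of_joins (hh : IsHeight k h) (hd : IsGeneric k h d)
    (hA : IsFiniteHForest A) (hB : IsFiniteHForest B) (hφ : IsHom φ) (hg : IsHom g)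
    {b b' : B} (hbb : LRStructure.le b b') {c : K} (hc : Joins φ (g b) (g b') c) :
    ∃ ℓ : Split k h d → B, IsHom ℓ ∧ (∀ x : Split k h d, k x.pt = c → g (ℓ x) = φ x) ∧
      (∃ x x' : Split k h d, k x.pt = c ∧ LRStructure.le x x' ∧ ℓ x = b ∧ ℓ x' = b') ∧
      (ImmSucc b b' → b ≠ b' →
        ∃ x x' : Split k h d, k x.pt = c ∧ LRStructure.R x x' ∧ ℓ x = b ∧ ℓ x' = b') := by
  obtain ⟨y₀, y₁, rfl, hk, hext, hne, hc₀, hc₁⟩ := hc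
  have := hB.finite
  obtain ⟨n, f, rfl, rfl, hf, hst⟩ := hB.isHPO.exists_walk hbb
  have hlt : h y₀ < h y₁ := (hext _ hk).1.lt_of_ne fun he => hne (hh.inj _ _ hk.symm he)
  obtain ⟨s, hs, hpq, hlift⟩ := exists_lift_on_fiber hh hd.denseRange hd.injective hA hB.isHPO hφ
    hg hk.symm (fun y hy => (hext y hy).1) (fun y hy => (hext y hy).2)
    (p := h y₀) (q := h y₁) hlt
    (fun y hy hj => by
      refine ⟨(hext y hy).1.lt_of_ne fun he => hj ?_, (hext y hy).2.lt_of_ne fun he => hj ?_⟩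
      · obtain rfl := hh.inj _ _ hy.symm he
        rw [hc₀ _ (pt_lo y₀), hc₀ _ (pt_up y₀)]
      · obtain rfl := hh.inj _ _ (hy.trans hk.symm) he
        rw [hc₁ _ (pt_lo y), hc₁ _ (pt_up y)]) hf
    (hc₀ _ (pt_lo y₀)).symm (hc₁ _ (pt_up y₁)).symm
  have hlo : ∀ y, (0 < n → h y ≤ d (s 0)) → cutIndex s n (lo k h d y).bit = 0 := by
    intro y hy
    by_contra hpos
    have hb := bit_of_lt_cutIndex (Nat.pos_of_ne_zero hpos)
    have hn := cutIndex_le (s := s) (n := n) (σ := (lo k h d y).bit)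
    exact (bit_lo.1 hb).not_ge (hy (by omega))
  refine ⟨_, hf.isHom_cutIndex hB.isHPO hs, hlift,
    ⟨lo k h d y₀, up k h d y₁, rfl,
      ⟨hk.symm, fun n hn => bit_up.2 ((bit_lo.1 hn).le.trans (hext _ hk).1)⟩, ?_, ?_⟩, ?_⟩
  · rw [hlo y₀ fun hn => (hpq 0 hn).1.le]
  · congr 1
    by_contra hn
    have hlt' := lt_of_le_of_ne (cutIndex_le (s := s) (n := n) (σ := (up k h d y₁).bit)) hn
    have hb := bit_cutIndex hlt'
    rw [bit_up.2 (hpq _ hlt').2.le] at hb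
    exact absurd hb (by simp)
  · intro him hne'
    obtain ⟨hn, h1⟩ := hB.isHPO.walk_one hf hst him hne'
    obtain ⟨y, hy, hys⟩ := hh.exists_of_between hk.symm (hpq 0 hn).1.le (hpq 0 hn).2.le
    refine ⟨lo k h d y, up k h d y, hy, R_lo_up y, ?_, ?_⟩
    · rw [hlo y fun _ => hys.le]
    · have h2 := lt_cutIndex (up k h d y) hs hn (bit_up.2 hys.ge)
      have h3 := cutIndex_le_succ (x := lo k h d y) (y := up k h d y) hs rfl
      rw [hlo y fun _ => hys.le] at h3
      have h4 : cutIndex s n (up k h d y).bit = 1 := by omega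
      rw [h4, h1]

theorem exists_local_lift [T1Space K] (hh : IsHeight k h) (hd : IsGeneric k h d)
    (hA : IsFiniteHForest A) (hB : IsFiniteHForest B) (hφ : IsHom φ) (hg : IsEpi g) (c : K) :
    ∃ ℓ : Split k h d → B, IsHom ℓ ∧ ∀ x : Split k h d, k x.pt = c → g (ℓ x) = φ x := by
  obtain ⟨y₀, y₁, rfl, hk, hext⟩ := exists_fiber_extremes hh c
  have := hB.finite
  have hle : LRStructure.le (φ (lo k h d y₀)) (φ (up k h d y₁)) := hφ.map_le _ _
    ⟨hk.symm, fun n hn => bit_up.2 ((bit_lo.1 hn).le.trans (hext _ hk).1)⟩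
  obtain ⟨b, b', hb, hb', hbb⟩ := (hg.le_iff _ _).1 hle
  obtain ⟨n, f, rfl, rfl, hf, -⟩ := hB.isHPO.exists_walk hbb
  obtain ⟨s, hs, -, hlift⟩ := exists_lift_on_fiber hh hd.denseRange hd.injective hA hB.isHPO hφ
    hg.isHom hk.symm (fun y hy => (hext y hy).1) (fun y hy => (hext y hy).2)
    -- The fibre may be a single point, so the cuts are allowed to miss it.
    (p := h y₀ - 1) (q := h y₁ + 1) (by linarith [(hext _ hk).1])
    (fun y hy _ => ⟨by linarith [(hext y hy).1], by linarith [(hext y hy).2]⟩) hf hb hb'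
  exact ⟨_, hf.isHom_cutIndex hB.isHPO hs, hlift⟩



/-- Local lifts are correct on neighbourhoods of fibres and are patched by a locally constant
selection. Distinct joining fibres are reserved for the comparable pairs of `B` and kept fixed by
the selection, so the patched map realises every relation. -/
theorem exists_lift [CompactSpace K] [T2Space K] [TotallyDisconnectedSpace K] (hh : IsHeight k h)
    (hd : IsGeneric k h d) (harc : HasDenseArcs k h) (hA : IsFiniteHForest A)
    (hB : IsFiniteHForest B) (hφ : IsEpi φ) (hg : IsEpi g) :
    ∃ ℓ : Split k h d → B, IsEpi ℓ ∧ g ∘ ℓ = φ := by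
  have := hB.finite
  obtain ⟨e, he, hjoin⟩ := exists_injective_of_infinite
    (S := fun p : {p : B × B // LRStructure.le p.1 p.2} =>
      {c : K | Joins φ (g p.1.1) (g p.1.2) c}) (fun p => by
      obtain ⟨x, x', hx, hx', hxx⟩ := (hφ.le_iff _ _).1 (hg.isHom.map_le _ _ p.2)
      rw [← hx, ← hx']
      exact infinite_joins hh hd harc hA.isHPO hφ.isHom hxx)
  have hloc : ∀ c : K, ∃ ℓ : Split k h d → B, IsHom ℓ ∧
      (∀ x : Split k h d, k x.pt = c → g (ℓ x) = φ x) ∧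
      ∀ p, e p = c → (∃ x x' : Split k h d, k x.pt = c ∧ LRStructure.le x x' ∧
        ℓ x = p.1.1 ∧ ℓ x' = p.1.2) ∧ (ImmSucc p.1.1 p.1.2 → p.1.1 ≠ p.1.2 →
        ∃ x x' : Split k h d, k x.pt = c ∧ LRStructure.R x x' ∧ ℓ x = p.1.1 ∧ ℓ x' = p.1.2) := by
    intro c
    by_cases hc : ∃ p, e p = c
    · obtain ⟨p, rfl⟩ := hc
      obtain ⟨ℓ, h1, h2, h3⟩ := exists_local_lift_of_joins hh hd hA hB hφ.isHom hg.isHom p.2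
        (hjoin p)
      refine ⟨ℓ, h1, h2, fun p' hp' => ?_⟩
      obtain rfl := he hp'
      exact h3
    · obtain ⟨ℓ, h1, h2⟩ := exists_local_lift hh hd hA hB hφ.isHom hg c
      exact ⟨ℓ, h1, h2, fun p hp => absurd ⟨p, hp⟩ hc⟩
  choose ℓ hℓ hlift hreal using hloc
  obtain ⟨j, hj, hjV, hfix⟩ := exists_selection_fixing
    (fun c => {c' | ∀ x : Split k h d, k x.pt = c' → x ∉ {x | g (ℓ c x) ≠ φ x}})
    (fun c => nhds_fiber hh (by
      have hcont : Continuous fun x => (g (ℓ c x), φ x) :=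
        (hg.continuous.comp (hℓ c).continuous).prodMk hφ.continuous
      exact (isClosed_discrete {p : A × A | p.1 ≠ p.2}).preimage hcont)
      fun x hx => not_not.2 (hlift c x hx)) (finite_range e)
  have hom := isHom_patch hh hℓ hj
  have hfix' : ∀ p (x : Split k h d), k x.pt = e p → ℓ (j (k x.pt)) x = ℓ (e p) x := by
    intro p x hx
    rw [hx, hfix _ (mem_range_self p)]
  have hle : ∀ b b', LRStructure.le b b' → ∃ x x' : Split k h d,
      ℓ (j (k x.pt)) x = b ∧ ℓ (j (k x'.pt)) x' = b' ∧ LRStructure.le x x' := by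
    intro b b' hbb
    obtain ⟨x, x', hx, hxx, h1, h2⟩ := (hreal _ ⟨(b, b'), hbb⟩ rfl).1
    exact ⟨x, x', (hfix' _ _ hx).trans h1, (hfix' _ _ (hxx.1.symm.trans hx)).trans h2, hxx⟩
  have hsurj : Function.Surjective fun x : Split k h d => ℓ (j (k x.pt)) x := by
    intro b
    obtain ⟨x, -, hx, -⟩ := hle b b (hB.isHPO.le_refl b)
    exact ⟨x, hx⟩
  have hR : ∀ b b', ImmSucc b b' → b ≠ b' → ∃ x x' : Split k h d,
      ℓ (j (k x.pt)) x = b ∧ ℓ (j (k x'.pt)) x' = b' ∧ LRStructure.R x x' := by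
    intro b b' hbb hne
    obtain ⟨x, x', hx, hxx, h1, h2⟩ := (hreal _ ⟨(b, b'), hbb.1⟩ rfl).2 hbb hne
    have hpt : x.pt = x'.pt := hxx
    exact ⟨x, x', (hfix' _ _ hx).trans h1, (hfix' _ _ (hpt ▸ hx)).trans h2, hxx⟩
  refine ⟨_, .of_isHom hom hsurj ?_ hle, ?_⟩
  · intro b b' hbb
    rcases (hB.isHPO.R_iff b b').1 hbb with rfl | h' | h'
    · obtain ⟨x, hx⟩ := hsurj b
      exact ⟨x, x, hx, hx, rfl⟩
    · by_cases hne : b = b'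
      · subst hne
        obtain ⟨x, hx⟩ := hsurj b
        exact ⟨x, x, hx, hx, rfl⟩
      · exact hR b b' h' hne
    · by_cases hne : b' = b
      · subst hne
        obtain ⟨x, hx⟩ := hsurj b'
        exact ⟨x, x, hx, hx, rfl⟩
      · obtain ⟨x, x', h1, h2, h3⟩ := hR b' b h' hne
        exact ⟨x', x, h2, h1, Eq.symm h3⟩
  · funext x
    exact not_not.1 (hjV (k x.pt) x rfl)

end Lift

end Split

/-! ### Refining clopen coverings of the split space -/

theorem exists_sorted (d : ℕ → ℝ) (hd : Function.Injective d) (S : Finset ℕ) :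
    ∃ (n : ℕ) (s : ℕ → ℕ), (∀ i j, i < j → j < n → d (s i) < d (s j)) ∧
      ∀ m, m ∈ S ↔ ∃ i < n, s i = m := by
  classical
  induction S using Finset.induction_on_max_value d with
  | empty => exact ⟨0, id, fun i j _ hj => by omega, by simp⟩
  | insert a S ha hmax ih =>
    obtain ⟨n, s, hs, hmem⟩ := ih
    refine ⟨n + 1, Function.update s n a, fun i j hij hj => ?_, fun m => ?_⟩
    · rw [Function.update_of_ne (by omega : i ≠ n)]
      rcases (Nat.lt_succ_iff.1 hj).lt_or_eq with hj' | rfl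
      · rw [Function.update_of_ne (by omega : j ≠ n)]
        exact hs i j hij hj'
      · rw [Function.update_self]
        have hi := (hmem (s i)).2 ⟨i, hij, rfl⟩
        exact (hmax _ hi).lt_of_ne fun he => ha (hd he ▸ hi)
    · rw [Finset.mem_insert, hmem]
      constructor
      · rintro (rfl | ⟨i, hi, rfl⟩)
        · exact ⟨n, by omega, Function.update_self ..⟩
        · exact ⟨i, by omega, Function.update_of_ne (by omega) ..⟩
      · rintro ⟨i, hi, rfl⟩
        rcases (Nat.lt_succ_iff.1 hi).lt_or_eq with hi' | rfl
        · exact .inr ⟨i, hi', by rw [Function.update_of_ne (by omega : i ≠ n)]⟩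
        · exact .inl (Function.update_self ..)

namespace Split

variable {Y : Type u} {K : Type v} {k : Y → K} {h : Y → ℝ} {d : ℕ → ℝ}
  {s : ℕ → ℕ} {n : ℕ}

theorem le_of_cutIndex_lt (hd : Function.Injective d) {x y : Split k h d} (hk : k x.pt = k y.pt)
    (hlt : cutIndex s n x.bit < cutIndex s n y.bit) : LRStructure.le x y := by
  have hx := bit_cutIndex (hlt.trans_le cutIndex_le)
  have hy := bit_of_lt_cutIndex hlt
  refine ⟨hk, fun m hm => ?_⟩
  by_cases he : m = s (cutIndex s n x.bit)
  · rwa [he]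
  · exact y.bit_of_lt ((((x.le_of_bit hm).trans (x.ge_of_bit hx)).lt_of_ne
      fun h' => he (hd h')).trans_le (y.le_of_bit hy))

theorem cutIndex_lo_up (hs : ∀ i j, i < j → j < n → d (s i) < d (s j)) {i : ℕ} (hi : i < n)
    {y : Y} (hy : h y = d (s i)) :
    cutIndex s n (lo k h d y).bit = i ∧ cutIndex s n (up k h d y).bit = i + 1 := by
  have h1 := lt_cutIndex (up k h d y) hs hi (bit_up.2 hy.ge)
  have h2 := cutIndex_le_succ (x := lo k h d y) (y := up k h d y) hs rfl
  have h3 : cutIndex s n (lo k h d y).bit ≤ i := by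
    by_contra! hlt
    exact (bit_lo.1 (bit_of_lt_cutIndex hlt)).ne' hy
  omega

theorem bit_eq_of_cutIndex_eq (hs : ∀ i j, i < j → j < n → d (s i) < d (s j)) {x y : Split k h d}
    (hxy : cutIndex s n x.bit = cutIndex s n y.bit) {i : ℕ} (hi : i < n) :
    x.bit (s i) = y.bit (s i) := by
  rw [Bool.eq_iff_iff]
  exact ⟨fun hb => bit_of_lt_cutIndex (hxy ▸ lt_cutIndex x hs hi hb),
    fun hb => bit_of_lt_cutIndex (hxy ▸ lt_cutIndex y hs hi hb)⟩

variable [TopologicalSpace Y] [CompactSpace Y] [TopologicalSpace K]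

theorem exists_cutIndex_eq [T1Space K] (hh : IsHeight k h) {c : K}
    (hs : ∀ i j, i < j → j < n → d (s i) < d (s j))
    (hhit : ∀ i < n, ∃ y, k y = c ∧ h y = d (s i)) {i : ℕ} (hi : i ≤ n) :
    ∃ x : Split k h d, k x.pt = c ∧ cutIndex s n x.bit = i := by
  rcases hi.lt_or_eq with hi | rfl
  · obtain ⟨y, hy, hys⟩ := hhit i hi
    exact ⟨lo k h d y, hy, (cutIndex_lo_up hs hi hys).1⟩
  · obtain ⟨_, y₁, _, hy₁, hext⟩ := exists_fiber_extremes hh c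
    refine ⟨up k h d y₁, hy₁, ?_⟩
    by_contra hne
    have hlt := lt_of_le_of_ne cutIndex_le hne
    obtain ⟨y, hy, hys⟩ := hhit _ hlt
    have hb := bit_cutIndex hlt
    rw [bit_up.2 (hys ▸ (hext y hy).2)] at hb
    exact absurd hb (by simp)

/-- A covering of a fibre by open sets is refined by finitely many levels. -/
theorem exists_forall_bit_eq [T1Space K] (hh : IsHeight k h) (hd : DenseRange d)
    {𝒰 : Set (Set (Split k h d))}
    (h𝒰 : ∀ U ∈ 𝒰, IsOpen U) (hcov : ⋃₀ 𝒰 = univ) (c : K) :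
    ∃ M : ℕ, ∀ x : Split k h d, k x.pt = c → ∃ U ∈ 𝒰, ∀ x' : Split k h d, k x'.pt = c →
      (∀ m < M, x'.bit m = x.bit m) → x' ∈ U := by
  have := compactSpace (k := k) (d := d) hh.continuous_h
  have hF : IsClosed {x : Split k h d | k x.pt = c} :=
    isClosed_singleton.preimage (hh.continuous_k.comp continuous_pt)
  have hlocal : ∀ x : Split k h d, k x.pt = c → ∃ U ∈ 𝒰, ∃ M, ∀ x' : Split k h d, k x'.pt = c →
      (∀ m < M, x'.bit m = x.bit m) → x' ∈ U := by
    intro x hx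
    obtain ⟨U, hU, hxU⟩ := mem_sUnion.1 (hcov ▸ mem_univ x)
    refine ⟨U, hU, ?_⟩
    by_contra! hne
    have hcl : ∀ M, IsClosed ({x' : Split k h d | k x'.pt = c} ∩
        {x' | ∀ m < M, x'.bit m = x.bit m} ∩ Uᶜ) := by
      intro M
      refine (hF.inter ?_).inter (h𝒰 U hU).isClosed_compl
      simp only [ofPred_forall]
      exact isClosed_iInter fun m => isClosed_iInter fun _ =>
        isClosed_eq (continuous_bit m) continuous_const
    -- By compactness a counterexample for every `M` yields a point outside `U` with all the bits of
    -- `x`, that is, `x` itself.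
    obtain ⟨z, hz⟩ := IsCompact.nonempty_iInter_of_sequence_nonempty_isCompact_isClosed
      (fun M => {x' : Split k h d | k x'.pt = c} ∩ {x' | ∀ m < M, x'.bit m = x.bit m} ∩ Uᶜ)
      (fun M z hz => ⟨⟨hz.1.1, fun m hm => hz.1.2 m (by omega)⟩, hz.2⟩)
      (fun M => by
        obtain ⟨z, h1, h2, h3⟩ := hne M
        exact ⟨z, ⟨h1, h2⟩, h3⟩) (hcl 0).isCompact hcl
    rw [mem_iInter] at hz
    refine (hz 0).2 ?_
    rwa [eq_of_bits hh hd ((hz 0).1.1.trans hx.symm) fun m =>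
      (hz (m + 1)).1.2 m (Nat.lt_succ_self m)]
  choose! U hU M hM using hlocal
  obtain ⟨t, ht, htc⟩ := hF.isCompact.elim_nhds_subcover
    (fun x => {x' | ∀ m ∈ Finset.range (M x), x'.bit m = x.bit m}) (fun x _ => by
      refine (eventually_all_finset _).2 fun m _ => ?_
      exact (continuous_bit m).continuousAt.eventually
        (IsOpen.mem_nhds (isOpen_discrete {x.bit m}) rfl))
  refine ⟨t.sup M, fun x hx => ?_⟩
  obtain ⟨z, hz, hxz⟩ := mem_iUnion₂.1 (htc hx)
  refine ⟨U z, hU z (ht z hz), fun x' hx' hb => hM z (ht z hz) x' hx' fun m hm => ?_⟩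
  rw [hb m (hm.trans_le (Finset.le_sup hz)), hxz m (Finset.mem_range.2 hm)]

/-- Levels not met by the fibre have a constant bit on it and are discarded, so that every interval
between the remaining cuts is occupied. -/
theorem exists_fiber_cuts [T1Space K] (hh : IsHeight k h) (hd : DenseRange d)
    (hinj : Function.Injective d) {𝒰 : Set (Set (Split k h d))}
    (h𝒰 : ∀ U ∈ 𝒰, IsOpen U) (hcov : ⋃₀ 𝒰 = univ) (c : K) :
    ∃ (n : ℕ) (s : ℕ → ℕ) (U : ℕ → Set (Split k h d)),
      (∀ i j, i < j → j < n → d (s i) < d (s j)) ∧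
      (∀ i < n, ∃ y, k y = c ∧ h y = d (s i)) ∧ (∀ i, U i ∈ 𝒰) ∧
      ∀ x : Split k h d, k x.pt = c → x ∈ U (cutIndex s n x.bit) := by
  classical
  obtain ⟨M, hM⟩ := exists_forall_bit_eq hh hd h𝒰 hcov c
  obtain ⟨n, s, hs, hmem⟩ := exists_sorted d hinj
    ((Finset.range M).filter fun m => ∃ y, k y = c ∧ h y = d m)
  have hbit : ∀ x y : Split k h d, k x.pt = c → k y.pt = c →
      cutIndex s n x.bit = cutIndex s n y.bit → ∀ m < M, x.bit m = y.bit m := by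
    intro x y hx hy hxy m hm
    by_contra hne
    have key : ∃ z, k z = c ∧ h z = d m := by
      cases hb : x.bit m with
      | true =>
        have hb' : y.bit m = false := by
          rw [hb] at hne
          simpa using Ne.symm hne
        obtain ⟨z, hz, hzm⟩ := hh.exists_of_between (hy.trans hx.symm) (y.ge_of_bit hb')
          (x.le_of_bit hb)
        exact ⟨z, hz.trans hy, hzm⟩
      | false =>
        have hb' : y.bit m = true := by
          rw [hb] at hne
          simpa using Ne.symm hne
        obtain ⟨z, hz, hzm⟩ := hh.exists_of_between (hx.trans hy.symm) (x.ge_of_bit hb)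
          (y.le_of_bit hb')
        exact ⟨z, hz.trans hx, hzm⟩
    obtain ⟨i, hi, rfl⟩ := (hmem m).1 (Finset.mem_filter.2 ⟨Finset.mem_range.2 hm, key⟩)
    exact hne (bit_eq_of_cutIndex_eq hs hxy hi)
  have hU : ∀ i, ∃ U ∈ 𝒰, ∀ x : Split k h d, k x.pt = c → cutIndex s n x.bit = i → x ∈ U := by
    intro i
    by_cases hi : ∃ x : Split k h d, k x.pt = c ∧ cutIndex s n x.bit = i
    · obtain ⟨x, hx, rfl⟩ := hi
      obtain ⟨U, hU, h'⟩ := hM x hx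
      exact ⟨U, hU, fun y hy hyx => h' y hy (hbit y x hy hx hyx)⟩
    · push Not at hi
      obtain ⟨y, hy⟩ := hh.surjective c
      obtain ⟨U, hU, -⟩ := hM (lo k h d y) hy
      exact ⟨U, hU, fun x hx hxi => absurd hxi (hi x hx)⟩
  choose U hU hxU using hU
  refine ⟨n, s, U, hs, fun i hi => ?_, hU, fun x hx => hxU _ x hx rfl⟩
  exact (Finset.mem_filter.1 ((hmem (s i)).2 ⟨i, hi, rfl⟩)).2

end Split

/-- Each selected fibre contributes one chain, numbered by its cuts; neighbouring fibres use the
cuts of the selected one. Since the selection is idempotent, the selected fibre itself maps onto its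
whole chain, and the points on its cuts realise the edges. -/
theorem Split.refining {Y K : Type} [TopologicalSpace Y] [CompactSpace Y] [T2Space Y]
    [TopologicalSpace K] [CompactSpace K] [T2Space K] [TotallyDisconnectedSpace K] [Nonempty K]
    {k : Y → K} {h : Y → ℝ} {d : ℕ → ℝ} (hh : IsHeight k h) (hd : DenseRange d)
    (hinj : Function.Injective d) : Refining (Split k h d) := by
  intro 𝒰 h𝒰 hcov
  choose n s U hs hhit hU hxU using
    exists_fiber_cuts hh hd hinj (fun U hU => (h𝒰 U hU).isOpen) hcov
  obtain ⟨j, hj, hjV, hidem⟩ := exists_selection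
    (fun c => {c' | ∀ x : Split k h d, k x.pt = c' →
      x ∉ {x : Split k h d | x ∉ U c (cutIndex (s c) (n c) x.bit)}})
    (fun c => nhds_fiber hh (by
      rw [← isOpen_compl_iff, isOpen_iff_mem_nhds]
      intro x hx
      have hx' : x ∈ U c (cutIndex (s c) (n c) x.bit) := not_not.1 hx
      filter_upwards [isLocallyConstant_cutIndex.eventually_eq x,
        (h𝒰 _ (hU c _)).isOpen.mem_nhds hx'] with y hy hyU
      rw [← hy] at hyU
      exact not_not.2 hyU) fun x hx => not_not.2 (hxU c x hx))
  let ι := {c : K // j c = c}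
  have hfin : Finite ι := (hj.range_finite.subset fun c (hc : j c = c) => ⟨c, hc⟩).to_subtype
  have hne : Nonempty ι := ⟨⟨j (Classical.arbitrary K), hidem _⟩⟩
  let N : ι → ℕ := fun c => n c
  -- `j c` replaces `c` so that the index is always a fixed point of `j`.
  let ℓ : K → Split k h d → ChainSum N := fun c x =>
    ⟨⟨j c, hidem c⟩, ⟨cutIndex (s (j c)) (n (j c)) x.bit, Nat.lt_succ_of_le cutIndex_le⟩⟩
  have hℓ : ∀ c, IsHom (ℓ c) := fun c =>
    { continuous := by
        refine IsLocallyConstant.continuous ((IsLocallyConstant.iff_eventually_eq _).2 fun x => ?_)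
        filter_upwards [isLocallyConstant_cutIndex.eventually_eq x] with y hy
        exact ChainSum.ext rfl hy
      map_R := fun x y hxy => ⟨rfl, cutIndex_le_succ (hs _) (Eq.symm hxy),
        cutIndex_le_succ (hs _) hxy⟩
      map_le := fun x y hxy => ⟨rfl, cutIndex_mono hxy⟩ }
  have hval : ∀ (c : ι) (i : Fin (N c + 1)) (x : Split k h d), k x.pt = c →
      cutIndex (s c) (n c) x.bit = i → ℓ (j (k x.pt)) x = ⟨c, i⟩ := by
    rintro ⟨c, hc⟩ i x hx hi
    have hjj : j (j (k x.pt)) = c := by rw [hidem, hx, hc]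
    refine ChainSum.ext (Subtype.ext hjj) ?_
    simp only [ℓ, hjj]
    exact hi
  have hreal : ∀ (c : ι) (i : Fin (N c + 1)), ∃ x : Split k h d, k x.pt = c ∧
      cutIndex (s c) (n c) x.bit = i := fun c i =>
    exists_cutIndex_eq hh (hs c) (hhit c) (Nat.lt_succ_iff.1 i.2)
  have hsurj : Function.Surjective fun x : Split k h d => ℓ (j (k x.pt)) x := by
    rintro ⟨c, i⟩
    obtain ⟨x, hx, hi⟩ := hreal c i
    exact ⟨x, hval c i x hx hi⟩
  have hR : ∀ (c : ι) (i i' : Fin (N c + 1)), (i' : ℕ) = i + 1 → ∃ x x' : Split k h d,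
      ℓ (j (k x.pt)) x = ⟨c, i⟩ ∧ ℓ (j (k x'.pt)) x' = ⟨c, i'⟩ ∧ LRStructure.R x x' := by
    intro c i i' hi
    have hin : (i : ℕ) < n c := by
      have h' := i'.2
      rw [hi] at h'
      exact Nat.lt_of_succ_lt_succ h'
    obtain ⟨y, hy, hys⟩ := hhit c i hin
    obtain ⟨h1, h2⟩ := cutIndex_lo_up (k := k) (hs c) hin hys
    exact ⟨lo k h d y, up k h d y, hval c i _ hy h1, hval c i' _ hy (h2.trans hi.symm), R_lo_up y⟩
  refine ⟨ChainSum N, inferInstance, inferInstance, inferInstance, _,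
    ChainSum.isFiniteHForest N, .of_isHom (isHom_patch hh hℓ hj) hsurj ?_ ?_, ?_⟩
  · rintro ⟨c, i⟩ ⟨c', i'⟩ ⟨hc, h1, h2⟩
    obtain rfl : c = c' := hc
    simp only at h1 h2
    rcases lt_trichotomy (i : ℕ) i' with hlt | heq | hlt
    · exact hR c i i' (by omega)
    · obtain rfl := Fin.ext heq
      obtain ⟨x, hx⟩ := hsurj ⟨c, i⟩
      exact ⟨x, x, hx, hx, rfl⟩
    · obtain ⟨x, x', hx, hx', hxx⟩ := hR c i' i (by omega)
      exact ⟨x', x, hx', hx, Eq.symm hxx⟩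
  · rintro ⟨c, i⟩ ⟨c', i'⟩ ⟨hc, h1⟩
    obtain rfl : c = c' := hc
    simp only at h1
    rcases h1.lt_or_eq with hlt | heq
    · obtain ⟨x, hx, hi⟩ := hreal c i
      obtain ⟨x', hx', hi'⟩ := hreal c i'
      exact ⟨x, x', hval c i x hx hi, hval c i' x' hx' hi', le_of_cutIndex_lt (s := s c) (n := n c)
        hinj (hx.trans hx'.symm) (by rwa [hi, hi'])⟩
    · obtain rfl := Fin.ext heq
      obtain ⟨x, hx⟩ := hsurj ⟨c, i⟩
      exact ⟨x, x, hx, hx, Split.le_refl x⟩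
  · rintro ⟨⟨c, hc⟩, i⟩
    refine ⟨U c i, hU c i, fun x hx => ?_⟩
    have hx' : ℓ (j (k x.pt)) x = ⟨⟨c, hc⟩, i⟩ := hx
    have h1 : j (j (k x.pt)) = c := congrArg (fun p : ChainSum N => (p.1 : K)) hx'
    have h2 : cutIndex (s (j (j (k x.pt)))) (n (j (j (k x.pt)))) x.bit = i :=
      congrArg (fun p : ChainSum N => (p.2 : ℕ)) hx'
    have h3 := not_not.1 (hjV (k x.pt) x rfl)
    rw [h1] at h2
    rw [hidem] at h1
    rw [h1, h2] at h3
    exact h3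

/-! ### Homogeneity by back-and-forth -/

section Homogeneity

variable {L : Type u} [TopologicalSpace L]

theorem exists_of_compatible [CompactSpace L] {T : ℕ → Type v} [∀ n, TopologicalSpace (T n)]
    [∀ n, DiscreteTopology (T n)] {f : ∀ n, L → T n} (hf : ∀ n, Continuous (f n))
    (hs : ∀ n, Function.Surjective (f n)) {t : ∀ n, T n}
    (ht : ∀ n x, f (n + 1) x = t (n + 1) → f n x = t n) : ∃ x, ∀ n, f n x = t n := by
  have hcl : ∀ n, IsClosed (f n ⁻¹' {t n}) := fun n => (isClosed_discrete _).preimage (hf n)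
  obtain ⟨x, hx⟩ := IsCompact.nonempty_iInter_of_sequence_nonempty_isCompact_isClosed
    (fun n => f n ⁻¹' {t n}) ht (fun n => hs n (t n)) (hcl 0).isCompact hcl
  exact ⟨x, mem_iInter.1 hx⟩

variable [LRStructure L]

theorem IsTopStructure.rel_of_forall_nat (hL : IsTopStructure L) {T : ℕ → Type v}
    {f : ∀ n, L → T n} (hmono : ∀ n m, n ≤ m → ∀ x y, f m x = f m y → f n x = f n y)
    (hsep : ∀ U : Set L, IsClopen U → ∃ n, ∀ x y, f n x = f n y → x ∈ U → y ∈ U)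
    {r : L → L → Prop} (hr : IsClosed {p : L × L | r p.1 p.2}) {x y : L}
    (h : ∀ n, ∃ u v, f n u = f n x ∧ f n v = f n y ∧ r u v) : r x y := by
  by_contra hxy
  obtain ⟨U, V, hU, hV, hx, hy, hUV⟩ := hL.exists_clopen_rectangle hr hxy
  obtain ⟨n, hn⟩ := hsep U hU
  obtain ⟨m, hm⟩ := hsep V hV
  obtain ⟨u, v, hu, hv, huv⟩ := h (max n m)
  exact hUV u (hn x u (hmono _ _ (le_max_left n m) _ _ hu.symm) hx) v
    (hm y v (hmono _ _ (le_max_right n m) _ _ hv.symm) hy) huv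

/-- Two epimorphisms onto a common finite Hasse forest. -/
structure EpiPair (L : Type u) [TopologicalSpace L] [LRStructure L] where
  /-- the common target -/
  A : Type
  [top : TopologicalSpace A]
  [disc : DiscreteTopology A]
  [str : LRStructure A]
  /-- the first epimorphism -/
  α : L → A
  /-- the second epimorphism -/
  β : L → A
  forest : IsFiniteHForest A
  epi_α : IsEpi α
  epi_β : IsEpi β

namespace EpiPair

attribute [instance] EpiPair.top EpiPair.disc EpiPair.str

/-- The pair with the two epimorphisms interchanged. -/
def swap (P : EpiPair L) : EpiPair L := ⟨P.A, P.β, P.α, P.forest, P.epi_β, P.epi_α⟩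

/-- Identifications made by the second pair are already made by the first one. -/
def Le (P Q : EpiPair L) : Prop := ∀ x y, Q.α x = Q.β y → P.α x = P.β y

theorem Le.swap {P Q : EpiPair L} (h : P.Le Q) : P.swap.Le Q.swap :=
  fun x y hxy => (h y x hxy.symm).symm

theorem Le.trans {P Q S : EpiPair L} (h : P.Le Q) (h' : Q.Le S) : P.Le S :=
  fun x y hxy => h x y (h' x y hxy)

theorem Le.eq_of_eq {P Q : EpiPair L} (h : P.Le Q) {x y : L} (hxy : Q.α x = Q.α y) :
    P.α x = P.α y := by
  obtain ⟨z, hz⟩ := Q.epi_β.surjective (Q.α x)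
  exact (h x z hz.symm).trans (h y z (hxy.symm.trans hz.symm)).symm

/-- Epimorphisms onto finite Hasse forests lift along epimorphisms of finite Hasse forests. -/
def _root_.FraisseFence.Lifting (L : Type u) [TopologicalSpace L] [LRStructure L] : Prop :=
  ∀ (A B : Type) [TopologicalSpace A] [DiscreteTopology A] [LRStructure A]
    [TopologicalSpace B] [DiscreteTopology B] [LRStructure B], IsFiniteHForest A →
    IsFiniteHForest B → ∀ φ : L → A, IsEpi φ → ∀ g : B → A, IsEpi g →
      ∃ ℓ : L → B, IsEpi ℓ ∧ g ∘ ℓ = φ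

/-- Half a step of back-and-forth: `α` is refined until it decides `U`, and the other epimorphism is
lifted along the resulting map of forests. Swapping the two gives the other half. -/
theorem exists_le_separating (hR : Refining L) (hE : Lifting L) (P : EpiPair L) {U : Set L}
    (hU : IsClopen U) : ∃ Q : EpiPair L, P.Le Q ∧ ∀ x y, Q.α x = Q.α y → x ∈ U → y ∈ U := by
  obtain ⟨B, _, _, _, α', hB, hα', hsep⟩ := hR.exists_factor (κ := fun x => (P.α x, x ∈ U))
    (((IsLocallyConstant.iff_continuous _).2 P.epi_α.continuous).prodMk (isLocallyConstant_mem hU))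
  have hfac : ∃ g : B → P.A, g ∘ α' = P.α := by
    choose i hi using hα'.surjective
    exact ⟨P.α ∘ i, funext fun x => congrArg Prod.fst (hsep _ _ (hi (α' x)))⟩
  obtain ⟨g, hg⟩ := hfac
  have hge : IsEpi g := hα'.of_comp (hg ▸ P.epi_α)
  obtain ⟨β', hβ', hgβ⟩ := hE P.A B P.forest hB P.β P.epi_β g hge
  refine ⟨⟨B, α', β', hB, hα', hβ'⟩, fun x y hxy => ?_, fun x y hxy hx => ?_⟩
  · rw [← hg, ← hgβ]
    exact congrArg g hxy
  · exact (congrArg Prod.snd (hsep _ _ hxy)).mp hx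

theorem exists_le_separating₂ (hR : Refining L) (hE : Lifting L) (P : EpiPair L) {U : Set L}
    (hU : IsClopen U) : ∃ Q : EpiPair L, P.Le Q ∧ (∀ x y, Q.α x = Q.α y → x ∈ U → y ∈ U) ∧
      ∀ x y, Q.β x = Q.β y → x ∈ U → y ∈ U := by
  obtain ⟨Q, hPQ, hQ⟩ := P.exists_le_separating hR hE hU
  obtain ⟨S, hQS, hS⟩ := Q.swap.exists_le_separating hR hE hU
  exact ⟨S.swap, hPQ.trans hQS.swap, fun x y hxy => hQ x y (hQS.swap.eq_of_eq hxy), hS⟩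

theorem exists_inverse (hL : IsTopStructure L) {P : ℕ → EpiPair L}
    (hmono : ∀ n, (P n).Le (P (n + 1))) (x : L) : ∃ y, ∀ n, (P n).α x = (P n).β y := by
  have := hL.compact
  obtain ⟨y, hy⟩ := exists_of_compatible (f := fun n => (P n).β) (t := fun n => (P n).α x)
    (fun n => (P n).epi_β.continuous) (fun n => (P n).epi_β.surjective)
    (fun n y hy => (hmono n x y hy.symm).symm)
  exact ⟨y, fun n => (hy n).symm⟩

/-- In the limit, `(P n).α x = (P n).β y` for all `n` is the graph of a bijection: compactness gives
existence in both directions, and uniqueness holds as clopen sets are eventually decided. Closed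
relations are tested on the finite quotients, so they are preserved both ways. -/
theorem exists_aut (hL : IsTopStructure L) {P : ℕ → EpiPair L}
    (hmono : ∀ n, (P n).Le (P (n + 1)))
    (hα : ∀ U : Set L, IsClopen U → ∃ n, ∀ x y, (P n).α x = (P n).α y → x ∈ U → y ∈ U)
    (hβ : ∀ U : Set L, IsClopen U → ∃ n, ∀ x y, (P n).β x = (P n).β y → x ∈ U → y ∈ U) :
    ∃ ψ : L → L, IsAut ψ ∧ ∀ n y, (P n).α (ψ y) = (P n).β y := by
  have := hL.metrizable
  have hle : ∀ n m, n ≤ m → (P n).Le (P m) := by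
    intro n m hnm
    induction m, hnm using Nat.le_induction with
    | base => exact fun _ _ => id
    | succ m _ ih => exact ih.trans (hmono m)
  have relα : ∀ {r : L → L → Prop}, IsClosed {p : L × L | r p.1 p.2} → ∀ {x y : L},
      (∀ n, ∃ u v, (P n).α u = (P n).α x ∧ (P n).α v = (P n).α y ∧ r u v) → r x y :=
    fun hr _ _ => hL.rel_of_forall_nat (f := fun n => (P n).α)
      (fun n m hnm x y => (hle n m hnm).eq_of_eq) hα hr
  have relβ : ∀ {r : L → L → Prop}, IsClosed {p : L × L | r p.1 p.2} → ∀ {x y : L},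
      (∀ n, ∃ u v, (P n).β u = (P n).β x ∧ (P n).β v = (P n).β y ∧ r u v) → r x y :=
    fun hr _ _ => hL.rel_of_forall_nat (f := fun n => (P n).β)
      (fun n m hnm x y => (hle n m hnm).swap.eq_of_eq) hβ hr
  have heq : IsClosed {p : L × L | p.1 = p.2} := isClosed_eq continuous_fst continuous_snd
  choose χ hχ using exists_inverse hL hmono
  choose ψ hψ using exists_inverse hL (P := fun n => (P n).swap) fun n => (hmono n).swap
  have hψ' : ∀ n y, (P n).α (ψ y) = (P n).β y := fun n y => (hψ y n).symm
  have hψχ : ∀ x, ψ (χ x) = x := fun x =>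
    relα heq fun n => ⟨x, x, (hχ x n).trans (hψ (χ x) n), rfl, rfl⟩
  have hχψ : ∀ y, χ (ψ y) = y := fun y =>
    relβ heq fun n => ⟨y, y, (hψ y n).trans (hχ (ψ y) n), rfl, rfl⟩
  have hcont : Continuous ψ := by
    refine hL.zeroDim.continuous_iff.2 fun U hU => ?_
    obtain ⟨n, hn⟩ := hα U hU
    have : ψ ⁻¹' U = (P n).β ⁻¹' ((P n).α '' U) := by
      ext y
      refine ⟨fun hy => ⟨ψ y, hy, hψ' n y⟩, ?_⟩
      rintro ⟨x, hx, hxy⟩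
      exact hn x _ (hxy.trans (hψ' n y).symm) hx
    rw [this]
    exact (isOpen_discrete _).preimage (P n).epi_β.continuous
  refine ⟨ψ, ⟨.of_isHom ⟨hcont, fun y y' hy => ?_, fun y y' hy => ?_⟩ (fun x => ⟨χ x, hψχ x⟩)
    (fun x x' hx => ⟨χ x, χ x', hψχ x, hψχ x', ?_⟩)
    (fun x x' hx => ⟨χ x, χ x', hψχ x, hψχ x', ?_⟩),
    Function.bijective_iff_has_inverse.2 ⟨χ, hχψ, hψχ⟩⟩, hψ'⟩
  · refine relα hL.isClosed_R fun n => ?_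
    rw [hψ', hψ']
    exact ((P n).epi_α.R_iff _ _).1 ((P n).epi_β.isHom.map_R _ _ hy)
  · refine relα hL.isClosed_le fun n => ?_
    rw [hψ', hψ']
    exact ((P n).epi_α.le_iff _ _).1 ((P n).epi_β.isHom.map_le _ _ hy)
  · refine relβ hL.isClosed_R fun n => ?_
    rw [← hχ, ← hχ]
    exact ((P n).epi_β.R_iff _ _).1 ((P n).epi_α.isHom.map_R _ _ hx)
  · refine relβ hL.isClosed_le fun n => ?_
    rw [← hχ, ← hχ]
    exact ((P n).epi_β.le_iff _ _).1 ((P n).epi_α.isHom.map_le _ _ hx)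

end EpiPair

theorem IsTopStructure.exists_enum_clopen (hL : IsTopStructure L) :
    ∃ U : ℕ → Set L, (∀ n, IsClopen (U n)) ∧ ∀ V, IsClopen V → ∃ n, U n = V := by
  have := hL.compact
  have := hL.metrizable
  let _ := TopologicalSpace.metrizableSpaceMetric L
  have : TotallySeparatedSpace L := totallySeparatedSpace_iff_exists_isClopen.2 fun x y hxy => by
    obtain ⟨U, V, hU, -, hx, hy, hUV⟩ := hL.exists_clopen_rectangle (r := (· = ·))
      (isClosed_eq continuous_fst continuous_snd) hxy
    exact ⟨U, hU, hx, fun hyU => hUV y hyU y hy rfl⟩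
  have : Countable (TopologicalSpace.Clopens L) :=
    TopologicalSpace.Clopens.countable_iff_secondCountable.2 inferInstance
  obtain ⟨e, he⟩ := exists_surjective_nat (TopologicalSpace.Clopens L)
  refine ⟨fun n => e n, fun n => (e n).isClopen, fun V hV => ?_⟩
  obtain ⟨n, hn⟩ := he ⟨V, hV⟩
  exact ⟨n, congrArg SetLike.coe hn⟩

theorem IsTopStructure.homogeneous (hL : IsTopStructure L) (hR : Refining L) (hE : Lifting L)
    {A : Type} [TopologicalSpace A] [DiscreteTopology A] [LRStructure A] (hA : IsFiniteHForest A)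
    {φ₁ φ₂ : L → A} (h₁ : IsEpi φ₁) (h₂ : IsEpi φ₂) : ∃ ψ : L → L, IsAut ψ ∧ φ₂ = φ₁ ∘ ψ := by
  obtain ⟨U, hU, hUs⟩ := hL.exists_enum_clopen
  choose S hS hSα hSβ using fun (P : EpiPair L) (n : ℕ) => P.exists_le_separating₂ hR hE (hU n)
  let P : ℕ → EpiPair L := fun n => Nat.rec ⟨A, φ₁, φ₂, hA, h₁, h₂⟩ (fun n Q => S Q n) n
  obtain ⟨ψ, hψ, h⟩ := EpiPair.exists_aut hL (P := P) (fun n => hS (P n) n)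
    (fun V hV => by
      obtain ⟨n, rfl⟩ := hUs V hV
      exact ⟨n + 1, hSα (P n) n⟩)
    (fun V hV => by
      obtain ⟨n, rfl⟩ := hUs V hV
      exact ⟨n + 1, hSβ (P n) n⟩)
  exact ⟨ψ, hψ, funext fun y => (h 0 y).symm⟩

theorem isEpi_const {X : Type v} [TopologicalSpace X] [LRStructure X] [Nonempty X]
    (hle : ∀ x : X, LRStructure.le x x) (hR : ∀ x : X, LRStructure.R x x)
    {T : Type w} [TopologicalSpace T] [LRStructure T] (hT : IsFiniteHForest T) [Subsingleton T]
    (t : T) : IsEpi (fun _ : X => t) := by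
  let x : X := Classical.arbitrary X
  exact .of_isHom ⟨continuous_const, fun _ _ _ => hT.isHPO.R_refl _,
    fun _ _ _ => hT.isHPO.le_refl _⟩ (fun p => ⟨x, Subsingleton.elim _ _⟩)
    (fun p q _ => ⟨x, x, Subsingleton.elim _ _, Subsingleton.elim _ _, hR x⟩)
    (fun p q _ => ⟨x, x, Subsingleton.elim _ _, Subsingleton.elim _ _, hle x⟩)

theorem IsTopStructure.isProjFraisseLimit [Nonempty L] (hL : IsTopStructure L) (hR : Refining L)
    (hE : Lifting L) : IsProjFraisseLimit L where
  isTopStructure := hL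
  refines := hR
  homogeneous A _ _ _ hA _ _ h₁ h₂ := hL.homogeneous hR hE hA h₁ h₂
  universal A _ _ _ hA := by
    -- A one-point structure: both `L` and `A` map onto it, and lifting the first map along the
    -- second gives `L → A`.
    have hT := ChainSum.isFiniteHForest (fun _ : Unit => 0)
    have : Subsingleton (ChainSum fun _ : Unit => 0) := ⟨fun p q =>
      ChainSum.ext rfl ((Nat.lt_one_iff.1 p.2.2).trans (Nat.lt_one_iff.1 q.2.2).symm)⟩
    obtain ⟨t⟩ := hT.nonempty
    have := hA.nonempty
    obtain ⟨φ, hφ, -⟩ := hE _ A hT hA (fun _ => t)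
      (isEpi_const (hR.le_refl hL) (fun x => hR.rel_of_forall hL hL.isClosed_R
        fun A _ _ _ φ hA hφ => (hφ.R_iff _ _).1 (hA.isHPO.R_refl _)) hT t)
      (fun _ => t) (isEpi_const hA.isHPO.le_refl hA.isHPO.R_refl hT t)
    exact ⟨φ, hφ⟩

end Homogeneity

/-! ### Sufficiency: the quotient of the split space -/

theorem Split.isProjFraisseLimit {Y K : Type} [TopologicalSpace Y] [CompactSpace Y] [T2Space Y]
    [SecondCountableTopology Y] [Nonempty Y]
    [TopologicalSpace K] [CompactSpace K] [T2Space K] [TotallyDisconnectedSpace K]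
    {k : Y → K} {h : Y → ℝ} {d : ℕ → ℝ} (hh : IsHeight k h) (hd : IsGeneric k h d)
    (harc : HasDenseArcs k h) : IsProjFraisseLimit (Split k h d) :=
  have : Nonempty K := .map k inferInstance
  have : Nonempty (Split k h d) := .map (lo k h d) inferInstance
  (isTopStructure hh hd.denseRange).isProjFraisseLimit
    (refining hh hd.denseRange hd.injective)
    fun _ _ _ _ _ _ _ _ hA hB _ hφ _ hg => exists_lift hh hd harc hA hB hφ hg

theorem HasDenseArcs.isFraisseFence {Y K : Type} [TopologicalSpace Y] [CompactSpace Y] [T2Space Y]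
    [SecondCountableTopology Y] [Nonempty Y]
    [TopologicalSpace K] [CompactSpace K] [T2Space K] [TotallyDisconnectedSpace K]
    {k : Y → K} {h : Y → ℝ} (harc : HasDenseArcs k h) (hh : IsHeight k h) : IsFraisseFence Y := by
  obtain ⟨d, hd⟩ := exists_isGeneric hh harc
  have hq : IsQuotientMap (⟨Split.pt, Split.continuous_pt⟩ : C(Split k h d, Y)) :=
    (Split.isClosedMap_pt hh.continuous_h).isQuotientMap Split.continuous_pt Split.surjective_pt
  exact ⟨Split k h d, inferInstance, inferInstance, Split.isProjFraisseLimit hh hd harc,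
    ⟨fun _ => rfl, Eq.symm, Eq.trans⟩, ⟨hq.homeomorph.symm⟩⟩

theorem IsFraisseFence.of_homeomorph {Y : Type u} {Z : Type v} [TopologicalSpace Y]
    [TopologicalSpace Z] (e : Y ≃ₜ Z) (hZ : IsFraisseFence Z) : IsFraisseFence Y := by
  obtain ⟨L, _, _, hL, h, ⟨g⟩⟩ := hZ
  exact ⟨L, _, _, hL, h, ⟨e.trans g⟩⟩

section Components

variable {Y : Type u} [TopologicalSpace Y]

theorem coe_connectedComponents_homeomorph {Z : Type v} [TopologicalSpace Z] (e : Y ≃ₜ Z)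
    {x y : Y} :
    (e x : ConnectedComponents Z) = e y ↔ (x : ConnectedComponents Y) = y := by
  simp only [ConnectedComponents.coe_eq_coe']
  refine ⟨fun h => ?_, fun h => e.continuous.mapsTo_connectedComponent y h⟩
  simpa using e.symm.continuous.mapsTo_connectedComponent (e y) h

theorem isHeight_coe {h : Y → ℝ} (hc : Continuous h)
    (hinj : ∀ x y : Y, (x : ConnectedComponents Y) = y → h x = h y → x = y) :
    IsHeight (ConnectedComponents.mk : Y → ConnectedComponents Y) h where
  continuous_k := ConnectedComponents.continuous_coe
  continuous_h := hc
  surjective := ConnectedComponents.surjective_coe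
  preconnected := by
    intro c
    obtain ⟨x, rfl⟩ := ConnectedComponents.surjective_coe c
    rw [connectedComponents_preimage_singleton]
    exact isPreconnected_connectedComponent
  inj := hinj

theorem hasDenseArcs_coe {h : Y → ℝ} (hc : Continuous h)
    (hinj : ∀ x y : Y, (x : ConnectedComponents Y) = y → h x = h y → x = y)
    (harc : ∀ O O' : Set Y, IsOpen O → IsOpen O' →
        (∃ x : Y, (O ∩ connectedComponent x).Nonempty ∧ (O' ∩ connectedComponent x).Nonempty) →
        ∃ z a b : Y, IsArcWithEndpoints (connectedComponent z) a b ∧ a ∈ O ∧ b ∈ O') :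
    HasDenseArcs (ConnectedComponents.mk : Y → ConnectedComponents Y) h := by
  intro O O' hO hO' x hx y hy hxy
  obtain ⟨z, a, b, hz, ha, hb⟩ := harc O O' hO hO' ⟨x, ⟨x, hx, mem_connectedComponent⟩,
    ⟨y, hy, ConnectedComponents.coe_eq_coe'.1 hxy.symm⟩⟩
  have hmem : ∀ w, w ∈ connectedComponent z ↔ ConnectedComponents.mk w = ConnectedComponents.mk z :=
    fun w => ConnectedComponents.coe_eq_coe'.symm
  have haz := (hmem a).1 hz.mem_left
  have hbz := (hmem b).1 hz.symm.mem_left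
  rcases hz.extreme hc fun s hs t ht => hinj s t (((hmem s).1 hs).trans ((hmem t).1 ht).symm)
    with H | H
  · exact ⟨a, b, hz.ne, haz.trans hbz.symm, fun w hw => H w ((hmem w).2 (hw.trans haz)),
      .inl ⟨ha, hb⟩⟩
  · exact ⟨b, a, hz.symm.ne, hbz.trans haz.symm, fun w hw => H w ((hmem w).2 (hw.trans hbz)),
      .inr ⟨hb, ha⟩⟩

theorem HasDenseArcs.homeomorph {h : Y → ℝ} {Z : Type v} [TopologicalSpace Z] (e : Y ≃ₜ Z)
    (harc : HasDenseArcs (ConnectedComponents.mk : Y → ConnectedComponents Y) h) :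
    HasDenseArcs (ConnectedComponents.mk : Z → ConnectedComponents Z) (h ∘ e.symm) := by
  intro O O' hO hO' x hx y hy hxy
  obtain ⟨a, b, hab, hk, hext, H⟩ := harc (e ⁻¹' O) (e ⁻¹' O') (hO.preimage e.continuous)
    (hO'.preimage e.continuous) (e.symm x) (by simpa) (e.symm y) (by simpa)
    ((coe_connectedComponents_homeomorph e.symm).2 hxy)
  refine ⟨e a, e b, e.injective.ne hab, (coe_connectedComponents_homeomorph e).2 hk,
    fun w hw => ?_, H⟩
  simpa using hext (e.symm w) ((coe_connectedComponents_homeomorph e).1 (by simpa using hw))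

theorem IsSmoothFence.isFraisseFence [Nonempty Y] (hY : IsSmoothFence Y)
    (harc : ∀ O O' : Set Y, IsOpen O → IsOpen O' →
        (∃ x : Y, (O ∩ connectedComponent x).Nonempty ∧ (O' ∩ connectedComponent x).Nonempty) →
        ∃ z a b : Y, IsArcWithEndpoints (connectedComponent z) a b ∧ a ∈ O ∧ b ∈ O') :
    IsFraisseFence Y := by
  have := hY.compact
  have := hY.metrizable
  let _ := TopologicalSpace.metrizableSpaceMetric Y
  obtain ⟨h, hc, hinj⟩ := hY.exists_height
  -- The definition of a Fraïssé fence asks for a limit in `Type`, so `Y` is first replaced by its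
  -- isometric copy in a space of bounded real sequences.
  let e := (kuratowskiEmbedding.isometry Y).isometryEquivOnRange.toHomeomorph
  have := e.compactSpace
  have := e.symm.surjective.nonempty
  refine .of_homeomorph e (((hasDenseArcs_coe hc hinj harc).homeomorph e).isFraisseFence
    (isHeight_coe (hc.comp e.symm.continuous) fun x y hxy hh => ?_))
  exact e.symm.injective (hinj _ _ ((coe_connectedComponents_homeomorph e.symm).2 hxy) hh)

end Components

end FraisseFence

theorem mainTheorem1 {Y : Type*} [TopologicalSpace Y] [Nonempty Y]
    (hY : FraisseFence.IsSmoothFence Y) :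
    FraisseFence.IsFraisseFence Y ↔
      ∀ O O' : Set Y, IsOpen O → IsOpen O' →
        (∃ x : Y, (O ∩ connectedComponent x).Nonempty ∧ (O' ∩ connectedComponent x).Nonempty) →
        ∃ z a b : Y, FraisseFence.IsArcWithEndpoints (connectedComponent z) a b ∧
          a ∈ O ∧ b ∈ O' :=
  ⟨fun hF _ _ hO hO' ⟨_, hx, hx'⟩ => hF.exists_arc hY.toIsFence hO hO' hx hx',
    fun harc => hY.isFraisseFence harc⟩
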